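/- Let $B:\mathbb R^2\to\mathbb R$ satisfy $B\in L^p_{\rm loc}(\mathbb R^2)$ for some $p>2$ and $|B(x)|=\mathcal O(|x|^{-\tau})$ as $|x|\to\infty$ for some $\tau>2$. Put $$\alpha=\frac1{2\pi}\int_{\mathbb R^2}B\,dx,\qquad \mu_\alpha=\min_{m\in\mathbb Z}|m-\alpha|,\qquad h(x)=-\frac1{2\pi}\int_{\mathbb R^2}B(y)\log|x-y|\,dy,\qquad A_h=(\partial_{x_2}h,-\partial_{x_1}h).$$ For $\rho>0$ let $g_+(\rho;r)=1$ if $r\le\rho$ and $g_+(\rho;r)=\rho^{-\alpha}r^{\alpha}$ if $r>\rho$, let $g_-=1/g_+$, and define $$k_-(\rho)=\inf_{x\in\mathbb R^2}\frac{e^{h(x)}}{g_-(\rho;|x|)},\qquad K_-(\rho)=\sup_{x\in\mathbb R^2}\frac{e^{h(x)}}{g_-(\rho;|x|)},\qquad \beta_-(B;\rho)=\Big(\frac{k_-(\rho)}{K_-(\rho)}\Big)^2 .$$ For $u\in H^1(\mathbb R^2)$ (complex valued) let $$Q_-[u]=\int_{\mathbb R^2}\big(|(i\nabla+A_h)u|^2-B|u|^2\big)\,dx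 .$$ **Theorem.** Suppose that $\alpha\le 0$. Then for all $u\in H^1(\mathbb R^2)$ and all $\rho>0$ the integrals below and the one defining $Q_-[u]$ converge absolutely, and $$Q_-[u]\ \ge\ \beta_-(B;\rho)\,\mu_\alpha^2\int_{\mathbb R^2}\frac{|u|^2}{\rho^2+|x|^2}\,dx\qquad\text{if }\alpha\notin\mathbb Z,$$ $$Q_-[u]\ \ge\ \beta_-(B;\rho)\,\frac{|\alpha|}{4|\alpha|+\pi}\int_{\mathbb R^2}\frac{|u|^2}{\rho^2+|x|^2\big(1+\log^2(|x|/\rho)\big)}\,dx\qquad\text{if }\alpha\in\mathbb Z.$$ -/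

import Mathlib

open MeasureTheory
open scoped ENNReal ContDiff

noncomputable section

namespace PauliHardy

/-- The Euclidean plane `ℝ²`, with its Euclidean norm and Lebesgue measure. -/
abbrev Plane : Type := EuclideanSpace ℝ (Fin 2)

/-- The `j`-th standard unit vector of the plane. -/
def unitVec (j : Fin 2) : Plane := EuclideanSpace.single j (1 : ℝ)

/-- The classical `j`-th partial derivative of a real function on the plane. -/
def partialD (j : Fin 2) (f : Plane → ℝ) (x : Plane) : ℝ := fderiv ℝ f x (unitVec j)

/-! ### The Sobolev space of order one -/

/-- `w` lies in `L²` and is the `j`-th partial derivative of `u` in the sense of distributions: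
`∫ (∂_j φ) u = - ∫ φ w` for all test functions `φ`. -/
def IsL2WeakPartial (j : Fin 2) (u w : Plane → ℂ) : Prop :=
  MemLp w 2 volume ∧
    ∀ φ : Plane → ℝ, ContDiff ℝ ∞ φ → HasCompactSupport φ →
      ∫ x, (partialD j φ x : ℂ) * u x = -∫ x, (φ x : ℂ) * w x

/-- `u ∈ H¹(ℝ²)`: the function and its first weak partial derivatives lie in `L²`. -/
def MemH1 (u : Plane → ℂ) : Prop :=
  MemLp u 2 volume ∧ ∀ j : Fin 2, ∃ w : Plane → ℂ, IsL2WeakPartial j u w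

open Classical in
/-- The `j`-th weak partial derivative of `u` (unique up to null sets when `u ∈ H¹`). -/
def weakPartial (j : Fin 2) (u : Plane → ℂ) : Plane → ℂ :=
  if hw : ∃ w : Plane → ℂ, IsL2WeakPartial j u w then hw.choose else 0

/-! ### The magnetic field, its flux and its vector potential -/

/-- The standing assumption on the field: `B ∈ L^p_loc(ℝ²)` for some `p > 2`, and
`|B(x)| = O(|x|^{-τ})` at infinity for some `τ > 2`. -/
def AdmissibleField (B : Plane → ℝ) : Prop :=
  (∃ p : ℝ≥0∞, 2 < p ∧ ∀ K : Set Plane, IsCompact K → MemLp B p (volume.restrict K)) ∧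
  (∃ τ : ℝ, 2 < τ ∧ ∃ C R : ℝ, ∀ᵐ x : Plane, R ≤ ‖x‖ → |B x| ≤ C * ‖x‖ ^ (-τ))

/-- The normalized flux `α = (2π)⁻¹ ∫ B`. -/
def flux (B : Plane → ℝ) : ℝ := 1 / (2 * Real.pi) * ∫ x, B x

/-- The distance `μ_α = min_{m ∈ ℤ} |m - α|` of `α` from the integers. -/
def distInt (α : ℝ) : ℝ := ⨅ m : ℤ, |(m : ℝ) - α|

/-- The scalar potential `h(x) = -(2π)⁻¹ ∫ B(y) log |x - y| dy`. -/
def scalarPot (B : Plane → ℝ) (x : Plane) : ℝ :=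
  -(1 / (2 * Real.pi)) * ∫ y, B y * Real.log ‖x - y‖

/-- The vector potential `A_h = (∂₂ h, -∂₁ h)`. -/
def vectorPot (B : Plane → ℝ) (x : Plane) : Fin 2 → ℝ :=
  ![partialD 1 (scalarPot B) x, -partialD 0 (scalarPot B) x]

/-! ### The constant `β₋(B; ρ)` -/

/-- `g₊(ρ; r)`: it is `1` for `r ≤ ρ` and `ρ^{-α} r^α` for `r > ρ`. -/
def gPlus (α ρ r : ℝ) : ℝ := if r ≤ ρ then 1 else ρ ^ (-α) * r ^ α

/-- `g₋ = 1 / g₊`. -/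
def gMinus (α ρ r : ℝ) : ℝ := 1 / gPlus α ρ r

/-- `k₋(ρ) = inf_x e^{h(x)} / g₋(ρ; |x|)`. -/
def kMinus (B : Plane → ℝ) (ρ : ℝ) : ℝ :=
  ⨅ x : Plane, Real.exp (scalarPot B x) / gMinus (flux B) ρ ‖x‖

/-- `K₋(ρ) = sup_x e^{h(x)} / g₋(ρ; |x|)`. -/
def capKMinus (B : Plane → ℝ) (ρ : ℝ) : ℝ :=
  ⨆ x : Plane, Real.exp (scalarPot B x) / gMinus (flux B) ρ ‖x‖

/-- `β₋(B; ρ) = (k₋(ρ) / K₋(ρ))²`. -/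
def betaMinus (B : Plane → ℝ) (ρ : ℝ) : ℝ := (kMinus B ρ / capKMinus B ρ) ^ 2

/-! ### The spin-down quadratic form -/

/-- The density `|(i∇ + A_h) u|² - B |u|²`. -/
def densityMinus (B : Plane → ℝ) (u : Plane → ℂ) (x : Plane) : ℝ :=
  (∑ j : Fin 2, ‖Complex.I * weakPartial j u x + (vectorPot B x j : ℂ) * u x‖ ^ 2)
    - B x * ‖u x‖ ^ 2

/-- `Q₋[u] = ∫ (|(i∇ + A_h) u|² - B |u|²) dx`. -/
def formMinus (B : Plane → ℝ) (u : Plane → ℂ) : ℝ := ∫ x, densityMinus B u x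

end PauliHardy

end

open MeasureTheory
open scoped ENNReal ContDiff

noncomputable section

namespace PauliHardy

open Set Filter Topology

section

/-! ### A weighted Hardy inequality in polar coordinates -/

/-! The form is a square in disguise. With D_j = i∂_j + A_j, the equation -Δh = B gives Q₋[u] = ∫
|(D_0 + i D_1)u|², and D_0 + i D_1 = i e^h (∂_0 + i∂_1) e^{-h}. Hence Q₋[u] = ∫ e^{2h} |(∂_0 +
i∂_1)v|² with v = e^{-h}u. Since k₋ g₋ ≤ e^h ≤ K₋ g₋, replacing e^h by the radial weight g₋ on both
sides costs exactly β₋, and it remains to bound ∫ g₋² |(∂_0 + i∂_1)v|² below by C ∫ g₋² w |v|² for a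
radial weight w (`hardy_contDiff_one`).

In polar coordinates |(∂_0 + i∂_1)v| = |V_r + (i/r)V_θ|. Put n(r) = ∫|V|² dθ and c(r) = ∫⟨V, iV_θ⟩
dθ. The cross term in the square is an exact derivative, 2∫⟨V_r, iV_θ⟩ = c'(r). For r > ρ one has
g₋² = G with G' = -2αG/r, so G c' and the term -2αGc/r left by completing the square iV_θ + αV
combine into (Gc)'; the square itself is at least κn by the spectral gap of the circle, κ ≤ min_m
(m-α)². The radial part is bounded through |V_r + pV|² ≥ 0 for a free function p: p = -(α+Q)/r
outside gives the potential (κ - Q² - rQ')/r², and p = lam·r/ρ² inside gives (2lam - lam²r²/ρ²)/ρ².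
At r = ρ the terms c(ρ) cancel, leaving -(lam + α + Q(ρ)) n(ρ), which has the right sign when lam +
α + Q(ρ) ≤ 0 (`PolarFunction.hardy`). This is where α ≤ 0 enters.

If α is not an integer, take Q = 0 and lam = μ_α ≤ -α. If α is a nonzero integer, there is no gap,
and Q = 1/(2(log(r/ρ) + b)) yields the logarithmic weight; for α = 0 the constant is zero.

The analytic part makes this rigorous for rough B. The assumptions bound ∫|B(y)||x-y|^{-1-δ}dy
uniformly in x, so h is C¹ with bounded gradient and -Δh = B weakly (`PotentialBounds`). The same
bound for the potential of |B| makes |B| form-bounded on H¹, so that density of test functions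
carries both integrability and the inequality to all of H¹ (`PotentialBounds.hardy_memH1`). -/

/-- Differentiation under an interval integral of a jointly continuous derivative. -/
theorem hasDerivAt_intervalIntegral_of_continuous {F F' : ℝ → ℝ → ℝ} {a b : ℝ}
    (hF : Continuous (Function.uncurry F)) (hF' : Continuous (Function.uncurry F'))
    (h : ∀ r t, HasDerivAt (fun s => F s t) (F' r t) r) (r : ℝ) :
    HasDerivAt (fun s => ∫ t in a..b, F s t) (∫ t in a..b, F' r t) r := by
  have hK : IsCompact (Metric.closedBall r 1 ×ˢ uIcc a b) :=
    (isCompact_closedBall r 1).prod isCompact_uIcc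
  obtain ⟨C, hC⟩ := hK.exists_bound_of_continuousOn hF'.continuousOn
  refine (intervalIntegral.hasDerivAt_integral_of_dominated_loc_of_deriv_le
    (bound := fun _ => C) (Metric.closedBall_mem_nhds r one_pos) ?_ ?_ ?_ ?_ ?_ ?_).2
  · exact Eventually.of_forall fun s =>
      (hF.comp (Continuous.prodMk_right s)).aestronglyMeasurable
  · exact (hF.comp (Continuous.prodMk_right r)).intervalIntegrable _ _
  · exact (hF'.comp (Continuous.prodMk_right r)).aestronglyMeasurable
  · exact Eventually.of_forall fun t ht s hs => hC (s, t) ⟨hs, uIoc_subset_uIcc ht⟩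
  · exact intervalIntegrable_const
  · exact Eventually.of_forall fun t _ s _ => h s t

/-- The spectral gap of `i d/dθ + α` on the circle. -/
theorem circle_gap {f f' : ℝ → ℂ} (hf : ∀ t, HasDerivAt f (f' t) t) (hf' : Continuous f')
    (hper : f Real.pi = f (-Real.pi)) {α κ : ℝ} (hκ : ∀ m : ℤ, κ ≤ ((m : ℝ) - α) ^ 2) :
    κ * ∫ t in (-Real.pi)..Real.pi, ‖f t‖ ^ 2
      ≤ ∫ t in (-Real.pi)..Real.pi, ‖Complex.I * f' t + α * f t‖ ^ 2 := by
  have hab : -Real.pi < Real.pi := by linarith [Real.pi_pos]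
  have hfc : Continuous f := continuous_iff_continuousAt.2 fun t => (hf t).continuousAt
  set F : ℝ → ℂ := fun t => Complex.I * f' t + α * f t with hF
  have hFc : Continuous F := by fun_prop
  have memL2 : ∀ g : ℝ → ℂ, Continuous g →
      MemLp g 2 (volume.restrict (Ioc (-Real.pi) Real.pi)) := fun g hg => by
    obtain ⟨C, hC⟩ := (isCompact_Icc (a := -Real.pi) (b := Real.pi)).exists_bound_of_continuousOn
      hg.continuousOn
    exact MemLp.of_bound hg.aestronglyMeasurable C
      ((ae_restrict_iff' measurableSet_Ioc).2 (Eventually.of_forall fun t ht =>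
        hC t (Ioc_subset_Icc_self ht)))
  have hpi : (Real.pi : ℂ) ≠ 0 := Complex.ofReal_ne_zero.2 Real.pi_ne_zero
  -- Integration by parts, with boundary term killed by periodicity. The mode n = 0 is separate
  -- because the general formula divides by n.
  have hcoef' : ∀ n : ℤ, fourierCoeffOn hab f' n = Complex.I * n * fourierCoeffOn hab f n := by
    intro n
    rcases eq_or_ne n 0 with rfl | hn
    · rw [fourierCoeffOn_eq_integral]
      have := intervalIntegral.integral_eq_sub_of_hasDerivAt (a := -Real.pi) (b := Real.pi)
        (fun t _ => hf t) (hf'.intervalIntegrable _ _)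
      simp [this, hper]
    · have hnC : (n : ℂ) ≠ 0 := Int.cast_ne_zero.2 hn
      have := fourierCoeffOn_of_hasDerivAt hab hn (fun t _ => hf t) (hf'.intervalIntegrable _ _)
      rw [hper, sub_self, mul_zero] at this
      rw [this]
      push_cast
      field_simp
      ring
  have hcoefF : ∀ n : ℤ, fourierCoeffOn hab F n = (α - n) * fourierCoeffOn hab f n := by
    intro n
    have hadd : fourierCoeffOn hab F n
        = Complex.I * fourierCoeffOn hab f' n + α * fourierCoeffOn hab f n := by
      rw [← fourierCoeffOn.const_mul, ← fourierCoeffOn.const_mul]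
      simp only [fourierCoeffOn_eq_integral, hF]
      rw [← smul_add, ← intervalIntegral.integral_add]
      · simp only [smul_add]
      · refine Continuous.intervalIntegrable ?_ _ _
        exact (by fun_prop : Continuous fun x : ℝ => (fourier (-n)) (x : AddCircle _)).smul
          (by fun_prop)
      · refine Continuous.intervalIntegrable ?_ _ _
        exact (by fun_prop : Continuous fun x : ℝ => (fourier (-n)) (x : AddCircle _)).smul
          (by fun_prop)
    rw [hadd, hcoef', ← mul_assoc, ← mul_assoc, Complex.I_mul_I]
    ring
  -- Parseval on both sides; the comparison then holds mode by mode because |α - n|² ≥ κ.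
  have h1 := (hasSum_sq_fourierCoeffOn hab (memL2 f hfc)).mul_left κ
  have h2 := hasSum_sq_fourierCoeffOn hab (memL2 F hFc)
  have hle := hasSum_le (fun n => by
    rw [hcoefF n, norm_mul, mul_pow]
    refine mul_le_mul_of_nonneg_right ?_ (by positivity)
    have : ‖(α - n : ℂ)‖ ^ 2 = ((n : ℝ) - α) ^ 2 := by
      rw [← Complex.ofReal_intCast, ← Complex.ofReal_sub, Complex.norm_real, Real.norm_eq_abs,
        sq_abs]
      ring
    rw [this]
    exact hκ n) h1 h2
  rw [smul_eq_mul, smul_eq_mul, ← mul_assoc, mul_comm κ, mul_assoc] at hle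
  exact le_of_mul_le_mul_left hle (inv_pos.2 (by linarith))

/-- A function in polar coordinates together with its first derivatives and one mixed second
derivative, all jointly continuous, `2π`-periodic in the angle. -/
structure PolarFunction where
  (V Vr Vt Vrt : ℝ → ℝ → ℂ)
  cont : Continuous (Function.uncurry V)
  cont_r : Continuous (Function.uncurry Vr)
  cont_t : Continuous (Function.uncurry Vt)
  cont_rt : Continuous (Function.uncurry Vrt)
  deriv_r : ∀ r t, HasDerivAt (fun s => V s t) (Vr r t) r
  deriv_t : ∀ r t, HasDerivAt (fun s => V r s) (Vt r t) t
  deriv_rt : ∀ r t, HasDerivAt (fun s => Vt s t) (Vrt r t) r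
  deriv_tr : ∀ r t, HasDerivAt (fun s => Vr r s) (Vrt r t) t
  per : ∀ r, V r Real.pi = V r (-Real.pi)
  per_r : ∀ r, Vr r Real.pi = Vr r (-Real.pi)

namespace PolarFunction

variable (P : PolarFunction)

/-- The integral of `|V|²` over the circle of radius `r`. -/
def mass (r : ℝ) : ℝ := ∫ t in (-Real.pi)..Real.pi, ‖P.V r t‖ ^ 2

/-- The angular momentum of `V` on the circle of radius `r`. -/
def angMom (r : ℝ) : ℝ := ∫ t in (-Real.pi)..Real.pi, inner ℝ (P.V r t) (Complex.I * P.Vt r t)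

/-- The radial derivative of `mass`. -/
def massDeriv (r : ℝ) : ℝ := ∫ t in (-Real.pi)..Real.pi, 2 * inner ℝ (P.V r t) (P.Vr r t)

/-- The radial derivative of `angMom`. -/
def angMomDeriv (r : ℝ) : ℝ :=
  ∫ t in (-Real.pi)..Real.pi, 2 * inner ℝ (P.Vr r t) (Complex.I * P.Vt r t)

/-- The integral of `|r V_r + i V_θ|²` over the circle of radius `r`. -/
def energy (r : ℝ) : ℝ :=
  ∫ t in (-Real.pi)..Real.pi, ‖(r : ℂ) * P.Vr r t + Complex.I * P.Vt r t‖ ^ 2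

theorem mass_nonneg (r : ℝ) : 0 ≤ P.mass r :=
  intervalIntegral.integral_nonneg (by linarith [Real.pi_pos]) fun _ _ => by positivity

theorem hasDerivAt_mass (r : ℝ) : HasDerivAt P.mass (P.massDeriv r) r := by
  have h0 := P.cont
  have h1 := P.cont_r
  refine hasDerivAt_intervalIntegral_of_continuous (F := fun r t => ‖P.V r t‖ ^ 2)
    (F' := fun r t => 2 * inner ℝ (P.V r t) (P.Vr r t)) ?_ ?_ (fun r t => ?_) r
  · exact (h0.norm.pow 2 : _)
  · exact (h0.inner h1).const_mul 2
  · exact (P.deriv_r r t).norm_sq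

/-- The integrand differentiates to ⟨V_r, iV_θ⟩ + ⟨V, iV_rθ⟩. Integrating ∂_θ⟨V, iV_r⟩ over the
closed circle and using the skew-symmetry of ⟨·, i·⟩ shows that both terms have the same integral;
this is what the mixed derivative and the periodicity of V and V_r are for. -/
theorem hasDerivAt_angMom (r : ℝ) : HasDerivAt P.angMom (P.angMomDeriv r) r := by
  have h0 := P.cont
  have h1 := P.cont_r
  have h2 := P.cont_t
  have h3 := P.cont_rt
  have hd := hasDerivAt_intervalIntegral_of_continuous
    (F := fun r t => inner ℝ (P.V r t) (Complex.I * P.Vt r t))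
    (F' := fun r t => inner ℝ (P.V r t) (Complex.I * P.Vrt r t)
      + inner ℝ (P.Vr r t) (Complex.I * P.Vt r t)) (a := -Real.pi) (b := Real.pi)
    (h0.inner (continuous_const.mul h2))
    ((h0.inner (continuous_const.mul h3)).add (h1.inner (continuous_const.mul h2)))
    (fun r t => (P.deriv_r r t).inner ℝ ((P.deriv_rt r t).const_mul Complex.I)) r
  have c0 : Continuous (P.V r) := h0.comp (Continuous.prodMk_right r)
  have c1 : Continuous (P.Vr r) := h1.comp (Continuous.prodMk_right r)
  have c2 : Continuous (P.Vt r) := h2.comp (Continuous.prodMk_right r)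
  have c3 : Continuous (P.Vrt r) := h3.comp (Continuous.prodMk_right r)
  have hparts := intervalIntegral.integral_eq_sub_of_hasDerivAt
    (a := -Real.pi) (b := Real.pi)
    (fun t _ => (P.deriv_t r t).inner ℝ ((P.deriv_tr r t).const_mul Complex.I))
    (Continuous.intervalIntegrable (by fun_prop) _ _)
  rw [P.per, P.per_r, sub_self] at hparts
  refine hd.congr_deriv (Eq.symm ?_)
  rw [angMomDeriv, ← sub_eq_zero, ← intervalIntegral.integral_sub
    (Continuous.intervalIntegrable (by fun_prop) _ _)
    (Continuous.intervalIntegrable (by fun_prop) _ _), ← neg_eq_zero, ← hparts,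
    ← intervalIntegral.integral_neg]
  refine intervalIntegral.integral_congr fun t _ => ?_
  simp only [Complex.inner, Complex.mul_re, Complex.mul_im, Complex.conj_re, Complex.conj_im,
    Complex.I_re, Complex.I_im]
  ring

/-- The lower bound for the energy on a circle, for any radial drift `p`. -/
theorem energy_ge (r p : ℝ) {α κ : ℝ} (hκ : ∀ m : ℤ, κ ≤ ((m : ℝ) - α) ^ 2) :
    r * P.angMomDeriv r - r ^ 2 * (p * P.massDeriv r + p ^ 2 * P.mass r)
      + (κ - α ^ 2) * P.mass r - 2 * α * P.angMom r ≤ P.energy r := by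
  have c0 : Continuous (P.V r) := P.cont.comp (Continuous.prodMk_right r)
  have c1 : Continuous (P.Vr r) := P.cont_r.comp (Continuous.prodMk_right r)
  have c2 : Continuous (P.Vt r) := P.cont_t.comp (Continuous.prodMk_right r)
  have hgap := circle_gap (P.deriv_t r) c2 (P.per r) hκ
  have hle : -Real.pi ≤ Real.pi := by linarith [Real.pi_pos]
  have hpos : 0 ≤ ∫ t in (-Real.pi)..Real.pi, r ^ 2 * ‖P.Vr r t + p * P.V r t‖ ^ 2 :=
    intervalIntegral.integral_nonneg hle fun _ _ => by positivity
  -- Two completed squares: iV_θ + αV in the angle and V_r + pV in the radius. The first is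
  -- controlled by the spectral gap, the second is dropped.
  have key : P.energy r = r * P.angMomDeriv r - r ^ 2 * (p * P.massDeriv r + p ^ 2 * P.mass r)
      - α ^ 2 * P.mass r - 2 * α * P.angMom r
      + (∫ t in (-Real.pi)..Real.pi, ‖Complex.I * P.Vt r t + α * P.V r t‖ ^ 2)
      + ∫ t in (-Real.pi)..Real.pi, r ^ 2 * ‖P.Vr r t + p * P.V r t‖ ^ 2 := by
    simp only [energy, angMomDeriv, massDeriv, mass, angMom]
    simp only [mul_add, ← intervalIntegral.integral_const_mul]
    rw [← intervalIntegral.integral_add, ← intervalIntegral.integral_sub,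
      ← intervalIntegral.integral_sub, ← intervalIntegral.integral_sub,
      ← intervalIntegral.integral_add, ← intervalIntegral.integral_add]
    · refine intervalIntegral.integral_congr fun t _ => ?_
      simp only [Complex.inner, ← Complex.normSq_eq_norm_sq, Complex.normSq_apply,
        Complex.mul_re, Complex.mul_im, Complex.conj_re, Complex.conj_im, Complex.add_re,
        Complex.add_im, Complex.ofReal_re, Complex.ofReal_im,
        Complex.I_re, Complex.I_im]
      ring
    all_goals exact Continuous.intervalIntegrable (by fun_prop) _ _
  rw [key]
  have : κ * P.mass r ≤ _ := hgap
  linarith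

theorem continuous_mass : Continuous P.mass :=
  continuous_iff_continuousAt.2 fun r => (P.hasDerivAt_mass r).continuousAt

theorem continuous_angMom : Continuous P.angMom :=
  continuous_iff_continuousAt.2 fun r => (P.hasDerivAt_angMom r).continuousAt

end PolarFunction

/-! ### The radial comparison weight and the weighted inequality on rays -/

theorem gMinus_of_le {α ρ r : ℝ} (h : r ≤ ρ) : gMinus α ρ r = 1 := by
  simp [gMinus, gPlus, h]

/-- The two branches of `gPlus` agree at r = ρ, so the power law holds on the closed half-line. -/
theorem gMinus_sq_of_ge {α ρ r : ℝ} (hρ : 0 < ρ) (h : ρ ≤ r) :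
    gMinus α ρ r ^ 2 = ρ ^ (2 * α) * r ^ (-2 * α) := by
  have hr : 0 < r := hρ.trans_le h
  have e1 : ρ ^ (2 * α) * r ^ (-2 * α) = (ρ ^ α * r ^ (-α)) ^ 2 := by
    rw [mul_pow, ← Real.rpow_mul_natCast hρ.le, ← Real.rpow_mul_natCast hr.le]
    congr 2 <;> push_cast <;> ring
  rw [e1]
  congr 1
  rcases h.eq_or_lt with rfl | h
  · rw [gMinus_of_le le_rfl, ← Real.rpow_add hρ]
    simp
  · rw [gMinus, gPlus, if_neg (not_le.2 h), Real.rpow_neg hρ.le, Real.rpow_neg hr.le]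
    field_simp

theorem gMinus_pos {α ρ r : ℝ} (hρ : 0 < ρ) : 0 < gMinus α ρ r := by
  unfold gMinus gPlus
  split_ifs with h
  · norm_num
  · have : 0 < r := hρ.trans (not_le.1 h)
    positivity

theorem continuous_gMinus_sq {α ρ : ℝ} (hρ : 0 < ρ) : Continuous fun r => gMinus α ρ r ^ 2 := by
  have h : (fun r => gMinus α ρ r ^ 2)
      = fun r => if r ≤ ρ then 1 else ρ ^ (2 * α) * r ^ (-2 * α) := by
    funext r
    split_ifs with h
    · rw [gMinus_of_le h, one_pow]
    · rw [gMinus_sq_of_ge hρ (not_le.1 h).le]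
  rw [h]
  refine continuous_if_le continuous_id continuous_const continuousOn_const ?_ ?_
  · refine ContinuousOn.mul continuousOn_const fun x hx => ?_
    exact (Real.continuousAt_rpow_const _ _ (Or.inl (hρ.trans_le hx).ne')).continuousWithinAt
  · rintro x rfl
    rw [← Real.rpow_add hρ]
    simp

/-- The weighted Hardy inequality in polar coordinates. The function `Q` is a radial drift on
`r > ρ`, and `lam` a radial drift on `r < ρ`. -/
theorem PolarFunction.hardy (P : PolarFunction) {α κ lam ρ R C : ℝ} {w Q Q' ε : ℝ → ℝ}
    (hρ : 0 < ρ) (hR : ρ ≤ R) (hκ : ∀ m : ℤ, κ ≤ ((m : ℝ) - α) ^ 2)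
    (hε : Continuous ε) (hεe : ∀ r, 0 < r → P.energy r = r ^ 2 * ε r)
    (hw : ContinuousOn w (Icc 0 R)) (hP0 : P.angMom 0 = 0) (hPR : P.angMom R = 0)
    (hPR' : P.mass R = 0)
    (hQ : ∀ r, ρ ≤ r → HasDerivAt Q (Q' r) r)
    (hin : ∀ r, 0 < r → r < ρ → C * w r ≤ (2 * lam - lam ^ 2 * r ^ 2 / ρ ^ 2) / ρ ^ 2)
    (hout : ∀ r, ρ < r → C * w r ≤ (κ - Q r ^ 2 - r * Q' r) / r ^ 2)
    (hbd : lam + α + Q ρ ≤ 0) :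
    C * (∫ r in (0 : ℝ)..R, r * gMinus α ρ r ^ 2 * (w r * P.mass r))
      ≤ ∫ r in (0 : ℝ)..R, r * gMinus α ρ r ^ 2 * ε r := by
  have hn := P.continuous_mass
  have hc := P.continuous_angMom
  have hg := continuous_gMinus_sq (α := α) hρ
  have hR0 : 0 ≤ R := hρ.le.trans hR
  set φ : ℝ → ℝ := fun r => r * gMinus α ρ r ^ 2 * ε r - C * (r * gMinus α ρ r ^ 2 * (w r * P.mass r))
    with hφ
  have hφc : ContinuousOn φ (Icc 0 R) := by fun_prop
  have hφi : IntegrableOn φ (Icc 0 R) := hφc.integrableOn_Icc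
  have hint : ∀ a b, 0 ≤ a → a ≤ b → b ≤ R → IntervalIntegrable φ volume a b := fun a b h0 hab hb =>
    (hφi.mono_set (by rw [uIcc_of_le hab]; exact Icc_subset_Icc h0 hb)).intervalIntegrable
  have hsub : (∫ r in (0 : ℝ)..R, φ r) = (∫ r in (0 : ℝ)..R, r * gMinus α ρ r ^ 2 * ε r)
      - C * (∫ r in (0 : ℝ)..R, r * gMinus α ρ r ^ 2 * (w r * P.mass r)) := by
    rw [hφ, intervalIntegral.integral_sub, intervalIntegral.integral_const_mul]
    · exact Continuous.intervalIntegrable (by fun_prop) _ _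
    · refine ContinuousOn.intervalIntegrable ?_
      rw [uIcc_of_le hR0]
      fun_prop
  rw [← sub_nonneg, ← hsub, ← intervalIntegral.integral_add_adjacent_intervals
    (hint 0 ρ le_rfl hρ.le hR) (hint ρ R hρ.le hR le_rfl)]
  -- the disc
  have inner_bd : P.angMom ρ - lam * P.mass ρ ≤ ∫ r in (0 : ℝ)..ρ, φ r := by
    -- The integrand dominates Φ', so its integral is at least Φ(ρ) - Φ(0), and Φ(0) = 0. The factor
    -- r²/ρ² removes the mass at the origin and equals 1 at r = ρ.
    set Φ : ℝ → ℝ := fun r => P.angMom r - lam * (r ^ 2 / ρ ^ 2) * P.mass r with hΦ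
    have hder : ∀ r, HasDerivAt Φ (P.angMomDeriv r - (lam * (2 * r / ρ ^ 2) * P.mass r
        + lam * (r ^ 2 / ρ ^ 2) * P.massDeriv r)) r := fun r => by
      have h2 : HasDerivAt (fun r : ℝ => lam * (r ^ 2 / ρ ^ 2)) (lam * (2 * r / ρ ^ 2)) r := by
        have := ((hasDerivAt_pow 2 r).div_const (ρ ^ 2)).const_mul lam
        simpa using this
      exact (P.hasDerivAt_angMom r).sub (h2.mul (P.hasDerivAt_mass r))
    have := intervalIntegral.sub_le_integral_of_hasDeriv_right_of_le hρ.le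
      (fun r _ => (hder r).continuousAt.continuousWithinAt)
      (fun r _ => (hder r).hasDerivWithinAt) (hφi.mono_set (Icc_subset_Icc le_rfl hR))
      (fun r hr => ?_)
    · refine le_trans (le_of_eq ?_) this
      simp only [hΦ, hP0]
      field_simp
      ring
    · have hr0 : 0 < r := hr.1
      -- In the disc the weight is constant, so no shift by α is wanted: with α = κ = 0 only ∫|V_θ|²
      -- ≥ 0 is used.
      have he := P.energy_ge r (lam * r / ρ ^ 2) (α := 0) (κ := 0) (fun m => by positivity)
      rw [hεe r hr0] at he
      have hw' := mul_le_mul_of_nonneg_right (hin r hr0 hr.2) (mul_nonneg hr0.le (P.mass_nonneg r))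
      simp only [hφ, gMinus_of_le hr.2.le]
      have he' : P.angMomDeriv r - r * (lam * r / ρ ^ 2 * P.massDeriv r
          + (lam * r / ρ ^ 2) ^ 2 * P.mass r) ≤ r * ε r := by
        refine le_of_mul_le_mul_left ?_ hr0
        linarith
      have e1 : (2 * lam - lam ^ 2 * r ^ 2 / ρ ^ 2) / ρ ^ 2 * (r * P.mass r)
        = lam * (2 * r / ρ ^ 2) * P.mass r - r * ((lam * r / ρ ^ 2) ^ 2 * P.mass r) := by
        field_simp
      have e2 : lam * (r ^ 2 / ρ ^ 2) * P.massDeriv r = r * (lam * r / ρ ^ 2 * P.massDeriv r) := by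
        field_simp
      rw [e1] at hw'
      rw [e2]
      linarith
  -- the exterior
  have outer_bd : -(P.angMom ρ + (α + Q ρ) * P.mass ρ) ≤ ∫ r in ρ..R, φ r := by
    set G : ℝ → ℝ := fun r => ρ ^ (2 * α) * r ^ (-2 * α) with hG
    have hGd : ∀ r, ρ ≤ r → HasDerivAt G (-2 * α * G r / r) r := fun r hr => by
      have hr0 : 0 < r := hρ.trans_le hr
      have := (Real.hasDerivAt_rpow_const (p := -2 * α) (Or.inl hr0.ne')).const_mul (ρ ^ (2 * α))
      refine this.congr_deriv ?_
      rw [Real.rpow_sub_one hr0.ne']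
      simp only [hG]
      ring
    have hGp : ∀ r, ρ ≤ r → 0 ≤ G r := fun r hr => by
      have hr0 : 0 < r := hρ.trans_le hr
      positivity
    -- The primitive outside the disc; it vanishes at R, where mass and angular momentum do.
    set Φ : ℝ → ℝ := fun r => G r * (P.angMom r + (α + Q r) * P.mass r) with hΦ
    have hder : ∀ r, ρ ≤ r → HasDerivAt Φ (-2 * α * G r / r * (P.angMom r + (α + Q r) * P.mass r)
        + G r * (P.angMomDeriv r + (Q' r * P.mass r + (α + Q r) * P.massDeriv r))) r := fun r hr =>
      (hGd r hr).mul ((P.hasDerivAt_angMom r).add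
        (((hQ r hr).const_add α).mul (P.hasDerivAt_mass r)))
    have := intervalIntegral.sub_le_integral_of_hasDeriv_right_of_le hR
      (fun r hr => (hder r hr.1).continuousAt.continuousWithinAt)
      (fun r hr => (hder r hr.1.le).hasDerivWithinAt)
      (hφi.mono_set (Icc_subset_Icc hρ.le le_rfl)) (fun r hr => ?_)
    · refine le_trans (le_of_eq ?_) this
      have hGρ : G ρ = 1 := by
        simp only [hG]
        rw [← Real.rpow_add hρ]
        simp
      simp only [hΦ, hPR, hPR', hGρ]
      ring
    · have hr0 : 0 < r := hρ.trans hr.1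
      -- This drift makes the terms in `massDeriv` match those of Φ'; the remaining coefficient of
      -- `mass` is then (κ - Q² - rQ')/r, all powers of α having cancelled.
      have he := P.energy_ge r (-(α + Q r) / r) hκ
      rw [hεe r hr0] at he
      have hw' := mul_le_mul_of_nonneg_right (hout r hr.1) (mul_nonneg hr0.le (P.mass_nonneg r))
      simp only [hφ, gMinus_sq_of_ge hρ hr.1.le]
      change _ ≤ r * G r * ε r - C * (r * G r * (w r * P.mass r))
      have he' : P.angMomDeriv r + (α + Q r) * P.massDeriv r - (α + Q r) ^ 2 / r * P.mass r
          + (κ - α ^ 2) / r * P.mass r - 2 * α / r * P.angMom r ≤ r * ε r := by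
        refine le_of_mul_le_mul_left ?_ hr0
        refine le_trans (le_of_eq ?_) (he.trans (le_of_eq ?_))
        · field_simp
          ring
        · ring
      have e1 : (κ - Q r ^ 2 - r * Q' r) / r ^ 2 * (r * P.mass r)
          = (κ - Q r ^ 2 - r * Q' r) / r * P.mass r := by
        field_simp
      rw [e1] at hw'
      have hfin := mul_le_mul_of_nonneg_left (add_le_add he' hw') (hGp r hr.1.le)
      have e2 : G r * (P.angMomDeriv r + (α + Q r) * P.massDeriv r
            - (α + Q r) ^ 2 / r * P.mass r + (κ - α ^ 2) / r * P.mass r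
            - 2 * α / r * P.angMom r - (κ - Q r ^ 2 - r * Q' r) / r * P.mass r)
          = -2 * α * G r / r * (P.angMom r + (α + Q r) * P.mass r)
        + G r * (P.angMomDeriv r + (Q' r * P.mass r + (α + Q r) * P.massDeriv r)) := by
        field_simp
        ring
      rw [← e2]
      linarith
  -- Adding the two bounds cancels `angMom ρ`; what is left is -(lam + α + Q ρ) times the mass at ρ.
  have := mul_nonneg (neg_nonneg.2 hbd) (P.mass_nonneg ρ)
  linarith

end

section

/-! ### Polar coordinates in the plane -/

/-- The point of the plane with polar coordinates `(r, t)`. -/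
def polarPoint (p : ℝ × ℝ) : Plane := !₂[p.1 * Real.cos p.2, p.1 * Real.sin p.2]

/-- The radial unit vector. -/
def radialVec (t : ℝ) : Plane := !₂[Real.cos t, Real.sin t]

/-- The angular unit vector. -/
def angularVec (t : ℝ) : Plane := !₂[-Real.sin t, Real.cos t]

theorem contDiff_polarPoint : ContDiff ℝ ∞ polarPoint := by
  unfold polarPoint
  rw [contDiff_euclidean]
  intro i
  fin_cases i <;> simp <;> fun_prop

theorem norm_radialVec (t : ℝ) : ‖radialVec t‖ = 1 := by
  simp [radialVec, EuclideanSpace.norm_eq, Fin.sum_univ_two]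

theorem polarPoint_eq (r t : ℝ) : polarPoint (r, t) = r • radialVec t := by
  ext i
  fin_cases i <;> simp [polarPoint, radialVec]

theorem norm_polarPoint (p : ℝ × ℝ) : ‖polarPoint p‖ = |p.1| := by
  rw [show p = (p.1, p.2) from rfl, polarPoint_eq, norm_smul, norm_radialVec]
  simp

theorem hasDerivAt_polarPoint_fst (r t : ℝ) :
    HasDerivAt (fun s => polarPoint (s, t)) (radialVec t) r := by
  simp only [polarPoint_eq]
  simpa using (hasDerivAt_id r).smul_const (radialVec t)

theorem hasDerivAt_polarPoint_snd (r t : ℝ) :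
    HasDerivAt (fun s => polarPoint (r, s)) (r • angularVec t) t := by
  have h : (fun s => polarPoint (r, s))
      = fun s => Real.cos s • (r • unitVec 0) + Real.sin s • (r • unitVec 1) := by
    funext s
    ext i
    fin_cases i <;> simp [polarPoint, unitVec, mul_comm]
  rw [h]
  refine (((Real.hasDerivAt_cos t).smul_const (r • unitVec 0)).add
    ((Real.hasDerivAt_sin t).smul_const (r • unitVec 1))).congr_deriv ?_
  ext i
  fin_cases i <;> simp [angularVec, unitVec, mul_comm]

theorem integral_polarPoint (f : Plane → ℝ) :
    ∫ x, f x = ∫ p in polarCoord.target, p.1 * f (polarPoint p) := by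
  have e1 := (EuclideanSpace.volume_preserving_symm_measurableEquiv_toLp (Fin 2))
  have e2 := (volume_preserving_finTwoArrow ℝ)
  rw [← (e1.symm _).integral_comp (MeasurableEquiv.measurableEmbedding _),
    ← (e2.symm _).integral_comp (MeasurableEquiv.measurableEmbedding _),
    ← integral_comp_polarCoord_symm]
  rfl

/-- Integration in polar coordinates of a function that becomes continuous after multiplication
by the Jacobian. -/
theorem integral_eq_polar {f : Plane → ℝ} {F : ℝ → ℝ → ℝ} {R : ℝ} (hR : 0 ≤ R)
    (hF : ContinuousOn (Function.uncurry F) (Icc 0 R ×ˢ univ))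
    (hfF : ∀ r t, 0 < r → r * f (polarPoint (r, t)) = F r t)
    (hsupp : ∀ r t, R < r → F r t = 0) :
    ∫ x, f x = ∫ r in (0 : ℝ)..R, ∫ t in (-Real.pi)..Real.pi, F r t := by
  have hpi : -Real.pi ≤ Real.pi := by linarith [Real.pi_pos]
  rw [integral_polarPoint]
  have h1 : ∫ p in polarCoord.target, p.1 * f (polarPoint p)
      = ∫ p in Ioi (0 : ℝ) ×ˢ Ioo (-Real.pi) Real.pi, Function.uncurry F p :=
    setIntegral_congr_fun polarCoord.open_target.measurableSet fun p hp => hfF p.1 p.2 hp.1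
  have h2 : ∫ p in Ioi (0 : ℝ) ×ˢ Ioo (-Real.pi) Real.pi, Function.uncurry F p
      = ∫ p in Ioc (0 : ℝ) R ×ˢ Ioo (-Real.pi) Real.pi, Function.uncurry F p := by
    refine (setIntegral_eq_of_subset_of_forall_sdiff_eq_zero (measurableSet_Ioi.prod measurableSet_Ioo)
      (prod_mono Ioc_subset_Ioi_self Subset.rfl) ?_)
    rintro ⟨r, t⟩ ⟨⟨hr, ht⟩, h⟩
    refine hsupp r t (not_le.1 fun hle => h ⟨⟨hr, hle⟩, ht⟩)
  have h3 : IntegrableOn (Function.uncurry F) (Ioc (0 : ℝ) R ×ˢ Ioo (-Real.pi) Real.pi) :=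
    ((hF.mono (prod_mono Subset.rfl (subset_univ _))).integrableOn_compact
      (isCompact_Icc.prod (isCompact_Icc (a := -Real.pi) (b := Real.pi)))).mono_set
      (prod_mono Ioc_subset_Icc_self Ioo_subset_Icc_self)
  rw [h1, h2, Measure.volume_eq_prod, setIntegral_prod _ h3, intervalIntegral.integral_of_le hR]
  refine setIntegral_congr_fun measurableSet_Ioc fun r _ => ?_
  simp only [intervalIntegral.integral_of_le hpi, integral_Ioc_eq_integral_Ioo]
  rfl

/-- The classical `j`-th partial derivative of a complex function. -/
def partialC (j : Fin 2) (v : Plane → ℂ) (x : Plane) : ℂ := fderiv ℝ v x (unitVec j)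

theorem fderiv_radialVec (L : Plane →L[ℝ] ℂ) (t : ℝ) :
    L (radialVec t) = Real.cos t * L (unitVec 0) + Real.sin t * L (unitVec 1) := by
  have : radialVec t = Real.cos t • unitVec 0 + Real.sin t • unitVec 1 := by
    ext i
    fin_cases i <;> simp [radialVec, unitVec]
  rw [this, map_add, map_smul, map_smul, Complex.real_smul, Complex.real_smul]

theorem fderiv_angularVec (L : Plane →L[ℝ] ℂ) (t : ℝ) :
    L (angularVec t) = -Real.sin t * L (unitVec 0) + Real.cos t * L (unitVec 1) := by
  have : angularVec t = (-Real.sin t) • unitVec 0 + Real.cos t • unitVec 1 := by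
    ext i
    fin_cases i <;> simp [angularVec, unitVec]
  rw [this, map_add, map_smul, map_smul, Complex.real_smul, Complex.real_smul]
  simp

theorem contDiff_fderiv_apply {E : Type*} [NormedAddCommGroup E] [NormedSpace ℝ E] {W : E → ℂ}
    (hW : ContDiff ℝ ∞ W) (u : E) :
    ContDiff ℝ ∞ fun q => fderiv ℝ W q u :=
  (hW.fderiv_right (m := ∞) (by simp)).clm_apply contDiff_const

theorem fderiv_fderiv_apply_comm {E : Type*} [NormedAddCommGroup E] [NormedSpace ℝ E]
    {W : E → ℂ} (hW : ContDiff ℝ ∞ W) (u v p : E) :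
    fderiv ℝ (fun q => fderiv ℝ W q v) p u = fderiv ℝ (fun q => fderiv ℝ W q u) p v := by
  have hd : DifferentiableAt ℝ (fderiv ℝ W) p :=
    (hW.fderiv_right (m := ∞) (by simp)).differentiable (by simp) p
  have hs := (hW.contDiffAt (x := p)).isSymmSndFDerivAt
    (by
      rw [minSmoothness_of_isRCLikeNormedField]
      exact WithTop.coe_le_coe.2 (le_top (a := (2 : ℕ∞))))
  have e : ∀ a b : E,
      fderiv ℝ (fun q => fderiv ℝ W q a) p b = fderiv ℝ (fderiv ℝ W) p b a := fun a b => by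
    rw [fderiv_clm_apply hd (differentiableAt_const a)]
    simp
  rw [e, e, hs.eq]

theorem hasDerivAt_fst {W : ℝ × ℝ → ℂ} (hW : ContDiff ℝ ∞ W) (r t : ℝ) :
    HasDerivAt (fun s => W (s, t)) (fderiv ℝ W (r, t) (1, 0)) r :=
  (hW.differentiable (by simp) (r, t)).hasFDerivAt.comp_hasDerivAt r
    ((hasDerivAt_id r).prodMk (hasDerivAt_const r t))

theorem hasDerivAt_snd {W : ℝ × ℝ → ℂ} (hW : ContDiff ℝ ∞ W) (r t : ℝ) :
    HasDerivAt (fun s => W (r, s)) (fderiv ℝ W (r, t) (0, 1)) t :=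
  (hW.differentiable (by simp) (r, t)).hasFDerivAt.comp_hasDerivAt t
    ((hasDerivAt_const t r).prodMk (hasDerivAt_id t))

/-- A smooth function of `(r, t)`, periodic in `t`, as a `PolarFunction`. -/
def PolarFunction.ofContDiff (W : ℝ × ℝ → ℂ) (hW : ContDiff ℝ ∞ W)
    (hper : ∀ r, W (r, Real.pi) = W (r, -Real.pi)) : PolarFunction where
  V r t := W (r, t)
  Vr r t := fderiv ℝ W (r, t) (1, 0)
  Vt r t := fderiv ℝ W (r, t) (0, 1)
  Vrt r t := fderiv ℝ (fun q => fderiv ℝ W q (0, 1)) (r, t) (1, 0)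
  cont := hW.continuous
  cont_r := (contDiff_fderiv_apply hW _).continuous
  cont_t := (contDiff_fderiv_apply hW _).continuous
  cont_rt := (contDiff_fderiv_apply (contDiff_fderiv_apply hW _) _).continuous
  deriv_r := hasDerivAt_fst hW
  deriv_t := hasDerivAt_snd hW
  deriv_rt := hasDerivAt_fst (contDiff_fderiv_apply hW _)
  deriv_tr r t := by
    rw [fderiv_fderiv_apply_comm hW]
    exact hasDerivAt_snd (contDiff_fderiv_apply hW _) r t
  per := hper
  per_r r := by
    refine (hasDerivAt_fst hW r Real.pi).unique ?_
    rw [funext hper]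
    exact hasDerivAt_fst hW r _

/-- A smooth function on the plane in polar coordinates. -/
def polarFunction (v : Plane → ℂ) (hv : ContDiff ℝ ∞ v) : PolarFunction :=
  .ofContDiff (v ∘ polarPoint) (hv.comp contDiff_polarPoint) fun r => by simp [polarPoint]

theorem polarFunction_Vr (v : Plane → ℂ) (hv : ContDiff ℝ ∞ v) (r t : ℝ) :
    (polarFunction v hv).Vr r t = Real.cos t * partialC 0 v (polarPoint (r, t))
      + Real.sin t * partialC 1 v (polarPoint (r, t)) := by
  have h := (hv.differentiable (by simp) (polarPoint (r, t))).hasFDerivAt.comp_hasDerivAt r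
    (hasDerivAt_polarPoint_fst r t)
  rw [((polarFunction v hv).deriv_r r t).unique h, fderiv_radialVec]
  rfl

theorem polarFunction_Vt (v : Plane → ℂ) (hv : ContDiff ℝ ∞ v) (r t : ℝ) :
    (polarFunction v hv).Vt r t = r * (-Real.sin t * partialC 0 v (polarPoint (r, t))
      + Real.cos t * partialC 1 v (polarPoint (r, t))) := by
  have h := (hv.differentiable (by simp) (polarPoint (r, t))).hasFDerivAt.comp_hasDerivAt t
    (hasDerivAt_polarPoint_snd r t)
  rw [((polarFunction v hv).deriv_t r t).unique h, map_smul, fderiv_angularVec, Complex.real_smul]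
  rfl

/-- r∂_r + i∂_θ = r e^{-iθ}(∂_0 + i∂_1), and the phase has modulus one. -/
theorem polarFunction_energy (v : Plane → ℂ) (hv : ContDiff ℝ ∞ v) (r t : ℝ) :
    ‖(r : ℂ) * (polarFunction v hv).Vr r t + Complex.I * (polarFunction v hv).Vt r t‖ ^ 2
      = r ^ 2 * ‖partialC 0 v (polarPoint (r, t))
        + Complex.I * partialC 1 v (polarPoint (r, t))‖ ^ 2 := by
  rw [polarFunction_Vr, polarFunction_Vt]
  have : (r : ℂ) * (Real.cos t * partialC 0 v (polarPoint (r, t))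
      + Real.sin t * partialC 1 v (polarPoint (r, t)))
      + Complex.I * (r * (-Real.sin t * partialC 0 v (polarPoint (r, t))
      + Real.cos t * partialC 1 v (polarPoint (r, t))))
      = r * ((Real.cos t - Real.sin t * Complex.I) * (partialC 0 v (polarPoint (r, t))
        + Complex.I * partialC 1 v (polarPoint (r, t)))) := by
    linear_combination ((r : ℂ) * Real.sin t * partialC 1 v (polarPoint (r, t))) * Complex.I_sq
  have h1 : ‖(Real.cos t - Real.sin t * Complex.I : ℂ)‖ = 1 := by
    have := Complex.norm_exp_ofReal_mul_I (-t)
    rw [Complex.exp_mul_I, ← Complex.ofReal_cos, ← Complex.ofReal_sin] at this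
    simpa [sub_eq_add_neg] using this
  rw [this, norm_mul, norm_mul, h1, one_mul, mul_pow, Complex.norm_real, Real.norm_eq_abs, sq_abs]

/-- The weighted Hardy inequality for smooth compactly supported functions on the plane. -/
theorem hardy_smooth {v : Plane → ℂ} (hv : ContDiff ℝ ∞ v) (hvc : HasCompactSupport v)
    {α κ lam ρ C : ℝ} {w Q Q' : ℝ → ℝ}
    (hρ : 0 < ρ) (hκ : ∀ m : ℤ, κ ≤ ((m : ℝ) - α) ^ 2)
    (hw : Continuous fun x : Plane => w ‖x‖)
    (hQ : ∀ r, ρ ≤ r → HasDerivAt Q (Q' r) r)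
    (hin : ∀ r, 0 < r → r < ρ → C * w r ≤ (2 * lam - lam ^ 2 * r ^ 2 / ρ ^ 2) / ρ ^ 2)
    (hout : ∀ r, ρ < r → C * w r ≤ (κ - Q r ^ 2 - r * Q' r) / r ^ 2)
    (hbd : lam + α + Q ρ ≤ 0) :
    C * (∫ x : Plane, gMinus α ρ ‖x‖ ^ 2 * (w ‖x‖ * ‖v x‖ ^ 2))
      ≤ ∫ x : Plane, gMinus α ρ ‖x‖ ^ 2 * ‖partialC 0 v x + Complex.I * partialC 1 v x‖ ^ 2 := by
  obtain ⟨R0, hR0⟩ := hvc.isCompact.isBounded.subset_closedBall (0 : Plane)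
  -- The margin 1 puts the circle r = R itself outside the support, so the boundary terms at R
  -- vanish.
  set R := max (R0 + 1) ρ with hRdef
  have hR : ρ ≤ R := le_max_right _ _
  have hRpos : 0 < R := hρ.trans_le hR
  have hzero : ∀ x : Plane, R ≤ ‖x‖ → x ∉ tsupport v := fun x hx hm => by
    have := hR0 hm
    rw [mem_closedBall_zero_iff] at this
    linarith [le_max_left (R0 + 1) ρ]
  have hv0 : ∀ x : Plane, R ≤ ‖x‖ → v x = 0 := fun x hx => image_eq_zero_of_notMem_tsupport (hzero x hx)
  have hd0 : ∀ j, ∀ x : Plane, R ≤ ‖x‖ → partialC j v x = 0 := fun j x hx => by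
    have : fderiv ℝ v x = 0 := by
      by_contra hne
      exact hzero x hx (support_fderiv_subset ℝ hne)
    simp [partialC, this]
  have hnp : ∀ r t, 0 ≤ r → ‖polarPoint (r, t)‖ = r := fun r t hr => by
    rw [norm_polarPoint, abs_of_nonneg hr]
  have hpc : Continuous polarPoint := contDiff_polarPoint.continuous
  have hdc : ∀ j, Continuous (partialC j v) := fun j =>
    (hv.continuous_fderiv (by simp)).clm_apply continuous_const
  have hgc := continuous_gMinus_sq (α := α) hρ
  set P := polarFunction v hv with hP
  have hPV : ∀ r t, P.V r t = v (polarPoint (r, t)) := fun r t => rfl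
  set e : ℝ → ℝ → ℝ := fun r t => ‖partialC 0 v (polarPoint (r, t))
        + Complex.I * partialC 1 v (polarPoint (r, t))‖ ^ 2 with he
  have hec : Continuous (Function.uncurry e) := by
    have h0 := (hdc 0).comp hpc
    have h1 := (hdc 1).comp hpc
    exact ((h0.add (continuous_const.mul h1)).norm.pow 2 : _)
  have hmain := P.hardy (R := R) (ε := fun r => ∫ t in (-Real.pi)..Real.pi, e r t) hρ hR hκ
    (intervalIntegral.continuous_parametric_intervalIntegral_of_continuous' hec _ _)
    (fun r hr => by
      rw [← intervalIntegral.integral_const_mul]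
      exact intervalIntegral.integral_congr fun t _ => polarFunction_energy v hv r t)
    (w := w) (C := C) ?_ ?_ ?_ ?_ hQ hin hout hbd
  · convert hmain using 2
    · rw [integral_eq_polar (F := fun r t => r * (gMinus α ρ r ^ 2 * (w r * ‖v (polarPoint (r, t))‖ ^ 2)))
        hRpos.le]
      · refine intervalIntegral.integral_congr fun r _ => ?_
        simp only [PolarFunction.mass, hPV, ← intervalIntegral.integral_const_mul]
        exact intervalIntegral.integral_congr fun t _ => by ring
      · have hwr : ContinuousOn (fun p : ℝ × ℝ => w p.1) (Icc 0 R ×ˢ univ) :=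
          (hw.comp hpc).continuousOn.congr fun p hp => by
            simp [norm_polarPoint, abs_of_nonneg hp.1.1]
        have hg2 : Continuous fun p : ℝ × ℝ => gMinus α ρ p.1 ^ 2 := hgc.comp continuous_fst
        have hv2 : Continuous fun p : ℝ × ℝ => ‖v (polarPoint p)‖ ^ 2 :=
          ((hv.continuous.comp hpc).norm.pow 2 : _)
        exact continuous_fst.continuousOn.mul (hg2.continuousOn.mul (hwr.mul hv2.continuousOn))
      · intro r t hr
        rw [hnp r t hr.le]
      · intro r t hr
        rw [hv0 _ (by rw [hnp r t (hRpos.trans hr).le]; exact hr.le)]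
        simp
    · rw [integral_eq_polar (F := fun r t => r * (gMinus α ρ r ^ 2 * e r t)) hRpos.le]
      · refine intervalIntegral.integral_congr fun r _ => ?_
        simp only [← intervalIntegral.integral_const_mul]
        exact intervalIntegral.integral_congr fun t _ => by ring
      · have hg2 : Continuous fun p : ℝ × ℝ => gMinus α ρ p.1 ^ 2 := hgc.comp continuous_fst
        exact (continuous_fst.mul (hg2.mul hec)).continuousOn
      · intro r t hr
        rw [hnp r t hr.le]
      · intro r t hr
        have hn : R ≤ ‖polarPoint (r, t)‖ := by rw [hnp r t (hRpos.trans hr).le]; exact hr.le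
        simp [he, hd0 0 _ hn, hd0 1 _ hn]
  · have := (hw.comp hpc).comp (Continuous.prodMk_left (0 : ℝ))
    refine this.continuousOn.congr fun r hr => ?_
    simp [norm_polarPoint, abs_of_nonneg hr.1]
  · simp [PolarFunction.angMom, hP, polarFunction_Vt]
  · simp [PolarFunction.angMom, hPV, hv0 _ (hnp R _ hRpos.le).ge]
  · simp [PolarFunction.mass, hPV, hv0 _ (hnp R _ hRpos.le).ge]

end

section

/-! ### The logarithmic potential -/

/-- Quantitative bounds on a field under which its logarithmic potential is of class `C¹`. -/
structure PotentialBounds (B : Plane → ℝ) (δ M : ℝ) : Prop where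
  pos : 0 < δ
  le_one : δ ≤ 1
  int : Integrable B
  moment : Integrable fun y => |B y| * ‖y‖ ^ δ
  kernel : ∀ x, Integrable fun y => |B y| * ‖x - y‖ ^ (-(1 + δ))
  kernel_le : ∀ x, ∫ y, |B y| * ‖x - y‖ ^ (-(1 + δ)) ≤ M

/-- Lets the potential of |B| be used as well; its bounded gradient gives the form bound on the
field. -/
theorem PotentialBounds.abs {B : Plane → ℝ} {δ M : ℝ} (h : PotentialBounds B δ M) :
    PotentialBounds (fun y => |B y|) δ M where
  pos := h.pos
  le_one := h.le_one
  int := h.int.abs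
  moment := by simpa only [abs_abs] using h.moment
  kernel := by simpa only [abs_abs] using h.kernel
  kernel_le := by simpa only [abs_abs] using h.kernel_le

theorem finrank_plane : Module.finrank ℝ Plane = 2 := by simp

/-- Local integrability carries measurability on each ball, and countably many balls cover the
plane. -/
theorem AdmissibleField.aestronglyMeasurable {B : Plane → ℝ} (hB : AdmissibleField B) :
    AEStronglyMeasurable B := by
  obtain ⟨⟨p, -, hp⟩, -⟩ := hB
  have h : ∀ n : ℕ, AEStronglyMeasurable B
      (volume.restrict (Metric.closedBall (0 : Plane) n)) := fun n =>
    (hp _ (isCompact_closedBall 0 (n : ℝ))).1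
  have := (aestronglyMeasurable_iUnion_iff).2 h
  rwa [Metric.iUnion_closedBall_nat, Measure.restrict_univ] at this

theorem integrableOn_norm_rpow_compl_closedBall {s R : ℝ} (hs : 2 < s) (hR : 1 ≤ R) :
    IntegrableOn (fun y : Plane => ‖y‖ ^ (-s)) (Metric.closedBall 0 R)ᶜ := by
  have hi : Integrable fun y : Plane => (2 : ℝ) ^ s * (1 + ‖y‖) ^ (-s) :=
    (integrable_one_add_norm (by rw [finrank_plane]; exact_mod_cast hs)).const_mul _
  refine hi.integrableOn.mono' ?_ ?_
  · exact (measurable_norm.pow_const _).aestronglyMeasurable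
  · refine (ae_restrict_iff' Metric.isClosed_closedBall.measurableSet.compl).2
      (Eventually.of_forall fun y hy => ?_)
    have hy1 : 1 < ‖y‖ := by
      have : R < ‖y‖ := by simpa using hy
      linarith
    have hy0 : 0 < ‖y‖ := by linarith
    rw [Real.norm_of_nonneg (by positivity), Real.rpow_neg hy0.le, Real.rpow_neg (by positivity),
      ← div_eq_mul_inv, inv_eq_one_div, div_le_div_iff₀ (by positivity) (by positivity), one_mul,
      ← Real.mul_rpow (by norm_num) hy0.le]
    exact Real.rpow_le_rpow (by positivity) (by linarith) (by linarith)

/-- An admissible field satisfies `PotentialBounds`. -/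
theorem AdmissibleField.potentialBounds {B : Plane → ℝ} (hB : AdmissibleField B) :
    ∃ δ M, PotentialBounds B δ M := by
  have hmeas := hB.aestronglyMeasurable
  obtain ⟨⟨p, hp2, hp⟩, τ, hτ, C, R0, hdecay⟩ := hB
  set R := max R0 1 with hR
  have hR1 : 1 ≤ R := le_max_right _ _
  set K : Set Plane := Metric.closedBall 0 R with hK
  have hKm : MeasurableSet K := Metric.isClosed_closedBall.measurableSet
  have hKc : IsCompact K := isCompact_closedBall 0 R
  -- an exponent `q` in `(2, 3]`
  set q' : ℝ≥0∞ := min p 3 with hq'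
  have hq'top : q' ≠ ⊤ := ne_top_of_le_ne_top (by norm_num) (min_le_right p 3)
  have hq'2 : 2 < q' := lt_min hp2 (by norm_num)
  set q := q'.toReal with hq
  have hq2 : 2 < q := by
    have := (ENNReal.toReal_lt_toReal (by norm_num) hq'top).2 hq'2
    simpa using this
  have : IsFiniteMeasure (volume.restrict K) :=
    ⟨by rw [Measure.restrict_apply_univ]; exact hKc.measure_lt_top⟩
  have hBq : MemLp B q' (volume.restrict K) := (hp K hKc).mono_exponent (min_le_left _ _)
  have hBK : IntegrableOn (fun y => |B y| ^ q) K := by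
    have := hBq.integrable_norm_rpow (by positivity) hq'top
    exact this
  have hBK1 : IntegrableOn B K :=
    memLp_one_iff_integrable.1 (hBq.mono_exponent (by
      refine le_trans ?_ hq'2.le
      norm_num))
  have hdec : ∀ᵐ y : Plane, y ∈ Kᶜ → |B y| ≤ |C| * ‖y‖ ^ (-τ) := by
    filter_upwards [hdecay] with y hy hyK
    have : R < ‖y‖ := by simpa [hK] using hyK
    refine (hy (le_trans (le_max_left _ _) this.le)).trans ?_
    gcongr
    exact le_abs_self C
  have hdec1 : ∀ᵐ y : Plane, y ∈ Kᶜ → |B y| ≤ |C| := by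
    filter_upwards [hdec] with y hy hyK
    have hyR : R < ‖y‖ := by simpa [hK] using hyK
    refine (hy hyK).trans (mul_le_of_le_one_right (abs_nonneg _) ?_)
    exact Real.rpow_le_one_of_one_le_of_nonpos (by linarith) (by linarith)
  -- The first bound keeps τ - δ > 2, so the moment of order δ converges at infinity. The second
  -- gives (1 + δ)q/(q - 1) < 2, so the conjugate power of the kernel is locally integrable in the
  -- plane. The third makes t ↦ t^δ subadditive.
  set δ := min (min ((τ - 2) / 2) ((q - 2) / (2 * q))) 1 with hδ
  have hδ0 : 0 < δ := by
    refine lt_min (lt_min (by linarith) ?_) one_pos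
    exact div_pos (by linarith) (by linarith)
  have hδ1 : δ ≤ (τ - 2) / 2 := (min_le_left _ _).trans (min_le_left _ _)
  have hδ2 : δ ≤ (q - 2) / (2 * q) := (min_le_left _ _).trans (min_le_right _ _)
  have hδ3 : δ ≤ 1 := min_le_right _ _
  set s := 1 + δ with hs
  set qc := q / (q - 1) with hqc
  have hconj : q.HolderConjugate qc := Real.HolderConjugate.conjExponent (by linarith)
  have hqc1 : 1 < qc := hconj.symm.lt
  have hsq : s * qc < 2 := by
    have h1 : δ * (2 * q) ≤ q - 2 := (le_div_iff₀ (by linarith)).1 hδ2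
    rw [hqc, ← mul_div_assoc, div_lt_iff₀ (by linarith)]
    nlinarith
  have hmom : Integrable fun y => |B y| * ‖y‖ ^ δ := by
    have hm : AEStronglyMeasurable fun y => |B y| * ‖y‖ ^ δ :=
      hmeas.norm.mul (measurable_norm.pow_const _).aestronglyMeasurable
    rw [← integrableOn_univ, ← union_compl_self K]
    refine IntegrableOn.union ?_ ?_
    · refine (hBK1.abs.mul_const (R ^ δ)).mono' hm.restrict ?_
      refine (ae_restrict_iff' hKm).2 (Eventually.of_forall fun y hy => ?_)
      rw [Real.norm_of_nonneg (by positivity)]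
      have : ‖y‖ ≤ R := by simpa [hK] using hy
      gcongr
    · refine ((integrableOn_norm_rpow_compl_closedBall (s := τ - δ) (by linarith) hR1).const_mul
        |C|).mono' hm.restrict ?_
      refine (ae_restrict_iff' hKm.compl).2 ?_
      filter_upwards [hdec] with y hy hyK
      have hyR : R < ‖y‖ := by simpa [hK] using hyK
      have hy0 : 0 < ‖y‖ := by linarith
      rw [Real.norm_of_nonneg (by positivity), neg_sub, sub_eq_neg_add, Real.rpow_add hy0,
        ← mul_assoc]
      exact mul_le_mul_of_nonneg_right (hy hyK) (by positivity)
  have hint : Integrable B := by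
    rw [← integrableOn_univ, ← union_compl_self K]
    refine hBK1.union (hmom.integrableOn.mono' hmeas.restrict ?_)
    refine (ae_restrict_iff' hKm.compl).2 (Eventually.of_forall fun y hyK => ?_)
    have hyR : R < ‖y‖ := by simpa [hK] using hyK
    exact le_mul_of_one_le_right (abs_nonneg _) (Real.one_le_rpow (by linarith) hδ0.le)
  -- the dominating function
  set D0 : Plane → ℝ := (Metric.ball 0 1).indicator fun z => ‖z‖ ^ (-(s * qc)) with hD0
  have hD0i : Integrable D0 := by
    rw [hD0, integrable_indicator_iff Metric.isOpen_ball.measurableSet]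
    refine integrableOn_ball_of_norm_le_rpow (C := 1) (α := s * qc) (by simp)
      (by rw [finrank_plane]; exact_mod_cast hsq) (Eventually.of_forall fun x => ?_)
      (measurable_norm.pow_const _).aestronglyMeasurable
    rw [one_mul, Real.norm_of_nonneg (by positivity)]
  have hD0nn : ∀ z, 0 ≤ D0 z := fun z => indicator_nonneg (fun _ _ => by positivity) _
  set D : Plane → Plane → ℝ := fun x y =>
    |B y| + K.indicator (fun y => |B y| ^ q) y + (1 + |C|) * D0 (x - y) with hD
  have hKi : Integrable (K.indicator fun y => |B y| ^ q) := (integrable_indicator_iff hKm).2 hBK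
  have hDi : ∀ x, Integrable (D x) := fun x =>
    (hint.abs.add hKi).add ((hD0i.comp_sub_left x).const_mul _)
  -- The three terms of `D` serve three regions: for |x-y| ≥ 1 the kernel is at most 1; for |x-y| <
  -- 1 and y in K, Young's inequality separates |B|^q from the kernel; for |x-y| < 1 and y outside K
  -- the field is at most |C|. Only the last term of `D` depends on x, by a translation, so the
  -- integral of `D` does not depend on x.
  have hle : ∀ x, ∀ᵐ y, |B y| * ‖x - y‖ ^ (-s) ≤ D x y := fun x => by
    filter_upwards [hdec1] with y hy
    have hKn : 0 ≤ K.indicator (fun y => |B y| ^ q) y :=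
      indicator_nonneg (fun _ _ => by positivity) _
    have hC0 := abs_nonneg C
    have hB0 := abs_nonneg (B y)
    rcases le_or_gt 1 ‖x - y‖ with h1 | h1
    · have : ‖x - y‖ ^ (-s) ≤ 1 := Real.rpow_le_one_of_one_le_of_nonpos h1 (by linarith)
      have h2 : |B y| * ‖x - y‖ ^ (-s) ≤ |B y| := mul_le_of_le_one_right hB0 this
      have h3 : 0 ≤ (1 + |C|) * D0 (x - y) := mul_nonneg (by positivity) (hD0nn _)
      simp only [hD]
      linarith
    · have hD0v : D0 (x - y) = ‖x - y‖ ^ (-(s * qc)) :=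
        indicator_of_mem (by simpa using h1) _
      have hpow0 : 0 ≤ ‖x - y‖ ^ (-(s * qc)) := by positivity
      by_cases hyK : y ∈ K
      · have hyoung := Real.young_inequality_of_nonneg hB0
          (b := ‖x - y‖ ^ (-s)) (by positivity) hconj
        rw [← Real.rpow_mul (norm_nonneg _), neg_mul] at hyoung
        have h1 : |B y| ^ q / q ≤ |B y| ^ q := div_le_self (by positivity) (by linarith)
        have h2 : ‖x - y‖ ^ (-(s * qc)) / qc ≤ ‖x - y‖ ^ (-(s * qc)) :=
          div_le_self (by positivity) hqc1.le
        simp only [hD, hD0v, indicator_of_mem hyK]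
        nlinarith
      · rcases eq_or_ne (x - y) 0 with h0 | h0
        -- On the diagonal the kernel takes the default value 0 ^ (-s) = 0.
        · rw [h0, norm_zero, Real.zero_rpow (by linarith), mul_zero]
          have h3 : 0 ≤ (1 + |C|) * D0 (x - y) := mul_nonneg (by positivity) (hD0nn _)
          simp only [hD]
          linarith
        · have hz : 0 < ‖x - y‖ := norm_pos_iff.2 h0
          have h2 : ‖x - y‖ ^ (-s) ≤ ‖x - y‖ ^ (-(s * qc)) :=
            Real.rpow_le_rpow_of_exponent_ge hz h1.le (by nlinarith)
          have h3 : |B y| * ‖x - y‖ ^ (-s) ≤ |C| * ‖x - y‖ ^ (-(s * qc)) :=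
            mul_le_mul (hy hyK) h2 (by positivity) hC0
          simp only [hD, hD0v]
          linarith
  have hki : ∀ x, Integrable fun y => |B y| * ‖x - y‖ ^ (-s) := fun x => by
    refine (hDi x).mono' (hmeas.norm.mul ?_) ?_
    · exact ((measurable_const.sub measurable_id).norm.pow_const _).aestronglyMeasurable
    · filter_upwards [hle x] with y hy
      rwa [Real.norm_of_nonneg (by positivity)]
  refine ⟨δ, (∫ y, |B y|) + (∫ y, K.indicator (fun y => |B y| ^ q) y) + (1 + |C|) * ∫ z, D0 z,
    hδ0, hδ3, hint, hmom, hki, fun x => ?_⟩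
  refine (integral_mono_ae (hki x) (hDi x) (hle x)).trans (le_of_eq ?_)
  have e1 := integral_add (hint.abs.add hKi) ((hD0i.comp_sub_left x).const_mul (1 + |C|))
  have e2 := integral_add hint.abs hKi
  rw [integral_const_mul, integral_sub_left_eq_self] at e1
  rw [← e2]
  exact e1

/-! ### Estimates for the logarithmic kernel and its regularization -/

theorem abs_log_le {t δ : ℝ} (ht : 0 ≤ t) (hδ : 0 < δ) :
    |Real.log t| ≤ t ^ δ / δ + t ^ (-(1 + δ)) / (1 + δ) := by
  have h1 : 0 ≤ t ^ δ / δ := by positivity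
  have h2 : 0 ≤ t ^ (-(1 + δ)) / (1 + δ) := by positivity
  rw [abs_le]
  constructor
  · have := Real.log_le_rpow_div (inv_nonneg.2 ht) (by linarith : 0 < 1 + δ)
    rw [Real.log_inv, Real.inv_rpow ht, ← Real.rpow_neg ht] at this
    linarith
  · have := Real.log_le_rpow_div ht hδ
    linarith

/-- The difference is ½ log(1 + (ε/t)²) ≤ log(1 + ε/t) ≤ ε/t. -/
theorem abs_half_log_sub_log_le {t ε : ℝ} (ht : 0 < t) (hε : 0 < ε) :
    |1 / 2 * Real.log (t ^ 2 + ε ^ 2) - Real.log t| ≤ ε * t⁻¹ := by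
  have h1 : 1 / 2 * Real.log (t ^ 2 + ε ^ 2) - Real.log t
      = 1 / 2 * Real.log (1 + (ε * t⁻¹) ^ 2) := by
    have : t ^ 2 + ε ^ 2 = t ^ 2 * (1 + (ε * t⁻¹) ^ 2) := by field_simp
    rw [this, Real.log_mul (by positivity) (by positivity), Real.log_pow]
    push_cast
    ring
  have h0 : 0 ≤ Real.log (1 + (ε * t⁻¹) ^ 2) := Real.log_nonneg (by nlinarith [sq_nonneg (ε * t⁻¹)])
  rw [h1, abs_of_nonneg (by positivity)]
  have hu : 0 < ε * t⁻¹ := by positivity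
  have h2 : Real.log (1 + (ε * t⁻¹) ^ 2) ≤ Real.log ((1 + ε * t⁻¹) ^ 2) :=
    Real.log_le_log (by positivity) (by nlinarith)
  rw [Real.log_pow] at h2
  have h3 := Real.log_le_sub_one_of_pos (by positivity : 0 < 1 + ε * t⁻¹)
  push_cast at h2
  linarith

theorem inv_le_one_add_rpow {t δ : ℝ} (ht : 0 ≤ t) (hδ : 0 < δ) :
    t⁻¹ ≤ 1 + t ^ (-(1 + δ)) := by
  have h2 : 0 ≤ t ^ (-(1 + δ)) := by positivity
  rcases ht.eq_or_lt with rfl | h0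
  · simp
    positivity
  rcases le_or_gt 1 t with h1 | h1
  · have := inv_le_one_of_one_le₀ h1
    linarith
  · rw [← Real.rpow_neg_one]
    have := Real.rpow_le_rpow_of_exponent_ge h0 h1.le (by linarith : -(1 + δ) ≤ -1)
    linarith

/-- The regularized kernel `z / (|z|² + ε²)` as a linear form. -/
def gradKernel (ε : ℝ) (z : Plane) : Plane →L[ℝ] ℝ := (‖z‖ ^ 2 + ε ^ 2)⁻¹ • innerSL ℝ z

theorem norm_gradKernel (ε : ℝ) (z : Plane) :
    ‖gradKernel ε z‖ = (‖z‖ ^ 2 + ε ^ 2)⁻¹ * ‖z‖ := by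
  rw [gradKernel, norm_smul, innerSL_apply_norm, Real.norm_of_nonneg (by positivity)]

theorem norm_gradKernel_zero (z : Plane) : ‖gradKernel 0 z‖ = ‖z‖⁻¹ := by
  rw [norm_gradKernel]
  rcases eq_or_ne ‖z‖ 0 with h | h
  · simp [h]
  · field_simp
    simp

theorem norm_gradKernel_le {ε : ℝ} (hε : 0 < ε) (z : Plane) : ‖gradKernel ε z‖ ≤ ε⁻¹ := by
  rw [norm_gradKernel, inv_mul_le_iff₀ (by positivity), ← div_eq_mul_inv, le_div_iff₀ hε]
  nlinarith [sq_nonneg (‖z‖ - ε), norm_nonneg z, sq_nonneg ‖z‖, sq_nonneg ε]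

/-- The difference has norm (ε²/(t² + ε²))/t with t = |z|, and the first factor is at most min(1,
(ε/t)²) ≤ (ε/t)^δ. Giving up part of the decay in ε keeps the singularity at order 1 + δ, which
`kernel_le` integrates uniformly. -/
theorem norm_gradKernel_sub_le {ε δ : ℝ} (hε : 0 < ε) (hδ : 0 < δ) (hδ1 : δ ≤ 1) (z : Plane) :
    ‖gradKernel ε z - gradKernel 0 z‖ ≤ ε ^ δ * ‖z‖ ^ (-(1 + δ)) := by
  have e0 : gradKernel ε z - gradKernel 0 z
      = ((‖z‖ ^ 2 + ε ^ 2)⁻¹ - (‖z‖ ^ 2 + 0 ^ 2)⁻¹) • innerSL ℝ z := by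
    ext v
    simp [gradKernel, sub_mul]
  rw [e0, norm_smul, innerSL_apply_norm]
  rcases (norm_nonneg z).eq_or_lt with h | h
  · rw [← h, mul_zero]
    positivity
  set t := ‖z‖ with ht
  have e1 : (t ^ 2 + ε ^ 2)⁻¹ - (t ^ 2 + 0 ^ 2)⁻¹ = -(ε ^ 2 / (t ^ 2 + ε ^ 2) * (t ^ 2)⁻¹) := by
    field_simp
    ring
  rw [e1, norm_neg, Real.norm_of_nonneg (by positivity)]
  have e2 : ε ^ 2 / (t ^ 2 + ε ^ 2) ≤ (ε / t) ^ δ := by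
    rcases le_or_gt ε t with hle | hlt
    · have h1 : ε ^ 2 / (t ^ 2 + ε ^ 2) ≤ (ε / t) ^ (2 : ℝ) := by
        rw [Real.rpow_two, div_pow]
        gcongr
        nlinarith [sq_nonneg ε]
      exact h1.trans (Real.rpow_le_rpow_of_exponent_ge (by positivity)
        ((div_le_one h).2 hle) (by linarith))
    · have h1 : ε ^ 2 / (t ^ 2 + ε ^ 2) ≤ 1 := (div_le_one (by positivity)).2 (by nlinarith [sq_nonneg t])
      exact h1.trans (Real.one_le_rpow ((one_le_div h).2 hlt.le) hδ.le)
  calc ε ^ 2 / (t ^ 2 + ε ^ 2) * (t ^ 2)⁻¹ * t ≤ (ε / t) ^ δ * (t ^ 2)⁻¹ * t := by gcongr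
    _ = ε ^ δ * t ^ (-(1 + δ)) := by
      rw [Real.div_rpow hε.le h.le, neg_add, Real.rpow_add h, Real.rpow_neg h.le, Real.rpow_neg h.le,
        Real.rpow_one]
      field_simp

theorem continuous_gradKernel {ε : ℝ} (hε : 0 < ε) : Continuous (gradKernel ε) := by
  have h1 : Continuous fun z : Plane => (‖z‖ ^ 2 + ε ^ 2)⁻¹ :=
    Continuous.inv₀ (by fun_prop) fun z => by positivity
  exact h1.smul (innerSL ℝ (E := Plane)).continuous

theorem measurable_gradKernel (ε : ℝ) : Measurable (gradKernel ε) := by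
  have h1 : Measurable fun z : Plane => (‖z‖ ^ 2 + ε ^ 2)⁻¹ := by fun_prop
  exact h1.smul (innerSL ℝ (E := Plane)).continuous.measurable

theorem hasFDerivAt_half_log {ε : ℝ} (hε : 0 < ε) (x y : Plane) :
    HasFDerivAt (fun x : Plane => 1 / 2 * Real.log (‖x - y‖ ^ 2 + ε ^ 2))
      (gradKernel ε (x - y)) x := by
  have h1 : HasFDerivAt (fun x : Plane => ‖x - y‖ ^ 2 + ε ^ 2) (2 • innerSL ℝ (x - y)) x := by
    have := ((hasFDerivAt_id x).sub_const y).norm_sq.add_const (ε ^ 2)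
    simpa using this
  have h2 := (h1.log (by positivity)).const_mul (1 / 2)
  refine h2.congr_fderiv ?_
  ext v
  simp [gradKernel]
  ring

/-! ### Continuous differentiability of the logarithmic potential -/

section
variable {B : Plane → ℝ} {δ M : ℝ}

/-- The logarithmic potential of `B`, without the normalization of `scalarPot`. -/
def logPot (B : Plane → ℝ) (x : Plane) : ℝ := ∫ y, B y * Real.log ‖x - y‖

/-- The gradient of `logPot`. -/
def gradPot (B : Plane → ℝ) (x : Plane) : Plane →L[ℝ] ℝ := ∫ y, B y • gradKernel 0 (x - y)

theorem ae_ne_point (x : Plane) : ∀ᵐ y : Plane, y ≠ x := by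
  simp [ae_iff, measure_singleton]

theorem PotentialBounds.integrable_inv (h : PotentialBounds B δ M) (x : Plane) :
    Integrable fun y => |B y| * ‖x - y‖⁻¹ := by
  refine (h.int.abs.add (h.kernel x)).mono' (h.int.1.norm.mul ?_)
    (Eventually.of_forall fun y => ?_)
  · exact ((measurable_const.sub measurable_id).norm.inv).aestronglyMeasurable
  · rw [Real.norm_of_nonneg (by positivity)]
    have := mul_le_mul_of_nonneg_left (inv_le_one_add_rpow (norm_nonneg (x - y)) h.pos)
      (abs_nonneg (B y))
    simpa [mul_add] using this

theorem PotentialBounds.integral_inv_le (h : PotentialBounds B δ M) (x : Plane) :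
    ∫ y, |B y| * ‖x - y‖⁻¹ ≤ (∫ y, |B y|) + M := by
  have h1 := integral_mono (h.integrable_inv x) (h.int.abs.add (h.kernel x)) (fun y => by
    have := mul_le_mul_of_nonneg_left (inv_le_one_add_rpow (norm_nonneg (x - y)) h.pos)
      (abs_nonneg (B y))
    simpa [mul_add] using this)
  have h2 := integral_add h.int.abs (h.kernel x)
  have h3 := h.kernel_le x
  have h4 : ∫ y, |B y| * ‖x - y‖⁻¹ ≤ ∫ y, (|B y| + |B y| * ‖x - y‖ ^ (-(1 + δ))) := h1
  linarith

/-- The growth of the logarithm is absorbed by the moment of order δ through |x-y|^δ ≤ |x|^δ +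
|y|^δ, its singularity by the kernel bound. -/
theorem PotentialBounds.integrable_log (h : PotentialBounds B δ M) (x : Plane) :
    Integrable fun y => B y * Real.log ‖x - y‖ := by
  have hδ := h.pos
  refine ((((h.int.abs.mul_const (‖x‖ ^ δ)).add h.moment).div_const δ).add
    ((h.kernel x).div_const (1 + δ))).mono' (h.int.1.mul ?_) (Eventually.of_forall fun y => ?_)
  · exact ((measurable_const.sub measurable_id).norm.log).aestronglyMeasurable
  · rw [norm_mul, Real.norm_eq_abs, Real.norm_eq_abs]
    have h1 := abs_log_le (norm_nonneg (x - y)) hδ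
    have h2 : ‖x - y‖ ^ δ ≤ ‖x‖ ^ δ + ‖y‖ ^ δ :=
      (Real.rpow_le_rpow (norm_nonneg _) (norm_sub_le x y) hδ.le).trans
        (Real.rpow_add_le_add_rpow (norm_nonneg _) (norm_nonneg _) hδ.le h.le_one)
    have h3 : ‖x - y‖ ^ δ / δ ≤ (‖x‖ ^ δ + ‖y‖ ^ δ) / δ := by gcongr
    refine (mul_le_mul_of_nonneg_left (h1.trans (add_le_add_left h3 _)) (abs_nonneg (B y))).trans
      (le_of_eq ?_)
    simp only [Pi.add_apply]
    ring

/-- The regularized potential. -/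
def logPotReg (B : Plane → ℝ) (ε : ℝ) (x : Plane) : ℝ :=
  ∫ y, B y * (1 / 2 * Real.log (‖x - y‖ ^ 2 + ε ^ 2))

/-- The gradient of the regularized potential. -/
def gradPotReg (B : Plane → ℝ) (ε : ℝ) (x : Plane) : Plane →L[ℝ] ℝ :=
  ∫ y, B y • gradKernel ε (x - y)

theorem reg_sub_le {ε : ℝ} (hε : 0 < ε) (x : Plane) :
    ∀ᵐ y, ‖B y * (1 / 2 * Real.log (‖x - y‖ ^ 2 + ε ^ 2)) - B y * Real.log ‖x - y‖‖
      ≤ ε * (|B y| * ‖x - y‖⁻¹) := by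
  filter_upwards [ae_ne_point x] with y hy
  have hz : 0 < ‖x - y‖ := norm_pos_iff.2 (sub_ne_zero.2 hy.symm)
  rw [← mul_sub, norm_mul, Real.norm_eq_abs, Real.norm_eq_abs]
  have := mul_le_mul_of_nonneg_left (abs_half_log_sub_log_le hz hε) (abs_nonneg (B y))
  linarith

theorem PotentialBounds.integrable_reg (h : PotentialBounds B δ M) {ε : ℝ} (hε : 0 < ε)
    (x : Plane) : Integrable fun y => B y * (1 / 2 * Real.log (‖x - y‖ ^ 2 + ε ^ 2)) := by
  have hm : AEStronglyMeasurable fun y : Plane => 1 / 2 * Real.log (‖x - y‖ ^ 2 + ε ^ 2) :=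
    ((((measurable_const.sub measurable_id).norm.pow_const 2).add_const _).log.const_mul
      _).aestronglyMeasurable
  have := ((h.integrable_inv x).const_mul ε).mono'
    ((h.int.1.mul hm).sub (h.integrable_log x).1) (reg_sub_le hε x)
  exact (this.add (h.integrable_log x)).congr (Eventually.of_forall fun y => by simp)

theorem PotentialBounds.abs_logPotReg_sub_le (h : PotentialBounds B δ M) {ε : ℝ} (hε : 0 < ε)
    (x : Plane) : |logPotReg B ε x - logPot B x| ≤ ε * ((∫ y, |B y|) + M) := by
  rw [logPotReg, logPot, ← integral_sub (h.integrable_reg hε x) (h.integrable_log x)]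
  refine (norm_integral_le_of_norm_le ((h.integrable_inv x).const_mul ε)
    (reg_sub_le hε x)).trans ?_
  rw [integral_const_mul]
  exact mul_le_mul_of_nonneg_left (h.integral_inv_le x) hε.le

theorem PotentialBounds.integrable_gradKernel_reg (h : PotentialBounds B δ M) {ε : ℝ}
    (hε : 0 < ε) (x : Plane) : Integrable fun y => B y • gradKernel ε (x - y) := by
  refine (h.int.abs.mul_const ε⁻¹).mono' (h.int.1.smul ?_) (Eventually.of_forall fun y => ?_)
  · exact ((continuous_gradKernel hε).comp (continuous_const.sub continuous_id)).aestronglyMeasurable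
  · rw [norm_smul, Real.norm_eq_abs]
    exact mul_le_mul_of_nonneg_left (norm_gradKernel_le hε _) (abs_nonneg _)

theorem PotentialBounds.integrable_gradKernel (h : PotentialBounds B δ M) (x : Plane) :
    Integrable fun y => B y • gradKernel 0 (x - y) := by
  refine (h.integrable_inv x).mono' (h.int.1.smul ?_) (Eventually.of_forall fun y => ?_)
  · exact ((measurable_gradKernel 0).comp
      (measurable_const.sub measurable_id)).aestronglyMeasurable
  · rw [norm_smul, Real.norm_eq_abs, norm_gradKernel_zero]

theorem PotentialBounds.norm_gradPot_le (h : PotentialBounds B δ M) (x : Plane) :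
    ‖gradPot B x‖ ≤ (∫ y, |B y|) + M := by
  refine (norm_integral_le_of_norm_le (h.integrable_inv x) (Eventually.of_forall fun y => ?_)).trans
    (h.integral_inv_le x)
  rw [norm_smul, Real.norm_eq_abs, norm_gradKernel_zero]

theorem PotentialBounds.norm_gradPotReg_sub_le (h : PotentialBounds B δ M) {ε : ℝ} (hε : 0 < ε)
    (x : Plane) : ‖gradPotReg B ε x - gradPot B x‖ ≤ ε ^ δ * M := by
  rw [gradPotReg, gradPot, ← integral_sub (h.integrable_gradKernel_reg hε x)
    (h.integrable_gradKernel x)]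
  refine (norm_integral_le_of_norm_le ((h.kernel x).const_mul (ε ^ δ))
    (Eventually.of_forall fun y => ?_)).trans ?_
  · have e : B y • gradKernel ε (x - y) - B y • gradKernel 0 (x - y)
        = B y • (gradKernel ε (x - y) - gradKernel 0 (x - y)) := by
      ext v
      simp [mul_sub]
    rw [e, norm_smul, Real.norm_eq_abs]
    have := mul_le_mul_of_nonneg_left (norm_gradKernel_sub_le hε h.pos h.le_one (x - y))
      (abs_nonneg (B y))
    linarith
  · rw [integral_const_mul]
    exact mul_le_mul_of_nonneg_left (h.kernel_le x) (by positivity)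

theorem PotentialBounds.hasFDerivAt_logPotReg (h : PotentialBounds B δ M) {ε : ℝ} (hε : 0 < ε)
    (x : Plane) : HasFDerivAt (logPotReg B ε) (gradPotReg B ε x) x := by
  refine hasFDerivAt_integral_of_dominated_of_fderiv_le (bound := fun y => |B y| * ε⁻¹)
    (F' := fun x y => B y • gradKernel ε (x - y)) univ_mem
    (Eventually.of_forall fun x => (h.integrable_reg hε x).1) (h.integrable_reg hε x)
    (h.integrable_gradKernel_reg hε x).1 (Eventually.of_forall fun y x _ => ?_)
    (h.int.abs.mul_const _) (Eventually.of_forall fun y x _ => ?_)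
  · rw [norm_smul, Real.norm_eq_abs]
    exact mul_le_mul_of_nonneg_left (norm_gradKernel_le hε _) (abs_nonneg _)
  · exact (hasFDerivAt_half_log hε x y).const_mul (B y)

theorem PotentialBounds.continuous_gradPotReg (h : PotentialBounds B δ M) {ε : ℝ} (hε : 0 < ε) :
    Continuous (gradPotReg B ε) := by
  refine continuous_of_dominated (bound := fun y => |B y| * ε⁻¹)
    (fun x => (h.integrable_gradKernel_reg hε x).1)
    (fun x => Eventually.of_forall fun y => ?_) (h.int.abs.mul_const _)
    (Eventually.of_forall fun y => ?_)
  · rw [norm_smul, Real.norm_eq_abs]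
    exact mul_le_mul_of_nonneg_left (norm_gradKernel_le hε _) (abs_nonneg _)
  · exact ((continuous_gradKernel hε).comp (continuous_id.sub continuous_const)).const_smul (B y)

/-- The error is at most ε^δ M at every point, M being the uniform bound on the kernel integral. -/
theorem PotentialBounds.tendstoUniformly (h : PotentialBounds B δ M) :
    TendstoUniformly (fun n : ℕ => gradPotReg B (1 / ((n : ℝ) + 1))) (gradPot B) atTop := by
  have ht : Tendsto (fun n : ℕ => (1 / ((n : ℝ) + 1)) ^ δ * M) atTop (𝓝 0) := by
    have := (tendsto_one_div_add_atTop_nhds_zero_nat (𝕜 := ℝ)).rpow_const (p := δ)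
      (Or.inr h.pos.le)
    rw [Real.zero_rpow h.pos.ne'] at this
    simpa using this.mul_const M
  rw [Metric.tendstoUniformly_iff]
  intro e he
  filter_upwards [ht.eventually_lt_const he] with n hn x
  rw [dist_comm, dist_eq_norm]
  exact (h.norm_gradPotReg_sub_le (by positivity) x).trans_lt hn

theorem PotentialBounds.continuous_gradPot (h : PotentialBounds B δ M) : Continuous (gradPot B) :=
  h.tendstoUniformly.continuous
    (Frequently.of_forall fun _ => h.continuous_gradPotReg (by positivity))

/-- Differentiation under the integral fails for the singular kernel itself, whose derivative has no
integrable majorant uniform in x at hand; it holds after regularization, and uniform convergence of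
the gradients passes it to the limit. -/
theorem PotentialBounds.hasFDerivAt_logPot (h : PotentialBounds B δ M) (x : Plane) :
    HasFDerivAt (logPot B) (gradPot B x) x := by
  refine hasFDerivAt_of_tendstoUniformly h.tendstoUniformly
    (fun n x => h.hasFDerivAt_logPotReg (by positivity) x) (fun x => ?_) x
  rw [tendsto_iff_norm_sub_tendsto_zero]
  refine squeeze_zero (fun _ => norm_nonneg _)
    (fun n => h.abs_logPotReg_sub_le (ε := 1 / ((n : ℝ) + 1)) (by positivity) x) ?_
  simpa using (tendsto_one_div_add_atTop_nhds_zero_nat (𝕜 := ℝ)).mul_const ((∫ y, |B y|) + M)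

end

end

section

/-! ### The Poisson equation for the potential, in weak form -/

theorem gradKernel_zero_apply (z v : Plane) : gradKernel 0 z v = (‖z‖ ^ 2)⁻¹ * inner ℝ z v := by
  simp [gradKernel]

/-- The representation of a test function by its gradient at the origin. -/
theorem integral_fderiv_radial {φ : Plane → ℝ} (hφ : ContDiff ℝ 1 φ) (hc : HasCompactSupport φ) :
    ∫ x, (‖x‖ ^ 2)⁻¹ * fderiv ℝ φ x x = -(2 * Real.pi * φ 0) := by
  obtain ⟨R0, hR0⟩ := hc.isCompact.isBounded.subset_closedBall (0 : Plane)
  set R := max R0 1 with hRdef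
  have hR : 0 < R := lt_of_lt_of_le one_pos (le_max_right _ _)
  have hzero : ∀ r t, R < r → polarPoint (r, t) ∉ tsupport φ := fun r t hr hm => by
    have := hR0 hm
    rw [mem_closedBall_zero_iff, norm_polarPoint, abs_of_pos (hR.trans hr)] at this
    linarith [le_max_left R0 1]
  -- The Jacobian r cancels the singularity of |x|⁻² x, leaving the radial derivative of φ,
  -- continuous up to r = 0. Each ray then contributes -φ(0).
  set F : ℝ → ℝ → ℝ := fun r t => fderiv ℝ φ (polarPoint (r, t)) (radialVec t) with hF
  have hrc : Continuous radialVec := by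
    unfold radialVec
    fun_prop
  have hpc : Continuous polarPoint := contDiff_polarPoint.continuous
  have hFc : Continuous (Function.uncurry F) :=
    ((hφ.continuous_fderiv one_ne_zero).comp hpc).clm_apply (hrc.comp continuous_snd)
  have hd : ∀ r t, HasDerivAt (fun s => φ (polarPoint (s, t))) (F r t) r := fun r t =>
    (hφ.differentiable one_ne_zero (polarPoint (r, t))).hasFDerivAt.comp_hasDerivAt r
      (hasDerivAt_polarPoint_fst r t)
  -- The radius R + 1 is taken so that φ vanishes on the end circle itself.
  rw [integral_eq_polar (F := F) (R := R + 1) (by linarith) hFc.continuousOn]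
  · have hder := hasDerivAt_intervalIntegral_of_continuous
      (F := fun r t => φ (polarPoint (r, t))) (a := -Real.pi) (b := Real.pi)
      (hφ.continuous.comp hpc) hFc hd
    have hcont := intervalIntegral.continuous_parametric_intervalIntegral_of_continuous' (μ := volume)
      hFc (-Real.pi) Real.pi
    rw [intervalIntegral.integral_eq_sub_of_hasDerivAt (fun r _ => hder r)
      (hcont.intervalIntegrable _ _)]
    have h1 : ∀ t, φ (polarPoint (R + 1, t)) = 0 := fun t =>
      image_eq_zero_of_notMem_tsupport (hzero _ t (by linarith))
    have h0 : ∀ t, φ (polarPoint (0, t)) = φ 0 := fun t => by rw [polarPoint_eq, zero_smul]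
    simp only [h1, h0, intervalIntegral.integral_const, smul_eq_mul]
    ring
  · intro r t hr
    rw [norm_polarPoint, abs_of_pos hr]
    simp only [hF]
    nth_rewrite 2 [polarPoint_eq]
    rw [map_smul, smul_eq_mul]
    field_simp
  · intro r t hr
    have : fderiv ℝ φ (polarPoint (r, t)) = 0 := by
      by_contra hne
      exact hzero r t (by linarith) (support_fderiv_subset ℝ hne)
    simp [hF, this]

theorem integral_gradKernel_fderiv {φ : Plane → ℝ} (hφ : ContDiff ℝ 1 φ)
    (hc : HasCompactSupport φ) (y : Plane) :
    ∫ x, (‖x - y‖ ^ 2)⁻¹ * fderiv ℝ φ x (x - y) = -(2 * Real.pi * φ y) := by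
  have h1 : ContDiff ℝ 1 fun x => φ (x + y) := hφ.comp (contDiff_id.add contDiff_const)
  have h2 : HasCompactSupport fun x => φ (x + y) :=
    hc.comp_homeomorph (Homeomorph.addRight y)
  have h3 := integral_fderiv_radial h1 h2
  rw [← integral_add_right_eq_self _ y]
  simp only [fderiv_comp_add_right, zero_add, add_sub_cancel_right] at h3 ⊢
  exact h3

theorem clm_eq_sum (L : Plane →L[ℝ] ℝ) (v : Plane) : L v = ∑ j, v j * L (unitVec j) := by
  have : v = ∑ j, v j • unitVec j := by
    ext i
    fin_cases i <;> simp [unitVec]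
  conv_lhs => rw [this]
  simp

theorem gradKernel_zero_unitVec (z : Plane) (j : Fin 2) :
    gradKernel 0 z (unitVec j) = (‖z‖ ^ 2)⁻¹ * z j := by
  rw [gradKernel_zero_apply, unitVec, EuclideanSpace.inner_single_right]
  simp

variable {B : Plane → ℝ} {δ M : ℝ}

/-- `-Δ logPot B = -2π B` in weak form. -/
theorem PotentialBounds.integral_gradPot_mul (h : PotentialBounds B δ M) {φ : Plane → ℝ}
    (hφ : ContDiff ℝ 1 φ) (hc : HasCompactSupport φ) :
    ∫ x, ∑ j, gradPot B x (unitVec j) * partialD j φ x = -(2 * Real.pi) * ∫ y, B y * φ y := by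
  set F : Plane → Plane → ℝ := fun x y => B y * ((‖x - y‖ ^ 2)⁻¹ * fderiv ℝ φ x (x - y)) with hF
  have hfc : Continuous (fderiv ℝ φ) := hφ.continuous_fderiv one_ne_zero
  have hfi : Integrable fun x => ‖fderiv ℝ φ x‖ :=
    (hfc.integrable_of_hasCompactSupport (hc.fderiv ℝ)).norm
  have hker : Measurable fun p : Plane × Plane =>
      (‖p.1 - p.2‖ ^ 2)⁻¹ * fderiv ℝ φ p.1 (p.1 - p.2) := by
    have h1 : Continuous fun p : Plane × Plane => fderiv ℝ φ p.1 (p.1 - p.2) :=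
      (hfc.comp continuous_fst).clm_apply (continuous_fst.sub continuous_snd)
    have h2 : Measurable fun p : Plane × Plane => (‖p.1 - p.2‖ ^ 2)⁻¹ := by fun_prop
    exact h2.mul h1.measurable
  have hbound : ∀ x y, ‖F x y‖ ≤ ‖fderiv ℝ φ x‖ * (|B y| * ‖x - y‖⁻¹) := fun x y => by
    simp only [hF]
    rw [norm_mul, norm_mul, Real.norm_eq_abs, Real.norm_of_nonneg (by positivity)]
    have h1 := (fderiv ℝ φ x).le_opNorm (x - y)
    rcases eq_or_ne ‖x - y‖ 0 with h0 | h0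
    · simp [h0]
    · calc |B y| * ((‖x - y‖ ^ 2)⁻¹ * ‖fderiv ℝ φ x (x - y)‖)
          ≤ |B y| * ((‖x - y‖ ^ 2)⁻¹ * (‖fderiv ℝ φ x‖ * ‖x - y‖)) := by gcongr
        _ = _ := by field_simp
  have hFm : AEStronglyMeasurable (Function.uncurry F) (volume.prod volume) :=
    h.int.1.comp_snd.mul hker.aestronglyMeasurable
  have hFi : Integrable (Function.uncurry F) (volume.prod volume) := by
    rw [integrable_prod_iff hFm]
    constructor
    · refine Eventually.of_forall fun x => ((h.integrable_inv x).const_mul ‖fderiv ℝ φ x‖).mono'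
        ?_ (Eventually.of_forall fun y => hbound x y)
      exact h.int.1.mul (hker.comp measurable_prodMk_left).aestronglyMeasurable
    · refine (hfi.mul_const ((∫ y, |B y|) + M)).mono' hFm.norm.integral_prod_right'
        (Eventually.of_forall fun x => ?_)
      rw [Real.norm_of_nonneg (integral_nonneg fun _ => norm_nonneg _)]
      refine (integral_mono_of_nonneg (Eventually.of_forall fun _ => norm_nonneg _)
        ((h.integrable_inv x).const_mul ‖fderiv ℝ φ x‖)
        (Eventually.of_forall fun y => hbound x y)).trans ?_
      rw [integral_const_mul]
      exact mul_le_mul_of_nonneg_left (h.integral_inv_le x) (norm_nonneg _)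
  have h1 : ∀ x, ∑ j, gradPot B x (unitVec j) * partialD j φ x = ∫ y, F x y := fun x => by
    have hg := h.integrable_gradKernel x
    have e : ∀ j, gradPot B x (unitVec j) * partialD j φ x
        = ∫ y, B y * ((‖x - y‖ ^ 2)⁻¹ * (x - y) j) * partialD j φ x := fun j => by
      rw [gradPot, ContinuousLinearMap.integral_apply hg, integral_mul_const]
      simp only [smul_apply, gradKernel_zero_unitVec, smul_eq_mul]
    simp only [e]
    rw [← integral_finsetSum]
    · refine integral_congr_ae (Eventually.of_forall fun y => ?_)
      simp only [hF, clm_eq_sum (fderiv ℝ φ x) (x - y), Finset.mul_sum, partialD]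
      exact Finset.sum_congr rfl fun j _ => by ring
    · intro j _
      have := ((ContinuousLinearMap.apply ℝ ℝ (unitVec j)).integrable_comp hg).mul_const
        (partialD j φ x)
      refine this.congr (Eventually.of_forall fun y => ?_)
      simp [gradKernel_zero_unitVec]
  simp only [h1]
  -- By Fubini the inner integral runs over x, where it is the representation of φ(y) by its
  -- gradient.
  rw [integral_integral_swap hFi, ← integral_const_mul]
  refine integral_congr_ae (Eventually.of_forall fun y => ?_)
  simp only [hF]
  rw [integral_const_mul, integral_gradKernel_fderiv hφ hc]
  ring

theorem PotentialBounds.hasFDerivAt_scalarPot (h : PotentialBounds B δ M) (x : Plane) :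
    HasFDerivAt (scalarPot B) (-(1 / (2 * Real.pi)) • gradPot B x) x :=
  (h.hasFDerivAt_logPot x).const_mul (-(1 / (2 * Real.pi)))

theorem PotentialBounds.partialD_scalarPot (h : PotentialBounds B δ M) (j : Fin 2) (x : Plane) :
    partialD j (scalarPot B) x = -(1 / (2 * Real.pi)) * gradPot B x (unitVec j) := by
  rw [partialD, (h.hasFDerivAt_scalarPot x).fderiv]
  simp

theorem PotentialBounds.contDiff_scalarPot (h : PotentialBounds B δ M) :
    ContDiff ℝ 1 (scalarPot B) := by
  rw [contDiff_one_iff_hasFDerivAt]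
  exact ⟨_, h.continuous_gradPot.const_smul (-(1 / (2 * Real.pi))), h.hasFDerivAt_scalarPot⟩

/-- A bound for the gradient of `scalarPot`. -/
theorem PotentialBounds.exists_bound_partialD (h : PotentialBounds B δ M) :
    ∃ A, 0 ≤ A ∧ ∀ j x, |partialD j (scalarPot B) x| ≤ A := by
  refine ⟨1 / (2 * Real.pi) * ((∫ y, |B y|) + M), ?_, fun j x => ?_⟩
  · exact mul_nonneg (by positivity) ((norm_nonneg _).trans (h.norm_gradPot_le 0))
  · rw [h.partialD_scalarPot, abs_mul, abs_neg, abs_of_pos (by positivity)]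
    refine mul_le_mul_of_nonneg_left ?_ (by positivity)
    refine ((gradPot B x).le_opNorm (unitVec j)).trans ?_
    simpa [unitVec] using h.norm_gradPot_le x

/-- `-Δ h = B` in weak form. -/
theorem PotentialBounds.integral_partialD_mul (h : PotentialBounds B δ M) {φ : Plane → ℝ}
    (hφ : ContDiff ℝ 1 φ) (hc : HasCompactSupport φ) :
    ∫ x, ∑ j, partialD j (scalarPot B) x * partialD j φ x = ∫ y, B y * φ y := by
  have e : ∀ x, ∑ j, partialD j (scalarPot B) x * partialD j φ x
      = -(1 / (2 * Real.pi)) * ∑ j, gradPot B x (unitVec j) * partialD j φ x := fun x => by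
    simp only [h.partialD_scalarPot, Finset.mul_sum, mul_assoc]
  simp only [e]
  rw [integral_const_mul, h.integral_gradPot_mul hφ hc]
  field_simp

end

section

/-! ### Convergence in `L²` -/

/-- Convergence in `L²`, in terms of integrals. -/
structure SqTendsto (F : ℕ → Plane → ℂ) (f : Plane → ℂ) : Prop where
  mem : ∀ n, MemLp (F n) 2 volume
  mem_lim : MemLp f 2 volume
  tendsto : Tendsto (fun n => ∫ x, ‖F n x - f x‖ ^ 2) atTop (𝓝 0)

theorem integrable_normSq {f : Plane → ℂ} (hf : MemLp f 2 volume) :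
    Integrable fun x => ‖f x‖ ^ 2 :=
  (memLp_two_iff_integrable_sq_norm hf.1).1 hf

theorem integral_normSq_add_le {f g : Plane → ℂ} (hf : MemLp f 2 volume) (hg : MemLp g 2 volume) :
    ∫ x, ‖f x + g x‖ ^ 2 ≤ 2 * (∫ x, ‖f x‖ ^ 2) + 2 * ∫ x, ‖g x‖ ^ 2 := by
  rw [← integral_const_mul, ← integral_const_mul, ← integral_add
    ((integrable_normSq hf).const_mul 2) ((integrable_normSq hg).const_mul 2)]
  refine integral_mono (integrable_normSq (hf.add hg)) (((integrable_normSq hf).const_mul 2).add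
    ((integrable_normSq hg).const_mul 2)) fun x => ?_
  have h1 := norm_add_le (f x) (g x)
  have h2 : ‖f x + g x‖ ^ 2 ≤ (‖f x‖ + ‖g x‖) ^ 2 := by gcongr
  simp only
  nlinarith [sq_nonneg (‖f x‖ - ‖g x‖)]

theorem SqTendsto.add {F G : ℕ → Plane → ℂ} {f g : Plane → ℂ} (hF : SqTendsto F f)
    (hG : SqTendsto G g) : SqTendsto (fun n x => F n x + G n x) (fun x => f x + g x) where
  mem n := (hF.mem n).add (hG.mem n)
  mem_lim := hF.mem_lim.add hG.mem_lim
  tendsto := by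
    have h := (hF.tendsto.const_mul 2).add (hG.tendsto.const_mul 2)
    rw [mul_zero, add_zero] at h
    refine squeeze_zero (fun n => integral_nonneg fun x => by positivity) (fun n => ?_) h
    have := integral_normSq_add_le ((hF.mem n).sub hF.mem_lim) ((hG.mem n).sub hG.mem_lim)
    refine le_trans (le_of_eq ?_) this
    congr 1
    funext x
    simp only [Pi.sub_apply]
    congr 2
    ring

/-- Multiplication by a bounded measurable function preserves `L²`. -/
theorem memLp_mul_bdd {f a : Plane → ℂ} (hf : MemLp f 2 volume)
    (ha : AEStronglyMeasurable a volume) {A : ℝ} (hA : ∀ x, ‖a x‖ ≤ A) :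
    MemLp (fun x => a x * f x) 2 volume :=
  (hf.norm.const_mul A).of_le (ha.mul hf.1) (Eventually.of_forall fun x => by
    rw [norm_mul]
    exact (mul_le_mul_of_nonneg_right (hA x) (norm_nonneg _)).trans (le_abs_self _))

theorem SqTendsto.bdd_mul {F : ℕ → Plane → ℂ} {f a : Plane → ℂ} (hF : SqTendsto F f)
    (ha : AEStronglyMeasurable a volume) {A : ℝ} (hA : ∀ x, ‖a x‖ ≤ A) :
    SqTendsto (fun n x => a x * F n x) (fun x => a x * f x) where
  mem n := memLp_mul_bdd (hF.mem n) ha hA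
  mem_lim := memLp_mul_bdd hF.mem_lim ha hA
  tendsto := by
    have h := hF.tendsto.const_mul (A ^ 2)
    rw [mul_zero] at h
    refine squeeze_zero (fun n => integral_nonneg fun x => by positivity) (fun n => ?_) h
    rw [← integral_const_mul]
    refine integral_mono_of_nonneg (Eventually.of_forall fun x => by positivity)
      ((integrable_normSq ((hF.mem n).sub hF.mem_lim)).const_mul _)
      (Eventually.of_forall fun x => ?_)
    simp only
    rw [← mul_sub, norm_mul, mul_pow]
    have := hA x
    gcongr

/-- If `∫ |f_n - f|² → 0` with respect to a nonnegative weight, then `∫ |f_n|² → ∫ |f|²`. -/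
theorem tendsto_integral_weighted_sq {F : ℕ → Plane → ℂ} {f : Plane → ℂ} {W : Plane → ℝ}
    (hW : ∀ x, 0 ≤ W x) (hF : ∀ n, Integrable fun x => W x * ‖F n x‖ ^ 2)
    (hf : Integrable fun x => W x * ‖f x‖ ^ 2)
    (hFf : ∀ n, Integrable fun x => W x * ‖F n x - f x‖ ^ 2)
    (h : Tendsto (fun n => ∫ x, W x * ‖F n x - f x‖ ^ 2) atTop (𝓝 0)) :
    Tendsto (fun n => ∫ x, W x * ‖F n x‖ ^ 2) atTop (𝓝 (∫ x, W x * ‖f x‖ ^ 2)) := by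
  set N := ∫ x, W x * ‖f x‖ ^ 2 with hN
  have hN0 : 0 ≤ N := integral_nonneg fun x => mul_nonneg (hW x) (by positivity)
  -- From |a² - b²| ≤ d(d + 2b) with d ≥ |a - b|, and 2bd ≤ ηb² + d²/η. The parameter η is later
  -- fixed by the size of N, before n is sent to infinity.
  have key : ∀ η > 0, ∀ n, |(∫ x, W x * ‖F n x‖ ^ 2) - N|
      ≤ η * N + (1 + η⁻¹) * ∫ x, W x * ‖F n x - f x‖ ^ 2 := fun η hη n => by
    rw [hN, ← integral_sub (hF n) hf, ← integral_const_mul, ← integral_const_mul,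
      ← integral_add (hf.const_mul η) ((hFf n).const_mul _), ← Real.norm_eq_abs]
    refine norm_integral_le_of_norm_le ((hf.const_mul η).add ((hFf n).const_mul _))
      (Eventually.of_forall fun x => ?_)
    rw [← mul_sub, Real.norm_eq_abs, abs_mul, abs_of_nonneg (hW x)]
    have h1 := abs_norm_sub_norm_le (F n x) (f x)
    set d := ‖F n x - f x‖
    set b := ‖f x‖
    set a := ‖F n x‖
    have hd : 0 ≤ d := norm_nonneg _
    have hb : 0 ≤ b := norm_nonneg _
    have ha : 0 ≤ a := norm_nonneg _
    have h2 : |a ^ 2 - b ^ 2| ≤ d * (d + 2 * b) := by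
      rw [show a ^ 2 - b ^ 2 = (a - b) * (a + b) by ring, abs_mul, abs_of_nonneg (add_nonneg ha hb)]
      have : a ≤ d + b := by linarith [le_abs_self (a - b)]
      exact mul_le_mul h1 (by linarith) (by positivity) hd
    have h3 : d * (d + 2 * b) ≤ η * b ^ 2 + (1 + η⁻¹) * d ^ 2 := by
      have : 0 ≤ η * (b - η⁻¹ * d) ^ 2 := by positivity
      have e : η * (b - η⁻¹ * d) ^ 2 = η * b ^ 2 - 2 * b * d + η⁻¹ * d ^ 2 := by
        field_simp
        ring
      rw [e] at this
      linarith
    have := mul_le_mul_of_nonneg_left (h2.trans h3) (hW x)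
    linarith
  rw [Metric.tendsto_atTop']
  intro e he
  set η := e / (2 * (N + 1)) with hη
  have hη0 : 0 < η := by positivity
  have hηN : η * N < e / 2 + 0 * N := by
    rw [hη, div_mul_eq_mul_div, div_lt_iff₀ (by positivity)]
    nlinarith
  have ht := h.const_mul (1 + η⁻¹)
  rw [mul_zero] at ht
  obtain ⟨n0, hn0⟩ := (ht.eventually_lt_const (half_pos he)).exists_forall_of_atTop
  refine ⟨n0, fun n hn => ?_⟩
  rw [Real.dist_eq]
  have := key η hη0 n
  have := hn0 n hn.le
  linarith

theorem SqTendsto.tendsto_weighted {F : ℕ → Plane → ℂ} {f : Plane → ℂ} (hF : SqTendsto F f)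
    {W : Plane → ℝ} (hWm : AEStronglyMeasurable W volume) (hW : ∀ x, 0 ≤ W x) {A : ℝ}
    (hA : ∀ x, W x ≤ A) :
    Tendsto (fun n => ∫ x, W x * ‖F n x‖ ^ 2) atTop (𝓝 (∫ x, W x * ‖f x‖ ^ 2)) := by
  have hi : ∀ {g : Plane → ℂ}, MemLp g 2 volume → Integrable fun x => W x * ‖g x‖ ^ 2 :=
    fun {g} hg => (integrable_normSq hg).bdd_mul hWm (c := A)
      (Eventually.of_forall fun x => by rw [Real.norm_of_nonneg (hW x)]; exact hA x)
  refine tendsto_integral_weighted_sq hW (fun n => hi (hF.mem n)) (hi hF.mem_lim)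
    (fun n => hi ((hF.mem n).sub hF.mem_lim)) ?_
  have h := hF.tendsto.const_mul A
  rw [mul_zero] at h
  refine squeeze_zero (fun n => integral_nonneg fun x => mul_nonneg (hW x) (by positivity))
    (fun n => ?_) h
  rw [← integral_const_mul]
  refine integral_mono (hi ((hF.mem n).sub hF.mem_lim))
    ((integrable_normSq ((hF.mem n).sub hF.mem_lim)).const_mul _) fun x => ?_
  exact mul_le_mul_of_nonneg_right (hA x) (by positivity)

theorem SqTendsto.tendsto_integral {F : ℕ → Plane → ℂ} {f : Plane → ℂ} (hF : SqTendsto F f) :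
    Tendsto (fun n => ∫ x, ‖F n x‖ ^ 2) atTop (𝓝 (∫ x, ‖f x‖ ^ 2)) := by
  simpa using hF.tendsto_weighted (W := fun _ => 1) aestronglyMeasurable_const
    (fun _ => zero_le_one) (fun _ => le_rfl)

/-! ### Mollification -/

/-- A sequence of bump functions whose supports shrink to the origin. -/
def bump (n : ℕ) : ContDiffBump (0 : Plane) where
  rIn := 1 / (2 * ((n : ℝ) + 1))
  rOut := 1 / ((n : ℝ) + 1)
  rIn_pos := by positivity
  rIn_lt_rOut := by
    refine one_div_lt_one_div_of_lt (by positivity) ?_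
    have : (0 : ℝ) ≤ n := n.cast_nonneg
    linarith

/-- The normalized bump functions. -/
def bumpN (n : ℕ) : Plane → ℝ := (bump n).normed volume

theorem bumpN_nonneg (n : ℕ) (x : Plane) : 0 ≤ bumpN n x := (bump n).nonneg_normed x

theorem contDiff_bumpN (n : ℕ) : ContDiff ℝ ∞ (bumpN n) := (bump n).contDiff_normed

theorem hasCompactSupport_bumpN (n : ℕ) : HasCompactSupport (bumpN n) :=
  (bump n).hasCompactSupport_normed

theorem integrable_bumpN (n : ℕ) : Integrable (bumpN n) := (bump n).integrable_normed

theorem integral_bumpN (n : ℕ) : ∫ x, bumpN n x = 1 := (bump n).integral_normed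

/-- Mollification by `bumpN n`. -/
def moll (n : ℕ) (f : Plane → ℂ) : Plane → ℂ :=
  convolution (bumpN n) f (ContinuousLinearMap.lsmul ℝ ℝ) volume

theorem moll_apply (n : ℕ) (f : Plane → ℂ) (x : Plane) :
    moll n f x = ∫ t, bumpN n t • f (x - t) := rfl

theorem contDiff_moll (n : ℕ) {f : Plane → ℂ} (hf : LocallyIntegrable f volume) :
    ContDiff ℝ ∞ (moll n f) :=
  (hasCompactSupport_bumpN n).contDiff_convolution_left (n := ⊤) _ (contDiff_bumpN n) hf

theorem MemLp.locInt {f : Plane → ℂ} (hf : MemLp f 2 volume) : LocallyIntegrable f volume :=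
  hf.locallyIntegrable one_le_two

theorem integrable_bumpN_mul_sq (n : ℕ) {f : Plane → ℂ} (hf : MemLp f 2 volume) (x : Plane) :
    Integrable fun t => bumpN n t * ‖f (x - t)‖ ^ 2 := by
  obtain ⟨C, hC⟩ := (hasCompactSupport_bumpN n).exists_bound_of_continuous
    (contDiff_bumpN n).continuous
  exact ((integrable_normSq hf).comp_sub_left x).bdd_mul
    (contDiff_bumpN n).continuous.aestronglyMeasurable (Eventually.of_forall hC)

/-- Jensen's inequality for the probability density `bumpN n`, in the form that the variance of |f(x
- ·)| is nonnegative. -/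
theorem norm_moll_sq_le (n : ℕ) {f : Plane → ℂ} (hf : MemLp f 2 volume) (x : Plane) :
    ‖moll n f x‖ ^ 2 ≤ ∫ t, bumpN n t * ‖f (x - t)‖ ^ 2 := by
  have h2 := integrable_bumpN_mul_sq n hf x
  have h1 : Integrable fun t => bumpN n t * ‖f (x - t)‖ := by
    have := ((hasCompactSupport_bumpN n).convolutionExists_left
      (ContinuousLinearMap.lsmul ℝ ℝ) (contDiff_bumpN n).continuous (MemLp.locInt hf) x).norm
    refine this.congr (Eventually.of_forall fun t => ?_)
    simp [abs_of_nonneg (bumpN_nonneg n t)]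
  set c := ∫ t, bumpN n t * ‖f (x - t)‖ with hc
  have hle : ‖moll n f x‖ ≤ c := by
    rw [moll_apply]
    refine (norm_integral_le_integral_norm _).trans (le_of_eq ?_)
    simp [hc, abs_of_nonneg (bumpN_nonneg n _)]
  have hsq : 0 ≤ ∫ t, bumpN n t * (‖f (x - t)‖ - c) ^ 2 :=
    integral_nonneg fun t => mul_nonneg (bumpN_nonneg n t) (sq_nonneg _)
  have e : ∫ t, bumpN n t * (‖f (x - t)‖ - c) ^ 2
      = (∫ t, bumpN n t * ‖f (x - t)‖ ^ 2) - 2 * c * c + c ^ 2 * 1 := by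
    have a1 := integral_sub h2 (h1.const_mul (2 * c))
    have a2 := integral_add (h2.sub (h1.const_mul (2 * c))) ((integrable_bumpN n).const_mul (c ^ 2))
    rw [integral_const_mul, ← hc] at a1
    rw [integral_const_mul, integral_bumpN] at a2
    rw [← a1]
    refine Eq.trans (integral_congr_ae (Eventually.of_forall fun t => ?_)) a2
    simp only [Pi.sub_apply]
    ring
  rw [e] at hsq
  have : ‖moll n f x‖ ^ 2 ≤ c ^ 2 := by gcongr
  nlinarith

/-- The pointwise Jensen bound integrates, since convolution with a density of total mass one
preserves the integral of |f|². -/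
theorem memLp_moll (n : ℕ) {f : Plane → ℂ} (hf : MemLp f 2 volume) : MemLp (moll n f) 2 volume ∧
    ∫ x, ‖moll n f x‖ ^ 2 ≤ ∫ x, ‖f x‖ ^ 2 := by
  have hi : Integrable (convolution (bumpN n) (fun x => ‖f x‖ ^ 2)
      (ContinuousLinearMap.mul ℝ ℝ) volume) :=
    (integrable_bumpN n).integrable_convolution _ (integrable_normSq hf)
  have hc := integral_convolution (ContinuousLinearMap.mul ℝ ℝ) (integrable_bumpN n)
    (integrable_normSq hf)
  rw [integral_bumpN] at hc
  have hm : AEStronglyMeasurable (moll n f) volume :=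
    (contDiff_moll n (MemLp.locInt hf)).continuous.aestronglyMeasurable
  have hle : ∀ x, ‖moll n f x‖ ^ 2 ≤ convolution (bumpN n) (fun x => ‖f x‖ ^ 2)
      (ContinuousLinearMap.mul ℝ ℝ) volume x := norm_moll_sq_le n hf
  have hi2 : Integrable fun x => ‖moll n f x‖ ^ 2 :=
    hi.mono' (hm.norm.pow 2) (Eventually.of_forall fun x => by
      rw [Real.norm_of_nonneg (by positivity)]
      exact hle x)
  refine ⟨(memLp_two_iff_integrable_sq_norm hm).2 hi2, (integral_mono hi2 hi hle).trans ?_⟩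
  rw [hc]
  simp

theorem moll_sub (n : ℕ) {f g : Plane → ℂ} (hf : MemLp f 2 volume) (hg : MemLp g 2 volume)
    (x : Plane) : moll n (f - g) x = moll n f x - moll n g x := by
  have h1 := (hasCompactSupport_bumpN n).convolutionExists_left
    (ContinuousLinearMap.lsmul ℝ ℝ) (contDiff_bumpN n).continuous (MemLp.locInt hf) x
  have h2 := (hasCompactSupport_bumpN n).convolutionExists_left
    (ContinuousLinearMap.lsmul ℝ ℝ) (contDiff_bumpN n).continuous (MemLp.locInt hg) x
  simp only [moll_apply, Pi.sub_apply, smul_sub]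
  exact integral_sub h1 h2

theorem moll_eq_zero {g : Plane → ℂ} {R : ℝ} (hg : ∀ x, R < ‖x‖ → g x = 0) (n : ℕ) {x : Plane}
    (hx : R + 1 < ‖x‖) : moll n g x = 0 := by
  rw [moll_apply]
  refine integral_eq_zero_of_ae (Eventually.of_forall fun t => ?_)
  simp only [Pi.zero_apply]
  by_cases ht : t ∈ Metric.ball (0 : Plane) (bump n).rOut
  · have h1 : ‖t‖ < 1 / ((n : ℝ) + 1) := by simpa [bump] using ht
    have h2 : 1 / ((n : ℝ) + 1) ≤ 1 := by
      rw [div_le_one (by positivity)]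
      linarith [n.cast_nonneg (α := ℝ)]
    have h3 := norm_sub_norm_le x t
    rw [hg (x - t) (by linarith), smul_zero]
  · rw [← (bump n).support_normed_eq (μ := volume), Function.notMem_support] at ht
    have : bumpN n t = 0 := ht
    rw [this, zero_smul]

/-- Mollifications of continuous compactly supported functions converge in `L²`. -/
theorem tendsto_moll_of_continuous {g : Plane → ℂ} (hg : Continuous g) (hc : HasCompactSupport g) :
    Tendsto (fun n => ∫ x, ‖moll n g x - g x‖ ^ 2) atTop (𝓝 0) := by
  obtain ⟨R, hR⟩ := hc.isCompact.isBounded.subset_closedBall (0 : Plane)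
  have hg0 : ∀ x, R < ‖x‖ → g x = 0 := fun x hx => by
    refine image_eq_zero_of_notMem_tsupport fun hm => ?_
    have := hR hm
    rw [mem_closedBall_zero_iff] at this
    linarith
  obtain ⟨C, hC⟩ := hc.exists_bound_of_continuous hg
  have hgl : LocallyIntegrable g volume := hg.locallyIntegrable
  have hmoll : ∀ n x, ‖moll n g x‖ ≤ C := fun n x => by
    rw [moll_apply]
    refine (norm_integral_le_of_norm_le ((integrable_bumpN n).mul_const C)
      (Eventually.of_forall fun t => ?_)).trans (le_of_eq ?_)
    · rw [norm_smul, Real.norm_of_nonneg (bumpN_nonneg n t)]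
      exact mul_le_mul_of_nonneg_left (hC _) (bumpN_nonneg n t)
    · rw [integral_mul_const, integral_bumpN, one_mul]
  have hlim : Tendsto (fun n => ∫ x, ‖moll n g x - g x‖ ^ 2) atTop (𝓝 (∫ _ : Plane, (0 : ℝ))) := by
    refine tendsto_integral_of_dominated_convergence
      ((Metric.closedBall (0 : Plane) (R + 1)).indicator fun _ => (2 * C) ^ 2) (fun n => ?_) ?_
      (fun n => Eventually.of_forall fun x => ?_) (Eventually.of_forall fun x => ?_)
    · exact (((contDiff_moll n hgl).continuous.sub hg).norm.pow 2 :
        Continuous fun x => ‖moll n g x - g x‖ ^ 2).aestronglyMeasurable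
    · rw [integrable_indicator_iff Metric.isClosed_closedBall.measurableSet]
      exact integrableOn_const (isCompact_closedBall (0 : Plane) (R + 1)).measure_lt_top.ne
    · rw [Real.norm_of_nonneg (by positivity)]
      by_cases hx : x ∈ Metric.closedBall (0 : Plane) (R + 1)
      · rw [indicator_of_mem hx]
        have := norm_sub_le (moll n g x) (g x)
        have := hmoll n x
        have := hC x
        gcongr
        linarith
      · have hx' : R + 1 < ‖x‖ := by simpa using hx
        rw [indicator_of_notMem hx, moll_eq_zero hg0 n hx', hg0 x (by linarith)]
        simp
    · have h1 : Tendsto (fun n => moll n g x) atTop (𝓝 (g x)) :=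
        ContDiffBump.convolution_tendsto_right_of_continuous (φ := bump)
          (tendsto_one_div_add_atTop_nhds_zero_nat) hg x
      have h2 := ((h1.sub_const (g x)).norm.pow 2)
      simpa using h2
  simpa using hlim

/-- Mollifications converge in `L²`. -/
theorem sqTendsto_moll {f : Plane → ℂ} (hf : MemLp f 2 volume) :
    SqTendsto (fun n => moll n f) f where
  mem n := (memLp_moll n hf).1
  mem_lim := hf
  tendsto := by
    rw [Metric.tendsto_atTop']
    intro e he
    -- Density of continuous compactly supported functions. The two squared triangle inequalities
    -- below cost factors 4, 4 and 2 on three errors of size e/16, so the total stays below e.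
    obtain ⟨g, hgc, hge, hg, hgL⟩ := hf.exists_hasCompactSupport_eLpNorm_sub_le (by norm_num)
      (ε := ENNReal.ofReal (Real.sqrt (e / 16))) (by simpa using he)
    have hD := hf.sub hgL
    have hfg : ∫ x, ‖(f - g) x‖ ^ 2 ≤ e / 16 := by
      have h1 := hD.eLpNorm_eq_integral_rpow_norm (by norm_num) (by norm_num)
      rw [h1] at hge
      have h2 := (ENNReal.ofReal_le_ofReal_iff (Real.sqrt_nonneg _)).1 hge
      simp only [ENNReal.toReal_ofNat, Real.rpow_two] at h2
      rw [← one_div, ← Real.sqrt_eq_rpow] at h2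
      exact (Real.sqrt_le_sqrt_iff (by positivity)).1 h2
    obtain ⟨n0, hn0⟩ := ((tendsto_moll_of_continuous hg hgc).eventually_lt_const
      (show 0 < e / 16 by positivity)).exists_forall_of_atTop
    refine ⟨n0, fun n hn => ?_⟩
    rw [Real.dist_eq, sub_zero, abs_of_nonneg (integral_nonneg fun x => by positivity)]
    have hmD := memLp_moll n hD
    have hmg := (memLp_moll n hgL).1.sub hgL
    have h1 := integral_normSq_add_le (hmD.1.add hmg) hD.neg
    have h2 := integral_normSq_add_le hmD.1 hmg
    have h3 := hn0 n hn.le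
    have e1 : ∀ x, (moll n (f - g) + (moll n g - g)) x + (-(f - g)) x = moll n f x - f x :=
      fun x => by
        simp only [Pi.add_apply, Pi.sub_apply, Pi.neg_apply, moll_sub n hf hgL]
        ring
    simp only [e1] at h1
    simp only [Pi.add_apply, Pi.neg_apply, norm_neg] at h1
    simp only [Pi.sub_apply] at h1 h2 h3 hfg hmD
    have h4 := hmD.2
    linarith

end

section

/-! ### Density of test functions in `H¹` -/

/-- The mollification of a weak derivative is the derivative of the mollification. -/
theorem partialC_moll {u w : Plane → ℂ} {j : Fin 2} (hu : LocallyIntegrable u volume)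
    (hw : ∀ φ : Plane → ℝ, ContDiff ℝ ∞ φ → HasCompactSupport φ →
      ∫ x, (partialD j φ x : ℂ) * u x = -∫ x, (φ x : ℂ) * w x) (n : ℕ) (x : Plane) :
    partialC j (moll n u) x = moll n w x := by
  have hb := contDiff_bumpN n
  have hbc := hasCompactSupport_bumpN n
  have hd := hbc.hasFDerivAt_convolution_left (ContinuousLinearMap.lsmul ℝ ℝ)
    (hb.of_le (by simp)) hu x
  have hex := (hbc.fderiv ℝ).convolutionExists_left
    ((ContinuousLinearMap.lsmul ℝ ℝ : ℝ →L[ℝ] ℂ →L[ℝ] ℂ).precompL Plane)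
    (hb.continuous_fderiv (by simp)) hu x
  have h1 : partialC j (moll n u) x = ∫ t, (partialD j (bumpN n) t : ℂ) * u (x - t) := by
    rw [partialC, show moll n u = convolution (bumpN n) u (ContinuousLinearMap.lsmul ℝ ℝ) volume
      from rfl, hd.fderiv, convolution, ContinuousLinearMap.integral_apply hex]
    refine integral_congr_ae (Eventually.of_forall fun t => ?_)
    simp [partialD, Complex.real_smul]
  -- The reflected and translated bump is the test function for the weak derivative; the sign of its
  -- chain rule cancels the sign in the definition.
  have hφ : ContDiff ℝ ∞ fun y => bumpN n (x - y) := hb.comp (contDiff_const.sub contDiff_id)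
  have hφc : HasCompactSupport fun y => bumpN n (x - y) :=
    hbc.comp_homeomorph (Homeomorph.subLeft x)
  have hφd : ∀ y, partialD j (fun y => bumpN n (x - y)) y = -partialD j (bumpN n) (x - y) :=
    fun y => by
      have := ((hb.differentiable (by simp) (x - y)).hasFDerivAt.comp y
        ((hasFDerivAt_id y).const_sub x)).fderiv
      have e : (fun y => bumpN n (x - y)) = bumpN n ∘ HSub.hSub x := rfl
      rw [partialD, e, this]
      simp [partialD]
  have h2 := hw _ hφ hφc
  simp only [hφd] at h2
  rw [h1, moll_apply, ← integral_sub_left_eq_self _ volume x,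
    ← integral_sub_left_eq_self (fun t => bumpN n t • w (x - t)) volume x]
  simp only [sub_sub_cancel, Complex.real_smul]
  rw [← neg_inj, ← h2, ← integral_neg]
  refine integral_congr_ae (Eventually.of_forall fun y => ?_)
  simp

/-- A fixed smooth cutoff function. -/
def cutoffBase : ContDiffBump (0 : Plane) := ⟨1, 2, one_pos, one_lt_two⟩

/-- Smooth cutoff functions exhausting the plane. -/
def cutoff (n : ℕ) (x : Plane) : ℝ := cutoffBase ((1 / ((n : ℝ) + 1)) • x)

theorem contDiff_cutoff (n : ℕ) : ContDiff ℝ ∞ (cutoff n) :=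
  cutoffBase.contDiff.comp (contDiff_const_smul _)

theorem hasCompactSupport_cutoff (n : ℕ) : HasCompactSupport (cutoff n) :=
  cutoffBase.hasCompactSupport.comp_smul (by positivity)

theorem abs_cutoff_le (n : ℕ) (x : Plane) : |cutoff n x| ≤ 1 := by
  rw [cutoff, abs_of_nonneg cutoffBase.nonneg]
  exact cutoffBase.le_one

theorem tendsto_smul_point (x : Plane) :
    Tendsto (fun n : ℕ => (1 / ((n : ℝ) + 1)) • x) atTop (𝓝 0) := by
  simpa using (tendsto_one_div_add_atTop_nhds_zero_nat (𝕜 := ℝ)).smul_const x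

theorem tendsto_cutoff (x : Plane) : Tendsto (fun n => cutoff n x) atTop (𝓝 1) := by
  have h := (cutoffBase.continuous.tendsto 0).comp (tendsto_smul_point x)
  rwa [cutoffBase.one_of_mem_closedBall (by simp [cutoffBase.rIn_pos.le])] at h

theorem partialD_cutoff (n : ℕ) (j : Fin 2) (x : Plane) :
    partialD j (cutoff n) x
      = 1 / ((n : ℝ) + 1) * partialD j cutoffBase ((1 / ((n : ℝ) + 1)) • x) := by
  have h := (((cutoffBase.contDiff (n := 1)).differentiable one_ne_zero
    ((1 / ((n : ℝ) + 1)) • x)).hasFDerivAt.comp x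
    ((hasFDerivAt_id x).const_smul (1 / ((n : ℝ) + 1)))).fderiv
  have e : cutoff n = cutoffBase ∘ HSMul.hSMul (1 / ((n : ℝ) + 1)) := rfl
  rw [partialD, e, h]
  simp [partialD]

theorem exists_bound_partialD_cutoff (j : Fin 2) :
    ∃ C, ∀ n x, |partialD j (cutoff n) x| ≤ 1 / ((n : ℝ) + 1) * C := by
  have hc : Continuous fun x => fderiv ℝ cutoffBase x (unitVec j) :=
    ((cutoffBase.contDiff (n := 1)).continuous_fderiv one_ne_zero).clm_apply continuous_const
  obtain ⟨C, hC⟩ := (cutoffBase.hasCompactSupport.fderiv_apply ℝ (unitVec j)).exists_bound_of_continuous hc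
  refine ⟨C, fun n x => ?_⟩
  rw [partialD_cutoff, abs_mul, abs_of_pos (by positivity)]
  exact mul_le_mul_of_nonneg_left (hC _) (by positivity)

theorem partialC_cutoff_mul {f : Plane → ℂ} (hf : ContDiff ℝ ∞ f) (n : ℕ) (j : Fin 2)
    (x : Plane) : partialC j (fun x => (cutoff n x : ℂ) * f x) x
      = cutoff n x * partialC j f x + partialD j (cutoff n) x * f x := by
  have h1 := ((contDiff_cutoff n).differentiable (by simp) x).hasFDerivAt
  have h2 := (hf.differentiable (by simp) x).hasFDerivAt
  have h3 := (h1.smul h2).fderiv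
  have e : (fun x => (cutoff n x : ℂ) * f x) = cutoff n • f := by
    funext x
    simp [Complex.real_smul]
  rw [partialC, e, h3]
  simp [partialC, partialD, Complex.real_smul]

theorem sqTendsto_cutoff_mul {f : Plane → ℂ} (hf : MemLp f 2 volume) :
    SqTendsto (fun n x => (cutoff n x : ℂ) * f x) f where
  mem n := memLp_mul_bdd hf
    (Complex.continuous_ofReal.comp (contDiff_cutoff n).continuous).aestronglyMeasurable (A := 1)
    fun x => by simpa using abs_cutoff_le n x
  mem_lim := hf
  tendsto := by
    have : Tendsto (fun n => ∫ x, ‖(cutoff n x : ℂ) * f x - f x‖ ^ 2) atTop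
        (𝓝 (∫ _ : Plane, (0 : ℝ))) := by
      refine tendsto_integral_of_dominated_convergence (fun x => 4 * ‖f x‖ ^ 2) (fun n => ?_)
        ((integrable_normSq hf).const_mul 4) (fun n => Eventually.of_forall fun x => ?_)
        (Eventually.of_forall fun x => ?_)
      · exact ((((Complex.continuous_ofReal.comp
          (contDiff_cutoff n).continuous).aestronglyMeasurable.mul hf.1).sub hf.1).norm.pow 2)
      · have e : (cutoff n x : ℂ) * f x - f x = ((cutoff n x - 1 : ℝ) : ℂ) * f x := by
          push_cast
          ring
        rw [Real.norm_of_nonneg (by positivity), e, norm_mul, mul_pow, Complex.norm_real]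
        have h1 : ‖cutoff n x - 1‖ ≤ 2 := by
          rw [Real.norm_eq_abs]
          have := abs_le.1 (abs_cutoff_le n x)
          rw [abs_le]
          constructor <;> linarith
        have h2 : ‖cutoff n x - 1‖ ^ 2 ≤ 2 ^ 2 := by gcongr
        nlinarith [sq_nonneg ‖f x‖]
      · have h1 := (((Complex.continuous_ofReal.tendsto _).comp (tendsto_cutoff x)).mul_const
          (f x)).sub_const (f x)
        have h2 := h1.norm.pow 2
        simpa using h2
    simpa using this

theorem sqTendsto_partialD_cutoff_mul {f : Plane → ℂ} (hf : MemLp f 2 volume) (j : Fin 2) :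
    SqTendsto (fun n x => (partialD j (cutoff n) x : ℂ) * f x) (fun _ => 0) := by
  obtain ⟨C, hC⟩ := exists_bound_partialD_cutoff j
  have hm : ∀ n, AEStronglyMeasurable (fun x => (partialD j (cutoff n) x : ℂ)) volume := fun n =>
    (Complex.continuous_ofReal.comp (((contDiff_cutoff n).continuous_fderiv (by simp)).clm_apply
      continuous_const)).aestronglyMeasurable
  refine ⟨fun n => memLp_mul_bdd hf (hm n) (A := 1 / ((n : ℝ) + 1) * C) fun x => by
    simpa using hC n x, MemLp.zero, ?_⟩
  have h : Tendsto (fun n : ℕ => (1 / ((n : ℝ) + 1) * C) ^ 2 * ∫ x, ‖f x‖ ^ 2) atTop (𝓝 0) := by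
    simpa using (((tendsto_one_div_add_atTop_nhds_zero_nat (𝕜 := ℝ)).mul_const C).pow 2).mul_const
      (∫ x, ‖f x‖ ^ 2)
  refine squeeze_zero (fun n => integral_nonneg fun x => by positivity) (fun n => ?_) h
  rw [← integral_const_mul]
  refine integral_mono_of_nonneg (Eventually.of_forall fun x => by positivity)
    ((integrable_normSq hf).const_mul _) (Eventually.of_forall fun x => ?_)
  simp only [sub_zero]
  rw [norm_mul, mul_pow, Complex.norm_real, Real.norm_eq_abs]
  have := hC n x
  gcongr

theorem integral_normSq_sub_lt {f g : Plane → ℂ} (hf : MemLp f 2 volume) {e : ℝ} (hg : MemLp g 2 volume)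
    (h1 : ∫ x, ‖f x - g x‖ ^ 2 < e) {k : Plane → ℂ} (hk : MemLp k 2 volume)
    (h2 : ∫ x, ‖k x - f x‖ ^ 2 < e) : ∫ x, ‖k x - g x‖ ^ 2 < 4 * e := by
  have h := integral_normSq_add_le (hk.sub hf) (hf.sub hg)
  simp only [Pi.sub_apply, sub_add_sub_cancel] at h
  linarith

/-- Test functions are dense in `H¹`. -/
theorem exists_testFunction_approx {u : Plane → ℂ} {w : Fin 2 → Plane → ℂ}
    (hu : MemLp u 2 volume) (hw : ∀ j, IsL2WeakPartial j u (w j)) :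
    ∃ φ : ℕ → Plane → ℂ, (∀ n, ContDiff ℝ ∞ (φ n)) ∧ (∀ n, HasCompactSupport (φ n)) ∧
      SqTendsto φ u ∧ ∀ j, SqTendsto (fun n => partialC j (φ n)) (w j) := by
  have key : ∀ e > 0, ∃ φ : Plane → ℂ, ContDiff ℝ ∞ φ ∧ HasCompactSupport φ ∧
      (∫ x, ‖φ x - u x‖ ^ 2 < e) ∧ ∀ j, ∫ x, ‖partialC j φ x - w j x‖ ^ 2 < e := by
    intro e he
    -- Mollification and cutoff each cost e/4, and `integral_normSq_sub_lt` multiplies by 4. The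
    -- mollified function is fixed before the cutoff radius is chosen.
    have he4 : 0 < e / 4 := by positivity
    have hm := sqTendsto_moll hu
    have hmw : ∀ j, SqTendsto (fun n => moll n (w j)) (w j) := fun j => sqTendsto_moll (hw j).1
    obtain ⟨n, hn, hnj⟩ := ((hm.tendsto.eventually_lt_const he4).and
      (eventually_all.2 fun j => (hmw j).tendsto.eventually_lt_const he4)).exists
    set f := moll n u with hf
    have hfs : ContDiff ℝ ∞ f := contDiff_moll n (MemLp.locInt hu)
    have hfd : ∀ j, partialC j f = moll n (w j) := fun j =>
      funext fun x => partialC_moll (MemLp.locInt hu) (hw j).2 n x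
    have hfL : MemLp f 2 volume := hm.mem n
    have hfdL : ∀ j, MemLp (partialC j f) 2 volume := fun j => by
      rw [hfd]
      exact (hmw j).mem n
    have hc := sqTendsto_cutoff_mul hfL
    have hcd : ∀ j, SqTendsto (fun m => partialC j fun x => (cutoff m x : ℂ) * f x)
        (partialC j f) := fun j => by
      have := (sqTendsto_cutoff_mul (hfdL j)).add (sqTendsto_partialD_cutoff_mul hfL j)
      simp only [add_zero] at this
      convert this using 2
      funext x
      exact partialC_cutoff_mul hfs _ j x
    obtain ⟨m, hm1, hm2⟩ := ((hc.tendsto.eventually_lt_const he4).and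
      (eventually_all.2 fun j => (hcd j).tendsto.eventually_lt_const he4)).exists
    refine ⟨fun x => (cutoff m x : ℂ) * f x, ?_, ?_, ?_, fun j => ?_⟩
    · exact (Complex.ofRealCLM.contDiff.comp (contDiff_cutoff m)).mul hfs
    · exact ((hasCompactSupport_cutoff m).comp_left (g := Complex.ofReal) rfl).mul_right
    · have := integral_normSq_sub_lt hfL hu hn (hc.mem m) hm1
      linarith
    · have h1 := hnj j
      have := integral_normSq_sub_lt (hfdL j) (hw j).1 (by rw [hfd]; exact h1) ((hcd j).mem m) (hm2 j)
      linarith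
  choose! φ h1 h2 h3 h4 using fun n : ℕ => key (1 / ((n : ℝ) + 1)) (by positivity)
  have hL : ∀ f : Plane → ℂ, Continuous f → HasCompactSupport f → MemLp f 2 volume :=
    fun f hf hfc => hf.memLp_of_hasCompactSupport hfc
  refine ⟨φ, h1, h2, ⟨fun n => hL _ (h1 n).continuous (h2 n), hu, ?_⟩, fun j =>
    ⟨fun n => hL _ (((h1 n).continuous_fderiv (by simp)).clm_apply continuous_const)
      ((h2 n).fderiv_apply ℝ _), (hw j).1, ?_⟩⟩
  · exact squeeze_zero (fun n => integral_nonneg fun x => by positivity) (fun n => (h3 n).le)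
      tendsto_one_div_add_atTop_nhds_zero_nat
  · exact squeeze_zero (fun n => integral_nonneg fun x => by positivity) (fun n => (h4 n j).le)
      tendsto_one_div_add_atTop_nhds_zero_nat

/-! ### The weighted Hardy inequality for `C¹` functions -/

theorem isL2WeakPartial_partialC {v : Plane → ℂ} (hv : ContDiff ℝ 1 v) (hc : HasCompactSupport v)
    (j : Fin 2) : IsL2WeakPartial j v (partialC j v) := by
  have hvd : Continuous (partialC j v) :=
    (hv.continuous_fderiv one_ne_zero).clm_apply continuous_const
  have hvdc : HasCompactSupport (partialC j v) := hc.fderiv_apply ℝ _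
  refine ⟨hvd.memLp_of_hasCompactSupport hvdc, fun φ hφ hφc => ?_⟩
  have hφd : Continuous fun x => fderiv ℝ φ x (unitVec j) :=
    (hφ.continuous_fderiv (by simp)).clm_apply continuous_const
  have h := integral_smul_fderiv_eq_neg_fderiv_smul_of_integrable (μ := volume) (f := φ) (g := v)
    (v := unitVec j) ((hφd.smul hv.continuous).integrable_of_hasCompactSupport hc.smul_left)
    ((hφ.continuous.smul hvd).integrable_of_hasCompactSupport hvdc.smul_left)
    ((hφ.continuous.smul hv.continuous).integrable_of_hasCompactSupport hc.smul_left)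
    (fun x _ => hφ.differentiable (by simp) x) (fun x _ => hv.differentiable one_ne_zero x)
  simp only [Complex.real_smul] at h
  rw [eq_neg_iff_add_eq_zero, add_comm, ← eq_neg_iff_add_eq_zero]
  exact h

/-- The weighted Hardy inequality for `C¹` compactly supported functions on the plane. -/
theorem hardy_contDiff_one {v : Plane → ℂ} (hv : ContDiff ℝ 1 v) (hvc : HasCompactSupport v)
    {α κ lam ρ C : ℝ} {w Q Q' : ℝ → ℝ}
    (hρ : 0 < ρ) (hκ : ∀ m : ℤ, κ ≤ ((m : ℝ) - α) ^ 2)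
    (hw : Continuous fun x : Plane => w ‖x‖) (hw0 : ∀ r, 0 ≤ w r)
    (hQ : ∀ r, ρ ≤ r → HasDerivAt Q (Q' r) r)
    (hin : ∀ r, 0 < r → r < ρ → C * w r ≤ (2 * lam - lam ^ 2 * r ^ 2 / ρ ^ 2) / ρ ^ 2)
    (hout : ∀ r, ρ < r → C * w r ≤ (κ - Q r ^ 2 - r * Q' r) / r ^ 2)
    (hbd : lam + α + Q ρ ≤ 0) :
    C * (∫ x : Plane, gMinus α ρ ‖x‖ ^ 2 * (w ‖x‖ * ‖v x‖ ^ 2))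
      ≤ ∫ x : Plane, gMinus α ρ ‖x‖ ^ 2 * ‖partialC 0 v x + Complex.I * partialC 1 v x‖ ^ 2 := by
  obtain ⟨R, hR⟩ := hvc.isCompact.isBounded.subset_closedBall (0 : Plane)
  have hv0 : ∀ x, R < ‖x‖ → v x = 0 := fun x hx => by
    refine image_eq_zero_of_notMem_tsupport fun hm => ?_
    have := hR hm
    rw [mem_closedBall_zero_iff] at this
    linarith
  have hd0 : ∀ j x, R < ‖x‖ → partialC j v x = 0 := fun j x hx => by
    have hx' : x ∉ tsupport v := fun hm => by
      have := hR hm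
      rw [mem_closedBall_zero_iff] at this
      linarith
    have : fderiv ℝ v x = 0 := by
      by_contra hne
      exact hx' (support_fderiv_subset ℝ hne)
    simp [partialC, this]
  have hvL : MemLp v 2 volume := hv.continuous.memLp_of_hasCompactSupport hvc
  have hwk := isL2WeakPartial_partialC hv hvc
  have hm := sqTendsto_moll hvL
  have hmd : ∀ j, SqTendsto (fun n => partialC j (moll n v)) (partialC j v) := fun j => by
    have e : (fun n => partialC j (moll n v)) = fun n => moll n (partialC j v) := by
      funext n x
      exact partialC_moll (MemLp.locInt hvL) (hwk j).2 n x
    rw [e]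
    exact sqTendsto_moll (hwk j).1
  have hmdbar := (hmd 0).add ((hmd 1).bdd_mul (a := fun _ => Complex.I) aestronglyMeasurable_const
    (A := 1) (fun _ => by simp))
  -- The mollifier radii are at most 1, so all approximants live in this ball; there the weights are
  -- bounded, though they need not be on the whole plane.
  set S : Set Plane := Metric.closedBall 0 (R + 1) with hS
  have hSc : IsCompact S := isCompact_closedBall _ _
  have hSm : MeasurableSet S := Metric.isClosed_closedBall.measurableSet
  have hgc : Continuous fun x : Plane => gMinus α ρ ‖x‖ ^ 2 :=
    (continuous_gMinus_sq hρ).comp continuous_norm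
  have lim : ∀ {W : Plane → ℝ}, Continuous W → (∀ x, 0 ≤ W x) → ∀ {F : ℕ → Plane → ℂ}
      {f : Plane → ℂ}, SqTendsto F f → (∀ n x, R + 1 < ‖x‖ → F n x = 0) →
      (∀ x, R + 1 < ‖x‖ → f x = 0) →
      Tendsto (fun n => ∫ x, W x * ‖F n x‖ ^ 2) atTop (𝓝 (∫ x, W x * ‖f x‖ ^ 2)) := by
    intro W hW hW0 F f hF hF0 hf0
    obtain ⟨A, hA⟩ := hSc.exists_bound_of_continuousOn hW.continuousOn
    have hA0 : 0 ≤ max A 0 := le_max_right _ _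
    have h := hF.tendsto_weighted (W := S.indicator W)
      (hW.aestronglyMeasurable.indicator hSm) (fun x => indicator_nonneg (fun x _ => hW0 x) x)
      (A := max A 0) (fun x => by
        by_cases hx : x ∈ S
        · rw [indicator_of_mem hx]
          exact (le_abs_self _).trans ((hA x hx).trans (le_max_left _ _))
        · rw [indicator_of_notMem hx]
          exact hA0)
    have e : ∀ g : Plane → ℂ, (∀ x, R + 1 < ‖x‖ → g x = 0) →
        (fun x => S.indicator W x * ‖g x‖ ^ 2) = fun x => W x * ‖g x‖ ^ 2 := fun g hg => by
      funext x
      by_cases hx : x ∈ S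
      · rw [indicator_of_mem hx]
      · have hx' : R + 1 < ‖x‖ := by simpa [hS] using hx
        simp [hg x hx']
    simp only [e _ (hF0 _), e _ hf0] at h
    exact h
  have hmd0 : ∀ j n x, R + 1 < ‖x‖ → partialC j (moll n v) x = 0 := fun j n x hx => by
    rw [partialC_moll (MemLp.locInt hvL) (hwk j).2 n x]
    exact moll_eq_zero (hd0 j) n hx
  have hl := lim (W := fun x => gMinus α ρ ‖x‖ ^ 2 * w ‖x‖) (hgc.mul hw)
    (fun x => mul_nonneg (sq_nonneg _) (hw0 _)) hm (fun n x hx => moll_eq_zero hv0 n hx)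
    (fun x hx => hv0 x (by linarith))
  have hr := lim (W := fun x => gMinus α ρ ‖x‖ ^ 2) hgc (fun x => sq_nonneg _) hmdbar
    (fun n x hx => by simp [hmd0 _ n x hx])
    (fun x hx => by simp [hd0 _ x (by linarith : R < ‖x‖)])
  have hl' : Tendsto (fun n => C * (∫ x : Plane, gMinus α ρ ‖x‖ ^ 2 * (w ‖x‖ * ‖moll n v x‖ ^ 2)))
      atTop (𝓝 (C * (∫ x : Plane, gMinus α ρ ‖x‖ ^ 2 * (w ‖x‖ * ‖v x‖ ^ 2)))) := by
    simp only [← mul_assoc (gMinus α ρ _ ^ 2)]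
    exact hl.const_mul C
  refine le_of_tendsto_of_tendsto' hl' hr fun n => ?_
  refine hardy_smooth (contDiff_moll n (MemLp.locInt hvL)) ?_ hρ hκ hw hQ hin hout hbd
  exact HasCompactSupport.intro hSc fun x hx => moll_eq_zero hv0 n (by simpa [hS] using hx)

end

section

/-! ### The quadratic form on test functions -/

/-- The magnetic derivative `i ∂_j φ + A_j φ` of a smooth function. -/
def magD (B : Plane → ℝ) (j : Fin 2) (φ : Plane → ℂ) (x : Plane) : ℂ :=
  Complex.I * partialC j φ x + (vectorPot B x j : ℂ) * φ x

theorem continuous_partialC {φ : Plane → ℂ} (hφ : ContDiff ℝ ∞ φ) (j : Fin 2) :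
    Continuous (partialC j φ) := (contDiff_fderiv_apply hφ _).continuous

theorem hasCompactSupport_partialC {φ : Plane → ℂ} (hc : HasCompactSupport φ) (j : Fin 2) :
    HasCompactSupport (partialC j φ) := hc.fderiv_apply ℝ _

theorem integrable_sq_of_compactSupport {f : Plane → ℂ} (hf : Continuous f)
    (hc : HasCompactSupport f) : Integrable fun x => ‖f x‖ ^ 2 :=
  integrable_normSq (hf.memLp_of_hasCompactSupport hc)

/-- A null Lagrangian. By parts, -∫⟨∂_0φ, i∂_1φ⟩ = ∫⟨φ, i∂_0∂_1φ⟩; the right side is symmetric in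
the two indices while the left side is antisymmetric. -/
theorem integral_inner_partialC {φ : Plane → ℂ} (hφ : ContDiff ℝ ∞ φ) (hc : HasCompactSupport φ) :
    ∫ x, inner ℝ (partialC 0 φ x) (Complex.I * partialC 1 φ x) = 0 := by
  have hcont := continuous_partialC hφ
  have hsupp := hasCompactSupport_partialC hc
  have hd : ∀ j, ContDiff ℝ ∞ fun x => Complex.I * partialC j φ x := fun j =>
    contDiff_const.mul (contDiff_fderiv_apply hφ _)
  have hdd : ∀ i j x, fderiv ℝ (fun x => Complex.I * partialC j φ x) x (unitVec i)
      = Complex.I * fderiv ℝ (partialC j φ) x (unitVec i) := fun i j x => by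
    have hdj : DifferentiableAt ℝ (partialC j φ) x :=
      (contDiff_fderiv_apply hφ (unitVec j)).differentiable (by simp) x
    rw [fderiv_const_mul hdj]
    rfl
  have hparts : ∀ i j, ∫ x, inner ℝ (φ x) (Complex.I * fderiv ℝ (partialC j φ) x (unitVec i))
      = -∫ x, inner ℝ (partialC i φ x) (Complex.I * partialC j φ x) := fun i j => by
    have hdc : Continuous fun x => fderiv ℝ (fun x => Complex.I * partialC j φ x) x (unitVec i) :=
      (contDiff_fderiv_apply (hd j) _).continuous
    have := integral_bilinear_fderiv_right_eq_neg_left_of_integrable (μ := volume)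
      (B := innerSL ℝ (E := ℂ)) (f := φ) (g := fun x => Complex.I * partialC j φ x)
      (v := unitVec i)
      (((hcont i).inner (hd j).continuous).integrable_of_hasCompactSupport
        ((hsupp i).mono fun x hx h0 => hx (by
          have h1 : fderiv ℝ φ x (unitVec i) = 0 := h0
          simp [h1])))
      ((hφ.continuous.inner hdc).integrable_of_hasCompactSupport
        (hc.mono fun x hx h0 => hx (by simp [h0])))
      ((hφ.continuous.inner (hd j).continuous).integrable_of_hasCompactSupport
        (hc.mono fun x hx h0 => hx (by simp [h0])))
      (fun x _ => hφ.differentiable (by simp) x) (fun x _ => (hd j).differentiable (by simp) x)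
    simp only [hdd] at this
    exact this
  have h01 := hparts 0 1
  have h10 := hparts 1 0
  have hcomm : ∀ x, fderiv ℝ (partialC 1 φ) x (unitVec 0) = fderiv ℝ (partialC 0 φ) x (unitVec 1) :=
    fun x => fderiv_fderiv_apply_comm hφ _ _ x
  simp only [hcomm] at h01
  rw [h01] at h10
  have hanti : ∫ x, inner ℝ (partialC 1 φ x) (Complex.I * partialC 0 φ x)
      = -∫ x, inner ℝ (partialC 0 φ x) (Complex.I * partialC 1 φ x) := by
    rw [← integral_neg]
    refine integral_congr_ae (Eventually.of_forall fun x => ?_)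
    simp only [Complex.inner, Complex.mul_re, Complex.mul_im, Complex.conj_re, Complex.conj_im,
      Complex.I_re, Complex.I_im]
    ring
  linarith

theorem contDiff_normSq {φ : Plane → ℂ} (hφ : ContDiff ℝ ∞ φ) :
    ContDiff ℝ 1 fun x => ‖φ x‖ ^ 2 := (hφ.norm_sq ℝ).of_le (by simp)

theorem hasCompactSupport_normSq {φ : Plane → ℂ} (hc : HasCompactSupport φ) :
    HasCompactSupport fun x => ‖φ x‖ ^ 2 :=
  hc.comp_left (g := fun z : ℂ => ‖z‖ ^ 2) (by simp)

theorem partialD_normSq {φ : Plane → ℂ} (hφ : ContDiff ℝ ∞ φ) (j : Fin 2) (x : Plane) :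
    partialD j (fun x => ‖φ x‖ ^ 2) x = 2 * inner ℝ (φ x) (partialC j φ x) := by
  rw [partialD, ((hφ.differentiable (by simp) x).hasFDerivAt.norm_sq).fderiv]
  simp [partialC]
  ring

variable {B : Plane → ℝ} {δ M : ℝ}

theorem PotentialBounds.continuous_partialD (h : PotentialBounds B δ M) (j : Fin 2) :
    Continuous fun x => partialD j (scalarPot B) x :=
  (h.contDiff_scalarPot.continuous_fderiv one_ne_zero).clm_apply continuous_const

theorem PotentialBounds.continuous_vectorPot (h : PotentialBounds B δ M) (j : Fin 2) :
    Continuous fun x => vectorPot B x j := by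
  fin_cases j
  · exact h.continuous_partialD 1
  · exact (h.continuous_partialD 0).neg

theorem PotentialBounds.continuous_magD (h : PotentialBounds B δ M) {φ : Plane → ℂ}
    (hφ : ContDiff ℝ ∞ φ) (j : Fin 2) : Continuous (magD B j φ) :=
  (continuous_const.mul (continuous_partialC hφ j)).add
    ((Complex.continuous_ofReal.comp (h.continuous_vectorPot j)).mul hφ.continuous)

theorem hasCompactSupport_magD {φ : Plane → ℂ} (hc : HasCompactSupport φ) (j : Fin 2) :
    HasCompactSupport (magD B j φ) :=
  (hasCompactSupport_partialC hc j).mul_left.add hc.mul_left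

theorem PotentialBounds.integrable_mul_sq (h : PotentialBounds B δ M) {φ : Plane → ℂ}
    (hφ : ContDiff ℝ ∞ φ) (hc : HasCompactSupport φ) : Integrable fun x => B x * ‖φ x‖ ^ 2 := by
  obtain ⟨C, hC⟩ := (hasCompactSupport_normSq hc).exists_bound_of_continuous
    (contDiff_normSq hφ).continuous
  exact h.int.mul_bdd (contDiff_normSq hφ).continuous.aestronglyMeasurable
    (Eventually.of_forall hC)

/-- The factorization `∑ |D_j φ|² - B |φ|² = |D_0 φ + i D_1 φ|²` under the integral. -/
theorem PotentialBounds.integral_magD_factor (h : PotentialBounds B δ M) {φ : Plane → ℂ}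
    (hφ : ContDiff ℝ ∞ φ) (hc : HasCompactSupport φ) :
    ∫ x, ‖magD B 0 φ x + Complex.I * magD B 1 φ x‖ ^ 2
      = (∑ j, ∫ x, ‖magD B j φ x‖ ^ 2) - ∫ x, B x * ‖φ x‖ ^ 2 := by
  have hcont := continuous_partialC hφ
  have hsupp := hasCompactSupport_partialC hc
  -- Expanding the square, the cross term splits into the null Lagrangian and -∇h·∇|φ|²; the latter
  -- integrates to -∫B|φ|² by the weak Poisson equation.
  have e : ∀ x, ‖magD B 0 φ x + Complex.I * magD B 1 φ x‖ ^ 2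
      = ‖magD B 0 φ x‖ ^ 2 + ‖magD B 1 φ x‖ ^ 2
        + 2 * inner ℝ (partialC 0 φ x) (Complex.I * partialC 1 φ x)
        - ∑ j, partialD j (scalarPot B) x * partialD j (fun x => ‖φ x‖ ^ 2) x := fun x => by
    rw [Fin.sum_univ_two, partialD_normSq hφ, partialD_normSq hφ]
    simp only [magD, vectorPot, Complex.inner,
      ← Complex.normSq_eq_norm_sq, Complex.normSq_apply, Matrix.cons_val_zero,
      Matrix.cons_val_one, Complex.mul_re, Complex.mul_im, Complex.conj_re,
      Complex.conj_im, Complex.add_re, Complex.add_im, Complex.ofReal_re, Complex.ofReal_im,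
      Complex.I_re, Complex.I_im]
    ring
  have i0 := integrable_sq_of_compactSupport (h.continuous_magD hφ 0) (hasCompactSupport_magD hc 0)
  have i1 := integrable_sq_of_compactSupport (h.continuous_magD hφ 1) (hasCompactSupport_magD hc 1)
  have i2 : Integrable fun x => 2 * inner ℝ (partialC 0 φ x) (Complex.I * partialC 1 φ x) :=
    (((hcont 0).inner (continuous_const.mul (hcont 1))).integrable_of_hasCompactSupport
        ((hsupp 0).mono fun x hx h0 => hx (by simp [h0]))).const_mul 2
  have i3 : Integrable fun x =>
      ∑ j, partialD j (scalarPot B) x * partialD j (fun x => ‖φ x‖ ^ 2) x :=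
    integrable_finsetSum _ fun j _ => ((h.continuous_partialD j).mul
      (((contDiff_normSq hφ).continuous_fderiv one_ne_zero).clm_apply
        continuous_const)).integrable_of_hasCompactSupport
      (((hasCompactSupport_normSq hc).fderiv_apply ℝ _).mul_left)
  have s1 := integral_add i0 i1
  have s2 := integral_add (i0.add i1) i2
  have s3 := integral_sub ((i0.add i1).add i2) i3
  rw [h.integral_partialD_mul (contDiff_normSq hφ) (hasCompactSupport_normSq hc)] at s3
  rw [integral_const_mul, integral_inner_partialC hφ hc] at s2
  simp only [Pi.add_apply] at s2 s3
  simp only [e]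
  rw [Fin.sum_univ_two]
  linarith

/-- The field is form-bounded with respect to the Laplacian. -/
theorem PotentialBounds.exists_form_bound (h : PotentialBounds B δ M) :
    ∃ A, 0 ≤ A ∧ ∀ φ : Plane → ℂ, ContDiff ℝ ∞ φ → HasCompactSupport φ →
      ∫ x, |B x| * ‖φ x‖ ^ 2
        ≤ A * (2 * (∫ x, ‖φ x‖ ^ 2) + ∑ j, ∫ x, ‖partialC j φ x‖ ^ 2) := by
  -- Applied to the potential H of |B|: ∫|B||φ|² = ∫∇H·∇|φ|², and ∇H is bounded.
  obtain ⟨A, hA0, hA⟩ := h.abs.exists_bound_partialD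
  refine ⟨A, hA0, fun φ hφ hc => ?_⟩
  have i0 := integrable_sq_of_compactSupport hφ.continuous hc
  have ij := fun j => integrable_sq_of_compactSupport (continuous_partialC hφ j)
    (hasCompactSupport_partialC hc j)
  have s1 := integral_add (ij 0) (ij 1)
  have s2 := integral_add (i0.const_mul 2) ((ij 0).add (ij 1))
  simp only [Pi.add_apply] at s2
  rw [integral_const_mul, s1] at s2
  rw [← h.abs.integral_partialD_mul (contDiff_normSq hφ) (hasCompactSupport_normSq hc),
    Fin.sum_univ_two, ← s2, ← integral_const_mul]
  have hpt : ∀ j x, |partialD j (scalarPot fun y => |B y|) x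
      * partialD j (fun x => ‖φ x‖ ^ 2) x| ≤ A * (‖φ x‖ ^ 2 + ‖partialC j φ x‖ ^ 2) :=
    fun j x => by
      rw [abs_mul, partialD_normSq hφ, abs_mul, abs_two]
      have h1 := abs_real_inner_le_norm (φ x) (partialC j φ x)
      refine mul_le_mul (hA j x) ?_ (by positivity) hA0
      nlinarith [sq_nonneg (‖φ x‖ - ‖partialC j φ x‖)]
  refine (le_abs_self _).trans ?_
  rw [← Real.norm_eq_abs]
  refine norm_integral_le_of_norm_le
    (((i0.const_mul 2).add ((ij 0).add (ij 1))).const_mul A) (Eventually.of_forall fun x => ?_)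
  rw [Fin.sum_univ_two, Real.norm_eq_abs]
  have := abs_add_le (partialD 0 (scalarPot fun y => |B y|) x
    * partialD 0 (fun x => ‖φ x‖ ^ 2) x) (partialD 1 (scalarPot fun y => |B y|) x
    * partialD 1 (fun x => ‖φ x‖ ^ 2) x)
  have h0 := hpt 0 x
  have h1 := hpt 1 x
  linarith

end

section

/-! ### The Hardy inequality on test functions -/

variable {B : Plane → ℝ} {δ M : ℝ}

/-- The gauge-transformed function `e^{-h} φ`. -/
def gauge (B : Plane → ℝ) (φ : Plane → ℂ) (x : Plane) : ℂ := Real.exp (-scalarPot B x) • φ x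

theorem PotentialBounds.contDiff_gauge (h : PotentialBounds B δ M) {φ : Plane → ℂ}
    (hφ : ContDiff ℝ ∞ φ) : ContDiff ℝ 1 (gauge B φ) :=
  h.contDiff_scalarPot.neg.exp.smul (hφ.of_le (by simp))

theorem hasCompactSupport_gauge {φ : Plane → ℂ} (hc : HasCompactSupport φ) :
    HasCompactSupport (gauge B φ) :=
  hc.mono fun x hx h0 => hx (by simp [gauge, h0])

theorem norm_gauge (φ : Plane → ℂ) (x : Plane) :
    ‖φ x‖ = Real.exp (scalarPot B x) * ‖gauge B φ x‖ := by
  rw [gauge, norm_smul, Real.norm_of_nonneg (Real.exp_nonneg _), ← mul_assoc, ← Real.exp_add,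
    add_neg_cancel, Real.exp_zero, one_mul]

theorem PotentialBounds.partialC_gauge (h : PotentialBounds B δ M) {φ : Plane → ℂ}
    (hφ : ContDiff ℝ ∞ φ) (j : Fin 2) (x : Plane) :
    partialC j (gauge B φ) x = Real.exp (-scalarPot B x) •
      (partialC j φ x - (partialD j (scalarPot B) x : ℂ) * φ x) := by
  have h1 := (h.contDiff_scalarPot.differentiable one_ne_zero x).hasFDerivAt.neg.exp
  have h2 := h1.smul (hφ.differentiable (by simp) x).hasFDerivAt
  have h3 : fderiv ℝ (gauge B φ) x = _ := h2.fderiv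
  rw [partialC, h3]
  simp [partialC, partialD]
  ring

/-- The conjugation D_0 + i D_1 = i e^h (∂_0 + i∂_1) e^{-h}, which removes the magnetic potential at
the price of the weight e^h. -/
theorem PotentialBounds.norm_magD_add (h : PotentialBounds B δ M) {φ : Plane → ℂ}
    (hφ : ContDiff ℝ ∞ φ) (x : Plane) :
    ‖magD B 0 φ x + Complex.I * magD B 1 φ x‖ = Real.exp (scalarPot B x) *
      ‖partialC 0 (gauge B φ) x + Complex.I * partialC 1 (gauge B φ) x‖ := by
  have e : partialC 0 (gauge B φ) x + Complex.I * partialC 1 (gauge B φ) x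
      = Real.exp (-scalarPot B x) • (-Complex.I * (magD B 0 φ x + Complex.I * magD B 1 φ x)) := by
    rw [h.partialC_gauge hφ, h.partialC_gauge hφ]
    simp only [magD, vectorPot, Matrix.cons_val_zero, Matrix.cons_val_one, Complex.real_smul]
    push_cast
    linear_combination Complex.exp (-(scalarPot B x : ℂ)) * (partialC 0 φ x
      + Complex.I * partialC 1 φ x
      - (partialD 0 (scalarPot B) x : ℂ) * φ x) * Complex.I_sq
  rw [e, norm_smul, Real.norm_of_nonneg (Real.exp_nonneg _), ← mul_assoc, ← Real.exp_add,
    add_neg_cancel, Real.exp_zero, one_mul, norm_mul, norm_neg, Complex.norm_I, one_mul]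

theorem kMinus_mul_le {ρ : ℝ} (hρ : 0 < ρ) (x : Plane) :
    kMinus B ρ * gMinus (flux B) ρ ‖x‖ ≤ Real.exp (scalarPot B x) := by
  have hg := gMinus_pos (α := flux B) (r := ‖x‖) hρ
  rw [← le_div_iff₀ hg]
  refine ciInf_le ⟨0, ?_⟩ x
  rintro _ ⟨y, rfl⟩
  exact div_nonneg (Real.exp_nonneg _) (gMinus_pos hρ).le

theorem kMinus_nonneg {ρ : ℝ} (hρ : 0 < ρ) : 0 ≤ kMinus B ρ :=
  le_ciInf fun _ => div_nonneg (Real.exp_nonneg _) (gMinus_pos hρ).le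

/-- A weighted Hardy inequality for the Cauchy–Riemann operator transfers to the magnetic
operator, at the cost of the factor `β₋`. -/
theorem PotentialBounds.hardy_testFunction (h : PotentialBounds B δ M) {ρ C : ℝ} (hρ : 0 < ρ)
    {w : ℝ → ℝ} (hC : 0 ≤ C) (hw : Continuous fun x : Plane => w ‖x‖) (hw0 : ∀ r, 0 ≤ w r)
    (hardy : ∀ v : Plane → ℂ, ContDiff ℝ 1 v → HasCompactSupport v →
      C * (∫ x : Plane, gMinus (flux B) ρ ‖x‖ ^ 2 * (w ‖x‖ * ‖v x‖ ^ 2))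
        ≤ ∫ x : Plane, gMinus (flux B) ρ ‖x‖ ^ 2
            * ‖partialC 0 v x + Complex.I * partialC 1 v x‖ ^ 2)
    {φ : Plane → ℂ} (hφ : ContDiff ℝ ∞ φ) (hc : HasCompactSupport φ) :
    betaMinus B ρ * C * (∫ x : Plane, w ‖x‖ * ‖φ x‖ ^ 2)
      ≤ ∫ x, ‖magD B 0 φ x + Complex.I * magD B 1 φ x‖ ^ 2 := by
  -- If the supremum is infinite, `capKMinus` takes the default value 0, division by zero gives β₋ =
  -- 0, and only nonnegativity of the right side is left. No asymptotics of h at infinity are then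
  -- needed.
  by_cases hK : BddAbove (range fun x : Plane =>
      Real.exp (scalarPot B x) / gMinus (flux B) ρ ‖x‖)
  swap
  · have : capKMinus B ρ = 0 := Real.iSup_of_not_bddAbove hK
    rw [betaMinus, this]
    simpa using integral_nonneg fun x => by positivity
  have hgpos : ∀ x : Plane, 0 < gMinus (flux B) ρ ‖x‖ := fun x => gMinus_pos hρ
  have hKle : ∀ x : Plane, Real.exp (scalarPot B x) ≤ capKMinus B ρ * gMinus (flux B) ρ ‖x‖ :=
    fun x => by
      rw [← div_le_iff₀ (hgpos x)]
      exact le_ciSup hK x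
  have hKpos : 0 < capKMinus B ρ := by
    have := (Real.exp_pos (scalarPot B 0)).trans_le (hKle 0)
    exact pos_of_mul_pos_left this (hgpos 0).le
  have hk0 := kMinus_nonneg (B := B) hρ
  have hv := h.contDiff_gauge hφ
  have hvc := hasCompactSupport_gauge (B := B) hc
  have hgc : Continuous fun x : Plane => gMinus (flux B) ρ ‖x‖ ^ 2 :=
    (continuous_gMinus_sq hρ).comp continuous_norm
  have hexp : Continuous fun x => Real.exp (scalarPot B x) :=
    Real.continuous_exp.comp h.contDiff_scalarPot.continuous
  have hpc : ∀ j, Continuous (partialC j (gauge B φ)) := fun j =>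
    (hv.continuous_fderiv one_ne_zero).clm_apply continuous_const
  have hL := hardy _ hv hvc
  have h1 : ∫ x : Plane, w ‖x‖ * ‖φ x‖ ^ 2 ≤ capKMinus B ρ ^ 2 *
      ∫ x : Plane, gMinus (flux B) ρ ‖x‖ ^ 2 * (w ‖x‖ * ‖gauge B φ x‖ ^ 2) := by
    rw [← integral_const_mul]
    refine integral_mono_of_nonneg (Eventually.of_forall fun x => mul_nonneg (hw0 _)
      (by positivity)) (Integrable.const_mul (Continuous.integrable_of_hasCompactSupport
        (hgc.mul (hw.mul (hv.continuous.norm.pow 2))) (hvc.mono fun x hx h0 => hx (by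
          simp [h0]))) _) (Eventually.of_forall fun x => ?_)
    simp only
    rw [norm_gauge (B := B) φ x, mul_pow]
    have := mul_le_mul_of_nonneg_right (pow_le_pow_left₀ (Real.exp_nonneg _) (hKle x) 2)
      (mul_nonneg (hw0 ‖x‖) (sq_nonneg ‖gauge B φ x‖))
    rw [mul_pow] at this
    linarith
  have h2 : kMinus B ρ ^ 2 * (∫ x : Plane, gMinus (flux B) ρ ‖x‖ ^ 2
      * ‖partialC 0 (gauge B φ) x + Complex.I * partialC 1 (gauge B φ) x‖ ^ 2)
      ≤ ∫ x, ‖magD B 0 φ x + Complex.I * magD B 1 φ x‖ ^ 2 := by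
    rw [← integral_const_mul]
    refine integral_mono_of_nonneg (Eventually.of_forall fun x => by positivity)
      (integrable_sq_of_compactSupport ((h.continuous_magD hφ 0).add
        (continuous_const.mul (h.continuous_magD hφ 1)))
        ((hasCompactSupport_magD hc 0).add (hasCompactSupport_magD hc 1).mul_left))
      (Eventually.of_forall fun x => ?_)
    simp only
    rw [h.norm_magD_add hφ, mul_pow, ← mul_assoc, ← mul_pow]
    have := kMinus_mul_le (B := B) hρ x
    have := (hgpos x).le
    gcongr
  rw [betaMinus, div_pow]
  calc kMinus B ρ ^ 2 / capKMinus B ρ ^ 2 * C * ∫ x : Plane, w ‖x‖ * ‖φ x‖ ^ 2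
      ≤ kMinus B ρ ^ 2 / capKMinus B ρ ^ 2 * C * (capKMinus B ρ ^ 2 *
        ∫ x : Plane, gMinus (flux B) ρ ‖x‖ ^ 2 * (w ‖x‖ * ‖gauge B φ x‖ ^ 2)) := by gcongr
    _ = kMinus B ρ ^ 2 * (C *
        ∫ x : Plane, gMinus (flux B) ρ ‖x‖ ^ 2 * (w ‖x‖ * ‖gauge B φ x‖ ^ 2)) := by
      field_simp
    _ ≤ _ := (mul_le_mul_of_nonneg_left hL (by positivity)).trans h2

/-! ### Radial weights -/

theorem distInt_nonneg (α : ℝ) : 0 ≤ distInt α := le_ciInf fun _ => abs_nonneg _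

theorem distInt_le (α : ℝ) (m : ℤ) : distInt α ≤ |(m : ℝ) - α| :=
  ciInf_le ⟨0, by rintro _ ⟨n, rfl⟩; exact abs_nonneg _⟩ m

theorem distInt_le_one (α : ℝ) : distInt α ≤ 1 := by
  refine (distInt_le α ⌊α⌋).trans ?_
  rw [abs_le]
  constructor <;> linarith [Int.floor_le α, Int.lt_floor_add_one α]

/-- The Hardy inequality for the weight `1 / (ρ² + r²)`. -/
theorem hardy_distInt {α ρ : ℝ} (hα : α ≤ 0) (hρ : 0 < ρ) {v : Plane → ℂ} (hv : ContDiff ℝ 1 v)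
    (hvc : HasCompactSupport v) :
    distInt α ^ 2 * (∫ x : Plane, gMinus α ρ ‖x‖ ^ 2 * ((ρ ^ 2 + ‖x‖ ^ 2)⁻¹ * ‖v x‖ ^ 2))
      ≤ ∫ x : Plane, gMinus α ρ ‖x‖ ^ 2
          * ‖partialC 0 v x + Complex.I * partialC 1 v x‖ ^ 2 := by
  have h0 := distInt_nonneg α
  have h1 := distInt_le_one α
  -- The integer m = 0 competes in the minimum; this gives the boundary condition at ρ for lam = μ_α
  -- and Q = 0.
  have h2 : distInt α ≤ -α := by simpa [abs_of_nonpos hα] using distInt_le α 0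
  refine hardy_contDiff_one (w := fun r => (ρ ^ 2 + r ^ 2)⁻¹) (Q := fun _ => 0) (Q' := fun _ => 0)
    (κ := distInt α ^ 2) (lam := distInt α) hv hvc hρ (fun m => ?_) ?_ (fun r => by positivity)
    (fun r _ => hasDerivAt_const _ _) (fun r hr hrρ => ?_) (fun r hr => ?_) (by linarith)
  · rw [← sq_abs ((m : ℝ) - α)]
    exact pow_le_pow_left₀ h0 (distInt_le α m) 2
  · exact Continuous.inv₀ (by fun_prop) fun x => by positivity
  · set μ := distInt α
    have hr2 : r ^ 2 ≤ ρ ^ 2 := by gcongr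
    have a1 : (ρ ^ 2 + r ^ 2)⁻¹ ≤ (ρ ^ 2)⁻¹ := by
      gcongr
      nlinarith
    have a2 : μ ^ 2 * r ^ 2 / ρ ^ 2 ≤ μ ^ 2 := by
      rw [div_le_iff₀ (by positivity)]
      gcongr
    calc μ ^ 2 * (ρ ^ 2 + r ^ 2)⁻¹ ≤ μ ^ 2 * (ρ ^ 2)⁻¹ := by gcongr
      _ = μ ^ 2 / ρ ^ 2 := by rw [div_eq_mul_inv]
      -- With lam = μ the claim is μ² ≤ 2μ - μ²r²/ρ², true for r ≤ ρ because 0 ≤ μ ≤ 1.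
      _ ≤ _ := by
        gcongr
        nlinarith
  · have hr0 := hρ.trans hr
    have a1 : (ρ ^ 2 + r ^ 2)⁻¹ ≤ (r ^ 2)⁻¹ := by
      gcongr
      nlinarith
    simp only [mul_zero, sub_zero, ne_eq, OfNat.ofNat_ne_zero, not_false_eq_true, zero_pow]
    rw [div_eq_mul_inv]
    gcongr

/-- The logarithmic weight `1 / (ρ² + r² (1 + log² (r / ρ)))`. -/
def logWeight (ρ r : ℝ) : ℝ := (ρ ^ 2 + r ^ 2 * (1 + Real.log (r / ρ) ^ 2))⁻¹

theorem logWeight_nonneg (ρ r : ℝ) : 0 ≤ logWeight ρ r := by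
  unfold logWeight
  positivity

theorem logWeight_le {ρ : ℝ} (hρ : 0 < ρ) (r : ℝ) : logWeight ρ r ≤ (ρ ^ 2)⁻¹ := by
  unfold logWeight
  gcongr
  have : 0 ≤ r ^ 2 * (1 + Real.log (r / ρ) ^ 2) := by positivity
  linarith

/-- Writing r² log²(r/ρ) as ρ² times the square of s log s with s = r/ρ settles continuity at r = 0.
-/
theorem continuous_logWeight {ρ : ℝ} (hρ : 0 < ρ) : Continuous (logWeight ρ) := by
  have h1 : Continuous fun r : ℝ => r / ρ * Real.log (r / ρ) :=
    Real.continuous_mul_log.comp (continuous_id.div_const ρ)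
  have h2 : logWeight ρ
      = fun r => (ρ ^ 2 + r ^ 2 + ρ ^ 2 * (r / ρ * Real.log (r / ρ)) ^ 2)⁻¹ := by
    funext r
    unfold logWeight
    congr 1
    field_simp
    ring
  rw [h2]
  exact Continuous.inv₀ (by fun_prop) fun r => by positivity

/-- The Hardy inequality for the logarithmic weight. -/
theorem hardy_log {α ρ : ℝ} (hα : α ≤ 0) (hint : ∃ n : ℤ, (n : ℝ) = α) (hρ : 0 < ρ)
    {v : Plane → ℂ} (hv : ContDiff ℝ 1 v) (hvc : HasCompactSupport v) :
    |α| / (4 * |α| + Real.pi)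
        * (∫ x : Plane, gMinus α ρ ‖x‖ ^ 2 * (logWeight ρ ‖x‖ * ‖v x‖ ^ 2))
      ≤ ∫ x : Plane, gMinus α ρ ‖x‖ ^ 2
          * ‖partialC 0 v x + Complex.I * partialC 1 v x‖ ^ 2 := by
  rw [abs_of_nonpos hα]
  rcases hα.eq_or_lt with h0 | hneg
  · rw [h0, neg_zero, zero_div, zero_mul]
    exact integral_nonneg fun x => by positivity
  -- Integrality enters here: α < 0 forces |α| ≥ 1, which leaves room for the boundary condition at
  -- ρ.
  have ha1 : 1 ≤ -α := by
    obtain ⟨n, rfl⟩ := hint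
    have : n < 0 := by exact_mod_cast hneg
    have : n ≤ -1 := by lia
    have : (n : ℝ) ≤ -1 := by exact_mod_cast this
    linarith
  set a := -α with ha
  have hπ := Real.pi_pos
  have hπ3 := Real.pi_gt_three
  -- The choice making 4C(1 + b²) = 1 for the constant C of the theorem.
  set b := Real.sqrt (Real.pi / (4 * a)) with hb
  have hb2 : b ^ 2 = Real.pi / (4 * a) := Real.sq_sqrt (by positivity)
  have hb0 : 0 < b := Real.sqrt_pos.2 (by positivity)
  set C := a / (4 * a + Real.pi) with hC
  have hC0 : 0 ≤ C := by positivity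
  have hCb : C * (4 * (1 + b ^ 2)) = 1 := by
    rw [hC, hb2]
    field_simp
  have hC4 : C ≤ 1 / 4 := by nlinarith [sq_nonneg b, mul_nonneg hC0 (sq_nonneg b)]
  have hlog0 : ∀ r, ρ ≤ r → 0 ≤ Real.log (r / ρ) := fun r hr =>
    Real.log_nonneg (by rwa [one_le_div hρ])
  -- In t = log(r/ρ) this Q is the drift of the one-dimensional Hardy inequality: -Q² - dQ/dt =
  -- 1/(4(t + b)²). The shift b > 0 keeps Q finite at r = ρ.
  refine hardy_contDiff_one (w := logWeight ρ) (κ := 0) (lam := 1 / 4)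
    (Q := fun r => (2 * (Real.log (r / ρ) + b))⁻¹)
    (Q' := fun r => -(2 * (Real.log (r / ρ) + b) ^ 2 * r)⁻¹) hv hvc hρ (fun m => sq_nonneg _)
    ((continuous_logWeight hρ).comp continuous_norm) (logWeight_nonneg ρ) (fun r hr => ?_)
    (fun r hr hrρ => ?_) (fun r hr => ?_) ?_
  · have hr0 := hρ.trans_le hr
    have hs : 0 < Real.log (r / ρ) + b := by linarith [hlog0 r hr]
    have h1 : HasDerivAt (fun r => 2 * (Real.log (r / ρ) + b)) (2 * (1 / ρ / (r / ρ))) r :=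
      ((((hasDerivAt_id r).div_const ρ).log (by simp; constructor <;> positivity)).add_const
        b).const_mul 2
    refine (h1.inv (by positivity)).congr_deriv ?_
    field_simp
  · have hr2 : r ^ 2 ≤ ρ ^ 2 := by gcongr
    have a2 : (1 / 4 : ℝ) ^ 2 * r ^ 2 / ρ ^ 2 ≤ 1 / 16 := by
      rw [div_le_iff₀ (by positivity)]
      nlinarith
    calc C * logWeight ρ r ≤ 1 / 4 * (ρ ^ 2)⁻¹ :=
          mul_le_mul hC4 (logWeight_le hρ r) (logWeight_nonneg ρ r) (by norm_num)
      _ = 1 / 4 / ρ ^ 2 := by rw [div_eq_mul_inv (1 / 4 : ℝ)]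
      _ ≤ _ := by
        gcongr
        linarith
  · have hr0 := hρ.trans hr
    set t := Real.log (r / ρ) with ht
    have ht0 : 0 ≤ t := hlog0 r hr.le
    have hs : 0 < t + b := by linarith
    have e : (0 : ℝ) - ((2 * (t + b))⁻¹) ^ 2 - r * -(2 * (t + b) ^ 2 * r)⁻¹
        = (4 * (t + b) ^ 2)⁻¹ := by
      field_simp
      ring
    simp only [e]
    have h1 : logWeight ρ r ≤ (r ^ 2 * (1 + t ^ 2))⁻¹ := by
      unfold logWeight
      gcongr
      linarith [sq_nonneg ρ]
    have h2 : C * (1 + t ^ 2)⁻¹ ≤ (4 * (t + b) ^ 2)⁻¹ := by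
      rw [← div_eq_mul_inv, ← one_div, div_le_div_iff₀ (by positivity) (by positivity)]
      -- Cauchy–Schwarz for the vectors (t, 1) and (1, b).
      have : (t + b) ^ 2 ≤ (1 + t ^ 2) * (1 + b ^ 2) := by nlinarith [sq_nonneg (t * b - 1)]
      nlinarith [mul_le_mul_of_nonneg_left this hC0]
    calc C * logWeight ρ r ≤ C * (r ^ 2 * (1 + t ^ 2))⁻¹ := by gcongr
      _ = C * (1 + t ^ 2)⁻¹ / r ^ 2 := by
        rw [mul_inv]
        ring
      _ ≤ _ := by gcongr
  -- The boundary condition 1/4 - a + 1/(2b) ≤ 0. Squared, it reads a/π ≤ (a - 1/4)², and a ≤ 3(a -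
  -- 1/4)² for a ≥ 1.
  · have h1 : (2 * b)⁻¹ ≤ a - 1 / 4 := by
      refine abs_le_of_sq_le_sq' ?_ (by linarith) |>.2
      rw [inv_pow, mul_pow, hb2]
      have : (2 ^ 2 * (Real.pi / (4 * a)))⁻¹ = a / Real.pi := by
        field_simp
        try ring
      rw [this, div_le_iff₀ hπ]
      have h3 : a ≤ (a - 1 / 4) ^ 2 * 3 := by nlinarith
      nlinarith [sq_nonneg (a - 1 / 4)]
    simp only [div_self hρ.ne', Real.log_one, zero_add]
    linarith

end

section

/-! ### Passage to the form domain -/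

theorem SqTendsto.comp {F : ℕ → Plane → ℂ} {f : Plane → ℂ} (hF : SqTendsto F f) {s : ℕ → ℕ}
    (hs : StrictMono s) : SqTendsto (fun n => F (s n)) f :=
  ⟨fun _ => hF.mem _, hF.mem_lim, hF.tendsto.comp hs.tendsto_atTop⟩

theorem SqTendsto.exists_subseq_ae {F : ℕ → Plane → ℂ} {f : Plane → ℂ} (hF : SqTendsto F f) :
    ∃ s : ℕ → ℕ, StrictMono s ∧ ∀ᵐ x, Tendsto (fun n => F (s n) x) atTop (𝓝 (f x)) := by
  have h1 : Tendsto (fun n => eLpNorm (F n - f) 2 volume) atTop (𝓝 0) := by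
    have e : ∀ n, eLpNorm (F n - f) 2 volume
        = ENNReal.ofReal (Real.sqrt (∫ x, ‖F n x - f x‖ ^ 2)) := fun n => by
      rw [((hF.mem n).sub hF.mem_lim).eLpNorm_eq_integral_rpow_norm (by norm_num) (by norm_num),
        Real.sqrt_eq_rpow]
      simp
    simp only [e]
    have := ENNReal.tendsto_ofReal (hF.tendsto.sqrt)
    simpa using this
  exact (tendstoInMeasure_of_tendsto_eLpNorm (by norm_num) (fun n => (hF.mem n).1)
    hF.mem_lim.1 h1).exists_seq_tendsto_ae

theorem SqTendsto.integral_sub_le {F : ℕ → Plane → ℂ} {f : Plane → ℂ} (hF : SqTendsto F f)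
    (n m : ℕ) : ∫ x, ‖F n x - F m x‖ ^ 2
      ≤ 2 * (∫ x, ‖F n x - f x‖ ^ 2) + 2 * ∫ x, ‖F m x - f x‖ ^ 2 := by
  have h := integral_normSq_add_le ((hF.mem n).sub hF.mem_lim) ((hF.mem m).sub hF.mem_lim).neg
  simp only [Pi.sub_apply, Pi.neg_apply, norm_neg] at h
  refine le_trans (le_of_eq ?_) h
  congr 1
  funext x
  congr 2
  ring

variable {B : Plane → ℝ} {δ M : ℝ}

theorem partialC_sub {φ ψ : Plane → ℂ} (hφ : ContDiff ℝ ∞ φ) (hψ : ContDiff ℝ ∞ ψ) (j : Fin 2)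
    (x : Plane) : partialC j (fun x => φ x - ψ x) x = partialC j φ x - partialC j ψ x := by
  rw [partialC, fderiv_fun_sub (hφ.differentiable (by simp) x) (hψ.differentiable (by simp) x)]
  rfl

/-- The form bound on the differences φ_n - φ_m, together with Fatou's lemma as m → ∞, controls
|B||φ_n - u|² although u is not a test function. Almost everywhere convergence is assumed for the
sake of Fatou. -/
theorem PotentialBounds.tendsto_weighted (h : PotentialBounds B δ M) {φ : ℕ → Plane → ℂ}
    {u : Plane → ℂ} {w : Fin 2 → Plane → ℂ} (hφ : ∀ n, ContDiff ℝ ∞ (φ n))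
    (hc : ∀ n, HasCompactSupport (φ n)) (hu : SqTendsto φ u)
    (hw : ∀ j, SqTendsto (fun n => partialC j (φ n)) (w j))
    (hae : ∀ᵐ x, Tendsto (fun n => φ n x) atTop (𝓝 (u x))) :
    (∀ n, Integrable fun x => |B x| * ‖φ n x - u x‖ ^ 2) ∧
      Tendsto (fun n => ∫ x, |B x| * ‖φ n x - u x‖ ^ 2) atTop (𝓝 0) := by
  obtain ⟨A, hA0, hA⟩ := h.exists_form_bound
  set E : ℕ → ℝ := fun n => A * (2 * (2 * ∫ x, ‖φ n x - u x‖ ^ 2)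
    + ∑ j, 2 * ∫ x, ‖partialC j (φ n) x - w j x‖ ^ 2) with hE
  have hE0 : Tendsto E atTop (𝓝 0) := by
    have := (((hu.tendsto.const_mul 2).const_mul 2).add
      (tendsto_finsetSum Finset.univ fun j _ => (hw j).tendsto.const_mul 2)).const_mul A
    simpa only [hE, mul_zero, Finset.sum_const_zero, add_zero] using this
  have hEnn : ∀ n, 0 ≤ E n := fun n => mul_nonneg hA0 (add_nonneg (by
    have : 0 ≤ ∫ x, ‖φ n x - u x‖ ^ 2 := integral_nonneg fun x => by positivity
    positivity) (Finset.sum_nonneg fun j _ => mul_nonneg zero_le_two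
      (integral_nonneg fun x => by positivity)))
  have hpair : ∀ n m, ∫ x, |B x| * ‖φ n x - φ m x‖ ^ 2 ≤ E n + E m := fun n m => by
    refine (hA (fun x => φ n x - φ m x) ((hφ n).sub (hφ m)) ((hc n).sub (hc m))).trans ?_
    simp only [hE]
    rw [← mul_add]
    refine mul_le_mul_of_nonneg_left ?_ hA0
    simp only [partialC_sub (hφ n) (hφ m), Fin.sum_univ_two]
    have h0 := hu.integral_sub_le n m
    have h1 := (hw 0).integral_sub_le n m
    have h2 := (hw 1).integral_sub_le n m
    linarith
  have hB : AEStronglyMeasurable B volume := h.int.1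
  have hmeas : ∀ {ψ χ : Plane → ℂ}, AEStronglyMeasurable ψ volume →
      AEStronglyMeasurable χ volume →
      AEStronglyMeasurable (fun x => |B x| * ‖ψ x - χ x‖ ^ 2) volume :=
    fun hψ hχ => hB.norm.mul ((hψ.sub hχ).norm.pow 2)
  have hpi : ∀ n m, Integrable fun x => |B x| * ‖φ n x - φ m x‖ ^ 2 := fun n m =>
    h.abs.integrable_mul_sq ((hφ n).sub (hφ m)) ((hc n).sub (hc m))
  have hl : ∀ n, ∫⁻ x, ENNReal.ofReal (|B x| * ‖φ n x - u x‖ ^ 2) ≤ ENNReal.ofReal (E n) := by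
    intro n
    have hlim : Tendsto (fun m => ENNReal.ofReal (E n + E m)) atTop
        (𝓝 (ENNReal.ofReal (E n))) := by
      have := ENNReal.tendsto_ofReal (hE0.const_add (E n))
      rwa [add_zero] at this
    calc ∫⁻ x, ENNReal.ofReal (|B x| * ‖φ n x - u x‖ ^ 2)
        = ∫⁻ x, liminf (fun m => ENNReal.ofReal (|B x| * ‖φ n x - φ m x‖ ^ 2)) atTop := by
          refine lintegral_congr_ae ?_
          filter_upwards [hae] with x hx
          have : Tendsto (fun m => |B x| * ‖φ n x - φ m x‖ ^ 2) atTop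
              (𝓝 (|B x| * ‖φ n x - u x‖ ^ 2)) :=
            (((tendsto_const_nhds.sub hx).norm.pow 2).const_mul _)
          exact (ENNReal.tendsto_ofReal this).liminf_eq.symm
      _ ≤ liminf (fun m => ∫⁻ x, ENNReal.ofReal (|B x| * ‖φ n x - φ m x‖ ^ 2)) atTop :=
          lintegral_liminf_le' fun m => (hpi n m).1.aemeasurable.ennreal_ofReal
      _ ≤ liminf (fun m => ENNReal.ofReal (E n + E m)) atTop := by
          refine liminf_le_liminf (Eventually.of_forall fun m => ?_)
          rw [← ofReal_integral_eq_lintegral_ofReal (hpi n m)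
            (Eventually.of_forall fun x => by positivity)]
          exact ENNReal.ofReal_le_ofReal (hpair n m)
      _ = _ := hlim.liminf_eq
  have hint : ∀ n, Integrable fun x => |B x| * ‖φ n x - u x‖ ^ 2 := fun n => by
    refine (lintegral_ofReal_ne_top_iff_integrable (hmeas (hu.mem n).1 hu.mem_lim.1)
      (Eventually.of_forall fun x => by positivity)).1 ?_
    exact ((hl n).trans_lt ENNReal.ofReal_lt_top).ne
  refine ⟨hint, squeeze_zero (fun n => integral_nonneg fun x => by positivity) (fun n => ?_) hE0⟩
  have := hl n
  rw [← ofReal_integral_eq_lintegral_ofReal (hint n)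
    (Eventually.of_forall fun x => by positivity)] at this
  exact (ENNReal.ofReal_le_ofReal_iff (hEnn n)).1 this

theorem isL2WeakPartial_weakPartial {u : Plane → ℂ} (hu : MemH1 u) (j : Fin 2) :
    IsL2WeakPartial j u (weakPartial j u) := by
  rw [weakPartial, dif_pos (hu.2 j)]
  exact (hu.2 j).choose_spec

theorem integrable_weight_mul {u : Plane → ℂ} (hu : MemLp u 2 volume) {w : ℝ → ℝ} {A : ℝ}
    (hw : Continuous fun x : Plane => w ‖x‖) (hw0 : ∀ r, 0 ≤ w r) (hwA : ∀ r, w r ≤ A) :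
    Integrable fun x : Plane => w ‖x‖ * ‖u x‖ ^ 2 :=
  (integrable_normSq hu).bdd_mul hw.aestronglyMeasurable (c := A)
    (Eventually.of_forall fun x => by rw [Real.norm_of_nonneg (hw0 _)]; exact hwA _)

/-- A weighted Hardy inequality for test functions extends to the form domain. -/
theorem PotentialBounds.hardy_memH1 (h : PotentialBounds B δ M) {u : Plane → ℂ} (hu : MemH1 u) :
    Integrable (densityMinus B u) ∧ ∀ (C A : ℝ) (w : ℝ → ℝ), (Continuous fun x : Plane => w ‖x‖) →
      (∀ r, 0 ≤ w r) → (∀ r, w r ≤ A) →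
      (∀ φ : Plane → ℂ, ContDiff ℝ ∞ φ → HasCompactSupport φ →
        C * (∫ x : Plane, w ‖x‖ * ‖φ x‖ ^ 2)
          ≤ ∫ x, ‖magD B 0 φ x + Complex.I * magD B 1 φ x‖ ^ 2) →
      C * (∫ x : Plane, w ‖x‖ * ‖u x‖ ^ 2) ≤ formMinus B u := by
  obtain ⟨ψ, hψ, hψc, hψu, hψw⟩ :=
    exists_testFunction_approx hu.1 (isL2WeakPartial_weakPartial hu)
  obtain ⟨s, hs, hae⟩ := hψu.exists_subseq_ae
  obtain ⟨φ, hφdef⟩ : ∃ φ : ℕ → Plane → ℂ, φ = fun n => ψ (s n) := ⟨_, rfl⟩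
  have hφ : ∀ n, ContDiff ℝ ∞ (φ n) := fun n => hφdef ▸ hψ _
  have hc : ∀ n, HasCompactSupport (φ n) := fun n => hφdef ▸ hψc _
  have hφu : SqTendsto φ u := hφdef ▸ hψu.comp hs
  have hφw : ∀ j, SqTendsto (fun n => partialC j (φ n)) (weakPartial j u) :=
    fun j => hφdef ▸ (hψw j).comp hs
  have hφae : ∀ᵐ x, Tendsto (fun n => φ n x) atTop (𝓝 (u x)) := hφdef ▸ hae
  obtain ⟨hdi, hdt⟩ := h.tendsto_weighted hφ hc hφu hφw hφae
  have hB : AEStronglyMeasurable B volume := h.int.1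
  have hmag : ∀ j, SqTendsto (fun n => magD B j (φ n))
      (fun x => Complex.I * weakPartial j u x + (vectorPot B x j : ℂ) * u x) := fun j => by
    obtain ⟨A, hA0, hA⟩ := h.exists_bound_partialD
    refine ((hφw j).bdd_mul (a := fun _ => Complex.I) (A := 1) aestronglyMeasurable_const
      (by simp)).add (hφu.bdd_mul (a := fun x => (vectorPot B x j : ℂ)) (A := A)
        (Complex.continuous_ofReal.comp (h.continuous_vectorPot j)).aestronglyMeasurable
        fun x => ?_)
    rw [Complex.norm_real, Real.norm_eq_abs]
    fin_cases j
    · simpa [vectorPot] using hA 1 x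
    · simpa [vectorPot] using hA 0 x
  have habs : Integrable fun x => |B x| * ‖u x‖ ^ 2 := by
    refine (((hdi 0).const_mul 2).add ((h.abs.integrable_mul_sq (hφ 0) (hc 0)).const_mul 2)).mono'
      (hB.norm.mul (hu.1.1.norm.pow 2)) (Eventually.of_forall fun x => ?_)
    rw [Real.norm_of_nonneg (by positivity)]
    simp only [Pi.add_apply]
    have h1 : ‖u x‖ ≤ ‖φ 0 x - u x‖ + ‖φ 0 x‖ := by
      have := norm_sub_norm_le (u x) (φ 0 x)
      rw [norm_sub_rev] at this
      linarith
    have h2 : ‖u x‖ ^ 2 ≤ 2 * ‖φ 0 x - u x‖ ^ 2 + 2 * ‖φ 0 x‖ ^ 2 := by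
      have := pow_le_pow_left₀ (norm_nonneg _) h1 2
      nlinarith [sq_nonneg (‖φ 0 x - u x‖ - ‖φ 0 x‖)]
    nlinarith [mul_le_mul_of_nonneg_left h2 (abs_nonneg (B x))]
  -- `tendsto_integral_weighted_sq` wants a nonnegative weight, so B is treated through its positive
  -- and negative parts, both dominated by |B|.
  have hpart : ∀ W : Plane → ℝ, AEStronglyMeasurable W volume → (∀ x, 0 ≤ W x) →
      (∀ x, W x ≤ |B x|) → (∀ v : Plane → ℂ, AEStronglyMeasurable v volume →
        (Integrable fun x => |B x| * ‖v x‖ ^ 2) → Integrable fun x => W x * ‖v x‖ ^ 2) ∧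
      Tendsto (fun n => ∫ x, W x * ‖φ n x‖ ^ 2) atTop (𝓝 (∫ x, W x * ‖u x‖ ^ 2)) := by
    intro W hWm hW hWB
    have hi : ∀ v : Plane → ℂ, AEStronglyMeasurable v volume →
        (Integrable fun x => |B x| * ‖v x‖ ^ 2) → Integrable fun x => W x * ‖v x‖ ^ 2 :=
      fun v hv hvi => hvi.mono' (hWm.mul (hv.norm.pow 2)) (Eventually.of_forall fun x => by
        rw [Real.norm_of_nonneg (mul_nonneg (hW x) (by positivity))]
        exact mul_le_mul_of_nonneg_right (hWB x) (by positivity))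
    have hid := fun n => hi (fun x => φ n x - u x) ((hφu.mem n).1.sub hu.1.1) (hdi n)
    refine ⟨hi, tendsto_integral_weighted_sq hW
      (fun n => hi _ (hφu.mem n).1 (h.abs.integrable_mul_sq (hφ n) (hc n)))
      (hi _ hu.1.1 habs) hid ?_⟩
    refine squeeze_zero (fun n => integral_nonneg fun x => mul_nonneg (hW x) (by positivity))
      (fun n => integral_mono (hid n) (hdi n) fun x => ?_) hdt
    exact mul_le_mul_of_nonneg_right (hWB x) (by positivity)
  obtain ⟨hpi, hpt⟩ := hpart (fun x => max (B x) 0) (hB.sup aestronglyMeasurable_const)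
    (fun x => le_max_right _ _) (fun x => max_le (le_abs_self _) (abs_nonneg _))
  obtain ⟨hni, hnt⟩ := hpart (fun x => max (-B x) 0) (hB.neg.sup aestronglyMeasurable_const)
    (fun x => le_max_right _ _) (fun x => max_le (neg_le_abs _) (abs_nonneg _))
  have hsplit : ∀ v : Plane → ℂ, AEStronglyMeasurable v volume →
      (Integrable fun x => |B x| * ‖v x‖ ^ 2) → ∫ x, B x * ‖v x‖ ^ 2
        = (∫ x, max (B x) 0 * ‖v x‖ ^ 2) - ∫ x, max (-B x) 0 * ‖v x‖ ^ 2 := fun v hv hvi => by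
    rw [← integral_sub (hpi v hv hvi) (hni v hv hvi)]
    refine integral_congr_ae (Eventually.of_forall fun x => ?_)
    simp only
    rw [← sub_mul]
    congr 1
    exact (posPart_sub_negPart (B x)).symm
  have hBt : Tendsto (fun n => ∫ x, B x * ‖φ n x‖ ^ 2) atTop (𝓝 (∫ x, B x * ‖u x‖ ^ 2)) := by
    rw [hsplit u hu.1.1 habs]
    refine (hpt.sub hnt).congr fun n => ?_
    exact (hsplit _ (hφu.mem n).1 (h.abs.integrable_mul_sq (hφ n) (hc n))).symm
  have hBi : Integrable fun x => B x * ‖u x‖ ^ 2 :=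
    habs.mono (hB.mul (hu.1.1.norm.pow 2)) (Eventually.of_forall fun x => by simp)
  have hki := fun j => integrable_normSq (hmag j).mem_lim
  have hform : formMinus B u = (∑ j, ∫ x,
      ‖Complex.I * weakPartial j u x + (vectorPot B x j : ℂ) * u x‖ ^ 2)
        - ∫ x, B x * ‖u x‖ ^ 2 := by
    rw [← integral_finsetSum _ fun j _ => hki j,
      ← integral_sub (integrable_finsetSum _ fun j _ => hki j) hBi]
    rfl
  refine ⟨(integrable_finsetSum _ fun j _ => hki j).sub hBi, fun C A w hw hw0 hwA hH => ?_⟩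
  rw [hform]
  refine le_of_tendsto_of_tendsto ((hφu.tendsto_weighted hw.aestronglyMeasurable (fun x => hw0 _)
    fun x => hwA _).const_mul C) ((tendsto_finsetSum Finset.univ fun j _ =>
      (hmag j).tendsto_integral).sub hBt) (Eventually.of_forall fun n => ?_)
  -- For each approximant, the factorization turns the squared Cauchy–Riemann expression into the
  -- form whose limit was just identified.
  exact (hH (φ n) (hφ n) (hc n)).trans_eq (h.integral_magD_factor (hφ n) (hc n))

end

end PauliHardy

end

/-! ### The Hardy inequalities for the spin-down form -/

theorem theorem2p5 (B : PauliHardy.Plane → ℝ) (hB : PauliHardy.AdmissibleField B)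
    (hα : PauliHardy.flux B ≤ 0) (u : PauliHardy.Plane → ℂ) (hu : PauliHardy.MemH1 u)
    (ρ : ℝ) (hρ : 0 < ρ) :
    MeasureTheory.Integrable (PauliHardy.densityMinus B u) ∧
    ((¬ ∃ n : ℤ, (n : ℝ) = PauliHardy.flux B) →
      MeasureTheory.Integrable (fun x : PauliHardy.Plane => ‖u x‖ ^ 2 / (ρ ^ 2 + ‖x‖ ^ 2)) ∧
      PauliHardy.betaMinus B ρ * PauliHardy.distInt (PauliHardy.flux B) ^ 2 *
          ∫ x : PauliHardy.Plane, ‖u x‖ ^ 2 / (ρ ^ 2 + ‖x‖ ^ 2)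
        ≤ PauliHardy.formMinus B u) ∧
    ((∃ n : ℤ, (n : ℝ) = PauliHardy.flux B) →
      MeasureTheory.Integrable (fun x : PauliHardy.Plane =>
        ‖u x‖ ^ 2 / (ρ ^ 2 + ‖x‖ ^ 2 * (1 + Real.log (‖x‖ / ρ) ^ 2))) ∧
      PauliHardy.betaMinus B ρ *
          (|PauliHardy.flux B| / (4 * |PauliHardy.flux B| + Real.pi)) *
          ∫ x : PauliHardy.Plane,
            ‖u x‖ ^ 2 / (ρ ^ 2 + ‖x‖ ^ 2 * (1 + Real.log (‖x‖ / ρ) ^ 2))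
        ≤ PauliHardy.formMinus B u) := by
  obtain ⟨δ, M, h⟩ := hB.potentialBounds
  obtain ⟨hi, hmain⟩ := h.hardy_memH1 hu
  have hwc : Continuous fun x : PauliHardy.Plane => (ρ ^ 2 + ‖x‖ ^ 2)⁻¹ :=
    Continuous.inv₀ (by fun_prop) fun x => by positivity
  have hw0 : ∀ r : ℝ, 0 ≤ (ρ ^ 2 + r ^ 2)⁻¹ := fun r => by positivity
  have hwA : ∀ r : ℝ, (ρ ^ 2 + r ^ 2)⁻¹ ≤ (ρ ^ 2)⁻¹ := fun r => by
    gcongr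
    linarith [sq_nonneg r]
  have hlc := (PauliHardy.continuous_logWeight hρ).comp
    (continuous_norm (E := PauliHardy.Plane))
  refine ⟨hi, fun _ => ?_, fun hint => ?_⟩
  · simp only [div_eq_inv_mul]
    exact ⟨PauliHardy.integrable_weight_mul hu.1 (w := fun r => (ρ ^ 2 + r ^ 2)⁻¹) hwc hw0 hwA,
      hmain _ _ (fun r => (ρ ^ 2 + r ^ 2)⁻¹) hwc hw0 hwA fun φ hφ hc =>
        h.hardy_testFunction (w := fun r => (ρ ^ 2 + r ^ 2)⁻¹) hρ (sq_nonneg _) hwc hw0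
          (fun v hv hvc => PauliHardy.hardy_distInt hα hρ hv hvc) hφ hc⟩
  · have e : ∀ x : PauliHardy.Plane,
        ‖u x‖ ^ 2 / (ρ ^ 2 + ‖x‖ ^ 2 * (1 + Real.log (‖x‖ / ρ) ^ 2))
          = PauliHardy.logWeight ρ ‖x‖ * ‖u x‖ ^ 2 := fun x => div_eq_inv_mul _ _
    simp only [e]
    exact ⟨PauliHardy.integrable_weight_mul hu.1 hlc (PauliHardy.logWeight_nonneg ρ)
        (PauliHardy.logWeight_le hρ),
      hmain _ _ _ hlc (PauliHardy.logWeight_nonneg ρ) (PauliHardy.logWeight_le hρ) fun φ hφ hc =>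
        h.hardy_testFunction hρ (div_nonneg (abs_nonneg _)
          (add_nonneg (mul_nonneg zero_le_four (abs_nonneg _)) Real.pi_pos.le)) hlc
          (PauliHardy.logWeight_nonneg ρ)
          (fun v hv hvc => PauliHardy.hardy_log hα hint hρ hv hvc) hφ hc⟩
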